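/- Fix $r\ge 3$. There is $\delta_0=\delta_0(r)>0$ such that for every $0<\delta<\delta_0$ and every degree bound $d\ge 1$ there is $n_0$ such that the following holds for all $n\ge n_0$, every graph $H$ on $r$ vertices, every graph $G=(V,E)$ with $V=[n]$ and all degrees at most $d$, and every $\varepsilon>n^{-\delta/\exp(2/\delta)}$. **Notation.** A random walk is lazy: from $v$ it stays with probability $1/2$; otherwise it picks $i\in[d]$ uniformly and moves to the $i$-th neighbour of $v$, staying at $v$ if there is none. $p_{s,t}(v)$ is the probability that a walk of length $t$ from $s$ ends at $v$. Put $\ell=n^{5\delta}$ and $\alpha=\varepsilon/(50r^4\log n)$. For $R\subseteq V$ and $s\in R$, $q^{(i)}_{[R],s}\in\mathbb R^{R}$ is the vector whose entry at $u\in R$ is the probability that a walk of length $2^i\ell$ from $s$ ends at $u$ and is in $R$ at its $j\ell$-th step for every $1\le j\le 2^i$. Lengths, numbers of repetitions and loop bounds are rounded up to integers. **FindMinor$(G,\varepsilon,H)$** (if $\varepsilon$ is below $n^{-\delta/\exp(2/\delta)}$, it just runs an exact $H$-minor finder on $G$) repeats the following $\varepsilon^{-2}n^{35\delta r^4}$ times,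 stopping as soon as an $H$-minor is output: pick $s\in V$ uniformly, and run LocalSearch$(s)$ and FindBiclique$(s)$. - LocalSearch$(s)$: for each $h=1,\dots,n^{7\delta r^4}$ perform $\varepsilon^{-1}n^{30\delta r^4}$ independent walks of length $h$ from $s$; let $B$ be the set of all destinations; run an exact $H$-minor finder on $G[B]$. - FindBiclique$(s)$: for $i=5r^4,\dots,1/\delta+4$: let the sequences $A$, $B$ be the destinations of $r^2$ independent walks each, of length $2^{i+1}\ell$ from $s$. For each $a\in A$, $b\in B$, perform $n^{\delta(i+18)/2}$ walks of length $2^i\ell$ from each of $a$ and $b$, and return all pairs (a walk from $a$, a walk from $b$) ending at the same vertex. If for all $a,b$ at least one pair is returned, run an exact $H$-minor finder on the subgraph formed by all returned walks. **Decompose$(G)$.** Start with $S=V$, $\mathcal P=\emptyset$. For $i=1,\dots,5r^4$: let $S'$ always denote $\{s\in S:\|q^{(i+1)}_{[S],s}\|_2^2\ge n^{-\delta i}\}$ for the current $S$. While $|S'|\ge\alpha n$, choose an arbitrary $s\in S'$ that has a piece and an arbitrary piece $P_s$ of $s$, add $P_s$ to $\mathcal P$ and replace $S$ by $S\setminus P_s$.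 Here a piece of $s$ is a nonempty $P_s\subseteq S$ such that at most $2n^{-\delta/4}d|P_s|$ edges run between $P_s$ and $S\setminus P_s$, and for all $v\in P_s$ there is $t\le160n^{\delta(i+7)}/\alpha$ with $p_{s,t}(v)\ge\alpha/n^{\delta(2i+14)}$. When the while loop ends, put $X_i=S'$ and replace $S$ by $S\setminus S'$. Finally let $X=\bigcup_iX_i$ and output $\mathcal P,X,S$. **Claim.** Suppose that FindMinor$(G,\varepsilon,H)$ outputs an $H$-minor with probability $<2/3$. Then Decompose$(G)$ never gets stuck (every partial run extends to a complete one) and always terminates, and each of its possible outputs consists of pairwise disjoint sets $P_s\in\mathcal P$, $X$, $S$ that partition $V$ and satisfy: - $|X|\le\varepsilon n/10$; - $|S|\le\varepsilon n/10$; - for all $P_s\in\mathcal P$ and $v\in P_s$ there is $t\le160n^{6\delta r^4}/\alpha$ such that $p_{s,t}(v)\ge\alpha/n^{11\delta r^4}$; - at most $\varepsilon n/10$ edges of $G$ run between different sets of $\mathcal P$. -/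

import Mathlib

namespace MinorFinding

noncomputable section

/-! ### Random walks on a graph with degree bound `d` -/

/-- One step of the lazy walk. With probability `1/2` stay; otherwise draw a uniform index
`i` among `d` and move to the `i`-th neighbour in the adjacency list, staying put if there is none. -/
def step {n : ℕ} (G : SimpleGraph (Fin n)) [DecidableRel G.Adj] (d : ℕ) [NeZero d]
    (v : Fin n) : PMF (Fin n) :=
  (PMF.uniformOfFintype Bool).bind fun lazy =>
    if lazy then PMF.pure v
    else (PMF.uniformOfFintype (Fin d)).map fun i =>
      ((G.neighborFinset v).sort (· ≤ ·)).getD i v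

/-- The random walk of length `t` from `s`, as a random list of `t + 1` vertices. -/
def walk {n : ℕ} (G : SimpleGraph (Fin n)) [DecidableRel G.Adj] (d : ℕ) [NeZero d] :
    Fin n → ℕ → PMF (List (Fin n))
  | s, 0 => PMF.pure [s]
  | s, t + 1 => (step G d s).bind fun v => (walk G d v t).map fun W => s :: W

/-- The law of the destination of a walk of length `t` from `s`. -/
def dest {n : ℕ} (G : SimpleGraph (Fin n)) [DecidableRel G.Adj] (d : ℕ) [NeZero d]
    (s : Fin n) (t : ℕ) : PMF (Fin n) :=
  (walk G d s t).map fun W => W.getLastD s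

/-- `p_{s,t}(v)`: the probability that a walk of length `t` from `s` ends at `v`. -/
def walkProb {n : ℕ} (G : SimpleGraph (Fin n)) [DecidableRel G.Adj] (d : ℕ) [NeZero d]
    (s : Fin n) (t : ℕ) (v : Fin n) : ℝ :=
  (dest G d s t v).toReal

/-- The basic walk length `ℓ = n ^ (5δ)`, rounded up. -/
def baseLength (n : ℕ) (δ : ℝ) : ℕ := ⌈(n : ℝ) ^ (5 * δ)⌉₊

/-- `q^{(i)}_{[R],s}(u)`: the probability that a walk of length `2^i ℓ` from `s` ends at `u` and
is in `R` at its `jℓ`-th step for all `1 ≤ j ≤ 2^i`. -/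
def returnProb {n : ℕ} (G : SimpleGraph (Fin n)) [DecidableRel G.Adj] (d : ℕ) [NeZero d]
    (δ : ℝ) (R : Finset (Fin n)) (i : ℕ) (s u : Fin n) : ℝ :=
  ((walk G d s (2 ^ i * baseLength n δ)).toOuterMeasure
    {W | W.getLast? = some u ∧
      ∀ j, 1 ≤ j → j ≤ 2 ^ i → ∃ w ∈ R, W[j * baseLength n δ]? = some w}).toReal

/-- The squared Euclidean norm of the vector `q^{(i)}_{[R],s}`, indexed by `R`. -/
def returnNormSq {n : ℕ} (G : SimpleGraph (Fin n)) [DecidableRel G.Adj] (d : ℕ) [NeZero d]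
    (δ : ℝ) (R : Finset (Fin n)) (i : ℕ) (s : Fin n) : ℝ :=
  ∑ u ∈ R, returnProb G d δ R i s u ^ 2

/-! ### Minors -/

/-- `B` is a model of `H` as a minor of the subgraph `F`: the branch sets `B x` are nonempty,
connected in `F`, pairwise disjoint, and joined by an edge of `F` for every edge of `H`. -/
def IsMinorModel {n r : ℕ} {G : SimpleGraph (Fin n)} (H : SimpleGraph (Fin r)) (F : G.Subgraph)
    (B : Fin r → Finset (Fin n)) : Prop :=
  (∀ x, (B x : Set (Fin n)) ⊆ F.verts ∧ (F.induce (B x : Set (Fin n))).Connected) ∧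
  (∀ x y, x ≠ y → Disjoint (B x) (B y)) ∧
  (∀ x y, H.Adj x y → ∃ u ∈ B x, ∃ v ∈ B y, F.Adj u v)

open Classical in
/-- An exact `H`-minor finding procedure: it returns an `H`-minor of `F` exactly if there is one. -/
def exactMinor {n r : ℕ} {G : SimpleGraph (Fin n)} (H : SimpleGraph (Fin r)) (F : G.Subgraph) :
    Option (Fin r → Finset (Fin n)) :=
  if h : ∃ B, IsMinorModel H F B then some h.choose else none

/-- The subgraph formed by the vertices and the edges that the given walks traverse. -/
def walksSubgraph {n : ℕ} (G : SimpleGraph (Fin n)) (L : List (List (Fin n))) : G.Subgraph where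
  verts := {v | ∃ W ∈ L, v ∈ W}
  Adj u v := G.Adj u v ∧ ∃ W ∈ L, [u, v] <:+: W ∨ [v, u] <:+: W
  adj_sub h := h.1
  edge_vert := by
    rintro u v ⟨-, W, hW, h | h⟩
    · exact ⟨W, hW, h.subset (by simp)⟩
    · exact ⟨W, hW, h.subset (by simp)⟩
  symm := ⟨by
    rintro u v ⟨h, W, hW, hh⟩
    exact ⟨h.symm, W, hW, hh.symm⟩⟩

/-! ### The randomized algorithm -/

/-- Independent samples, one from each distribution of the list. -/
def independent {β : Type} : List (PMF β) → PMF (List β)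
  | [] => PMF.pure []
  | p :: ps => p.bind fun a => (independent ps).map fun as => a :: as

/-- Run the procedures of the list one after the other, with fresh randomness, until one of them
outputs something; output that and terminate. -/
def firstOutput {β : Type} : List (PMF (Option β)) → PMF (Option β)
  | [] => PMF.pure none
  | p :: ps => p.bind fun o =>
      match o with
      | some b => PMF.pure (some b)
      | none => firstOutput ps

/-- `ε_CUTOFF = n ^ (-δ / exp (2/δ))`. -/
def cutoff (n : ℕ) (δ : ℝ) : ℝ := (n : ℝ) ^ (-δ / Real.exp (2 / δ))

/-- `LocalSearch(s)`. Numbers of repetitions are rounded up, here and below. -/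
def localSearch {n r : ℕ} (G : SimpleGraph (Fin n)) [DecidableRel G.Adj] (d : ℕ) [NeZero d]
    (H : SimpleGraph (Fin r)) (δ ε : ℝ) (s : Fin n) : PMF (Option (Fin r → Finset (Fin n))) :=
  (independent ((List.Ico 1 (⌈(n : ℝ) ^ (7 * δ * r ^ 4)⌉₊ + 1)).flatMap fun h =>
      List.replicate ⌈ε⁻¹ * (n : ℝ) ^ (30 * δ * r ^ 4)⌉₊ (dest G d s h))).map fun B =>
    exactMinor H ((⊤ : G.Subgraph).induce {v | v ∈ B})

/-- `FindPath(u, v, k, i)`: perform `k` walks of length `2^i ℓ` from each of `u` and `v`, and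
return all the pairs (one walk from `u`, one from `v`) that end at the same vertex. -/
def findPath {n : ℕ} (G : SimpleGraph (Fin n)) [DecidableRel G.Adj] (d : ℕ) [NeZero d]
    (δ : ℝ) (u v : Fin n) (k i : ℕ) : PMF (List (List (Fin n) × List (Fin n))) :=
  (independent (List.replicate k (walk G d u (2 ^ i * baseLength n δ)))).bind fun Wu =>
    (independent (List.replicate k (walk G d v (2 ^ i * baseLength n δ)))).map fun Wv =>
      (Wu ×ˢ Wv).filter fun p => p.1.getLast? = p.2.getLast?

open Classical in
/-- The `i`-th iteration of the loop of `FindBiclique(s)`. -/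
def findBicliqueIter {n r : ℕ} (G : SimpleGraph (Fin n)) [DecidableRel G.Adj] (d : ℕ) [NeZero d]
    (H : SimpleGraph (Fin r)) (δ : ℝ) (s : Fin n) (i : ℕ) :
    PMF (Option (Fin r → Finset (Fin n))) :=
  (independent (List.replicate (r ^ 2) (dest G d s (2 ^ (i + 1) * baseLength n δ)))).bind fun A =>
  (independent (List.replicate (r ^ 2) (dest G d s (2 ^ (i + 1) * baseLength n δ)))).bind fun B =>
  (independent ((A ×ˢ B).map fun ab =>
      findPath G d δ ab.1 ab.2 ⌈(n : ℝ) ^ (δ * (i + 18) / 2)⌉₊ i)).map fun found =>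
    if ∀ paths ∈ found, paths ≠ [] then
      exactMinor H (walksSubgraph G (found.flatten.flatMap fun p => [p.1, p.2]))
    else none

/-- `FindBiclique(s)`: iterations `i = 5r^4, …, 1/δ + 4`. -/
def findBiclique {n r : ℕ} (G : SimpleGraph (Fin n)) [DecidableRel G.Adj] (d : ℕ) [NeZero d]
    (H : SimpleGraph (Fin r)) (δ : ℝ) (s : Fin n) : PMF (Option (Fin r → Finset (Fin n))) :=
  firstOutput ((List.Ico (5 * r ^ 4) (⌈1 / δ⌉₊ + 4 + 1)).map (findBicliqueIter G d H δ s))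

open Classical in
/-- `FindMinor(G, ε, H)`; the output `none` means that no minor is returned. -/
def findMinor {n r : ℕ} [NeZero n] (G : SimpleGraph (Fin n)) [DecidableRel G.Adj] (d : ℕ)
    [NeZero d] (H : SimpleGraph (Fin r)) (δ ε : ℝ) : PMF (Option (Fin r → Finset (Fin n))) :=
  if ε < cutoff n δ then PMF.pure (exactMinor H (⊤ : G.Subgraph))
  else firstOutput (List.replicate ⌈(ε ^ 2)⁻¹ * (n : ℝ) ^ (35 * δ * r ^ 4)⌉₊
    ((PMF.uniformOfFintype (Fin n)).bind fun s =>
      firstOutput [localSearch G d H δ ε s, findBiclique G d H δ s]))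

/-- The probability that `FindMinor(G, ε, H)` outputs an `H`-minor. -/
def findMinorSuccess {n r : ℕ} [NeZero n] (G : SimpleGraph (Fin n)) [DecidableRel G.Adj] (d : ℕ)
    [NeZero d] (H : SimpleGraph (Fin r)) (δ ε : ℝ) : ℝ :=
  ((findMinor G d H δ ε).toOuterMeasure {o | o.isSome}).toReal

/-! ### The decomposition procedure -/

/-- `α = ε / (50 r^4 log n)`. -/
def alpha (n r : ℕ) (ε : ℝ) : ℝ := ε / (50 * r ^ 4 * Real.log n)

open Classical in
/-- The set `S' = {s ∈ S : ‖q^{(i+1)}_{[S],s}‖² ≥ 1 / n^{δ i}}`. -/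
def trapped {n : ℕ} (G : SimpleGraph (Fin n)) [DecidableRel G.Adj] (d : ℕ) [NeZero d]
    (δ : ℝ) (i : ℕ) (S : Finset (Fin n)) : Finset (Fin n) :=
  S.filter fun s => 1 / (n : ℝ) ^ (δ * i) ≤ returnNormSq G d δ S (i + 1) s

/-- `P` can be taken as the piece `P_s` cut out of `S` in phase `i`: a nonempty subset of `S` with
few edges to the rest of `S`, all of whose vertices are reached from `s` by short walks in `G`. -/
def IsPiece {n : ℕ} (G : SimpleGraph (Fin n)) [DecidableRel G.Adj] (d : ℕ) [NeZero d]
    (δ α : ℝ) (i : ℕ) (S : Finset (Fin n)) (s : Fin n) (P : Finset (Fin n)) : Prop :=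
  P.Nonempty ∧ P ⊆ S ∧
  ((G.interedges P (S \ P)).card : ℝ) ≤ 2 * (n : ℝ) ^ (-δ / 4) * d * P.card ∧
  ∀ v ∈ P, ∃ t : ℕ, (t : ℝ) ≤ 160 * (n : ℝ) ^ (δ * (i + 7)) / α ∧
    α / (n : ℝ) ^ (δ * (2 * i + 14)) ≤ walkProb G d s t v

/-- A state of `Decompose`: the loop index `i`, the pieces found so far (each with its vertex `s`),
the excess set `X` and the current set `S`. -/
structure DecomposeState (n : ℕ) where
  phase : ℕ
  pieces : List (Fin n × Finset (Fin n))
  X : Finset (Fin n)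
  S : Finset (Fin n)

/-- The initial state. -/
def DecomposeState.init (n : ℕ) : DecomposeState n := ⟨1, [], ∅, Finset.univ⟩

/-- One (nondeterministic) step of `Decompose`. -/
inductive DecomposeStep {n : ℕ} (G : SimpleGraph (Fin n)) [DecidableRel G.Adj] (d : ℕ) [NeZero d]
    (r : ℕ) (δ ε : ℝ) : DecomposeState n → DecomposeState n → Prop
  /-- While `|S'| ≥ αn`, choose an `s ∈ S'` that has a piece `P_s`, and cut such a piece out. -/
  | carve (i : ℕ) (L : List (Fin n × Finset (Fin n))) (X S : Finset (Fin n)) (s : Fin n)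
      (P : Finset (Fin n)) :
      i ≤ 5 * r ^ 4 → alpha n r ε * n ≤ (trapped G d δ i S).card → s ∈ trapped G d δ i S →
      IsPiece G d δ (alpha n r ε) i S s P →
      DecomposeStep G d r δ ε ⟨i, L, X, S⟩ ⟨i, (s, P) :: L, X, S \ P⟩
  /-- Once `|S'| < αn`, move `S'` to the excess set and go to the next phase. -/
  | advance (i : ℕ) (L : List (Fin n × Finset (Fin n))) (X S : Finset (Fin n)) :
      i ≤ 5 * r ^ 4 → ((trapped G d δ i S).card : ℝ) < alpha n r ε * n →
      DecomposeStep G d r δ ε ⟨i, L, X, S⟩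
        ⟨i + 1, L, X ∪ trapped G d δ i S, S \ trapped G d δ i S⟩

/-- `st'` can be reached from `st` by some number of steps of `Decompose`. -/
def DecomposeReaches {n : ℕ} (G : SimpleGraph (Fin n)) [DecidableRel G.Adj] (d : ℕ) [NeZero d]
    (r : ℕ) (δ ε : ℝ) (st st' : DecomposeState n) : Prop :=
  Relation.ReflTransGen (DecomposeStep G d r δ ε) st st'

/-- All phases `1, …, 5r^4` are over; the components of the state are the output. -/
def DecomposeState.IsFinal {n : ℕ} (r : ℕ) (st : DecomposeState n) : Prop :=
  st.phase = 5 * r ^ 4 + 1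

/-- The pieces, the set `X` and the set `S` partition the vertex set. -/
def DecomposeState.IsPartition {n : ℕ} (st : DecomposeState n) : Prop :=
  st.pieces.Pairwise (fun p p' => Disjoint p.2 p'.2) ∧
  (∀ p ∈ st.pieces, p.2.Nonempty ∧ Disjoint p.2 st.X ∧ Disjoint p.2 st.S) ∧
  Disjoint st.X st.S ∧
  ∀ v, v ∈ st.X ∨ v ∈ st.S ∨ ∃ p ∈ st.pieces, v ∈ p.2

/-- The set of edges of `G` that run between different pieces. -/
def crossEdges {n : ℕ} (G : SimpleGraph (Fin n)) (L : List (Fin n × Finset (Fin n))) :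
    Set (Sym2 (Fin n)) :=
  {e | e ∈ G.edgeSet ∧ ∃ p ∈ L, ∃ p' ∈ L, p.2 ≠ p'.2 ∧ ∃ u ∈ p.2, ∃ v ∈ p'.2, e = s(u, v)}

end

end MinorFinding

namespace MinorFinding

open scoped ENNReal

/-! Write x = n^δ and let M be the transition matrix of the walk; by the degree bound it is
symmetric, lazy and doubly stochastic. For a set R put Q = 1_R M^ℓ 1_R (`returnMatrix`). For s ∈ R
the vector q^{(i)}_{[R],s} is row s of Q^{2^i}, so its squared norm, called the level-i norm here,
is the diagonal entry Q^{2^{i+1}}(s,s). Hence it grows with R, decreases in i, and bounds all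
entries of Q^{2^{i+1}} by Cauchy–Schwarz.

Pieces exist (`exists_isPiece`), whether or not FindMinor fails. In phase i all level-i norms in S
are at most x^{-(i-1)}, while a trapped s has level-(i+1) norm at least x^{-i}. By a Kac-type count,
the walk from some trapped s visits S at least ⌈x⌉ times within ℓ steps, except for a small mass. If
no set of likely vertices were sparse, the Lovász–Simonovits method, applied to the chain induced on
S, would spread the walk out by then, so that the level-(i+1) norm would be too small. A sparse set
of likely vertices is a piece.

The final S is small (`card_le_of_isFree`). Otherwise go on removing trapped vertices up to phase
⌈1/δ⌉ + 4. Positive semidefiniteness of M forces some level-i norm in R to be at least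
(|R|/n)^{2^{i+1}}/n (`exists_returnNormSq_ge`), so the set left at the end is small and some phase i
removes many vertices s. For such s, the slow decay of the norm means that two ends of walks of
length 2^{i+1}ℓ from s form a good pair with probability at least x^{-2}/2: walks of length 2^i ℓ
from them meet with substantial probability (`sq_div_le_sum_returnMatrix_pow`,
`div_le_sum_indicator`). FindPath connects a good pair with probability at least 1/2 by the second
moment method. All r^4 pairs are good with probability at least (x^{-2}/2)^{r^4}, by the Sidorenko
inequality for complete bipartite graphs (`pow_le_sum_biclique`). Crossings of paths without a
common end are much rarer, since i > 5r^4 (`sum_sq_sum_throughProb_le`, `collision_error_le`).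
Without such crossings the paths contain every H as a minor (`exists_isMinorModel`). So an iteration
succeeds with probability at least x^{-3r^4}, and the repetitions in FindMinor raise this to 2/3.

The remaining claims follow from an invariant of Decompose and a decreasing potential. -/

/-- Expectation of a nonnegative extended random variable under a `PMF`. -/
noncomputable def expect {β : Type*} (p : PMF β) (f : β → ℝ≥0∞) : ℝ≥0∞ := ∑' x, p x * f x

/-! ### Expectations under a `PMF` -/

section Expect

variable {β γ : Type*}

lemma expect_pure (a : β) (f : β → ℝ≥0∞) : expect (PMF.pure a) f = f a := by
  classical
  unfold expect
  rw [tsum_eq_single a]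
  · simp
  · intro b hb
    simp [PMF.pure_apply, hb]

lemma expect_bind (p : PMF β) (q : β → PMF γ) (f : γ → ℝ≥0∞) :
    expect (p.bind q) f = expect p fun a => expect (q a) f := by
  unfold expect
  simp only [PMF.bind_apply, ← ENNReal.tsum_mul_left, ← ENNReal.tsum_mul_right]
  rw [ENNReal.tsum_comm]
  simp only [mul_assoc]

lemma expect_map (p : PMF β) (g : β → γ) (f : γ → ℝ≥0∞) :
    expect (p.map g) f = expect p fun a => f (g a) := by
  rw [← PMF.bind_pure_comp, expect_bind]
  simp [expect_pure]

lemma expect_mono_support {p : PMF β} {f g : β → ℝ≥0∞} (h : ∀ x ∈ p.support, f x ≤ g x) :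
    expect p f ≤ expect p g := by
  unfold expect
  refine ENNReal.tsum_le_tsum fun x => ?_
  by_cases hx : x ∈ p.support
  · gcongr; exact h x hx
  · rw [← PMF.apply_eq_zero_iff] at hx
    simp [hx]

lemma expect_congr_support {p : PMF β} {f g : β → ℝ≥0∞} (h : ∀ x ∈ p.support, f x = g x) :
    expect p f = expect p g :=
  le_antisymm (expect_mono_support fun x hx => (h x hx).le)
    (expect_mono_support fun x hx => (h x hx).ge)

lemma expect_mono {p : PMF β} {f g : β → ℝ≥0∞} (h : ∀ x, f x ≤ g x) :
    expect p f ≤ expect p g := expect_mono_support fun x _ => h x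

lemma expect_const (p : PMF β) (c : ℝ≥0∞) : expect p (fun _ => c) = c := by
  unfold expect
  rw [ENNReal.tsum_mul_right, p.tsum_coe, one_mul]

lemma expect_add (p : PMF β) (f g : β → ℝ≥0∞) :
    expect p (fun x => f x + g x) = expect p f + expect p g := by
  unfold expect
  simp only [mul_add, ENNReal.tsum_add]

lemma expect_const_mul (p : PMF β) (c : ℝ≥0∞) (f : β → ℝ≥0∞) :
    expect p (fun x => c * f x) = c * expect p f := by
  unfold expect
  rw [← ENNReal.tsum_mul_left]
  exact tsum_congr fun x => by ring

lemma expect_mul_const (p : PMF β) (c : ℝ≥0∞) (f : β → ℝ≥0∞) :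
    expect p (fun x => f x * c) = expect p f * c := by
  simp only [mul_comm _ c, expect_const_mul]

lemma expect_sum {ι : Type*} (p : PMF β) (s : Finset ι) (f : ι → β → ℝ≥0∞) :
    expect p (fun x => ∑ i ∈ s, f i x) = ∑ i ∈ s, expect p (f i) := by
  classical
  induction s using Finset.induction_on with
  | empty => simp [expect_const]
  | insert a s ha ih => simp only [Finset.sum_insert ha, expect_add, ih]

lemma expect_comm (p : PMF β) (q : PMF γ) (f : β → γ → ℝ≥0∞) :
    expect p (fun x => expect q (f x)) = expect q fun y => expect p fun x => f x y := by
  unfold expect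
  simp only [← ENNReal.tsum_mul_left]
  rw [ENNReal.tsum_comm]
  exact tsum_congr fun y => tsum_congr fun x => by ring

lemma toOuterMeasure_eq_expect (p : PMF β) (s : Set β) :
    p.toOuterMeasure s = expect p (s.indicator 1) := by
  classical
  rw [PMF.toOuterMeasure_apply]
  unfold expect
  refine tsum_congr fun x => ?_
  by_cases hx : x ∈ s <;> simp [hx]

lemma expect_fintype [Fintype β] (p : PMF β) (f : β → ℝ≥0∞) :
    expect p f = ∑ x, p x * f x := tsum_fintype _

/-! ### Independent samples -/

lemma expect_independent_nil {β : Type} (f : List β → ℝ≥0∞) :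
    expect (independent ([] : List (PMF β))) f = f [] := by
  simp [independent, expect_pure]

lemma expect_independent_cons {β : Type} (p : PMF β) (ps : List (PMF β)) (f : List β → ℝ≥0∞) :
    expect (independent (p :: ps)) f =
      expect p fun a => expect (independent ps) fun l => f (a :: l) := by
  simp [independent, expect_bind, expect_map]

lemma length_of_mem_support_independent {β : Type} {ps : List (PMF β)} {l : List β}
    (h : l ∈ (independent ps).support) : l.length = ps.length := by
  induction ps generalizing l with
  | nil => simp [independent] at h; simp [h]
  | cons p ps ih =>
    simp only [independent, PMF.mem_support_bind_iff, PMF.mem_support_map_iff] at h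
    obtain ⟨a, -, l', hl', rfl⟩ := h
    simp [ih hl']

lemma getElem_mem_support_of_independent {β : Type} {ps : List (PMF β)} {l : List β}
    (h : l ∈ (independent ps).support) (j : ℕ) {p : PMF β} {x : β}
    (hp : ps[j]? = some p) (hx : l[j]? = some x) : x ∈ p.support := by
  induction ps generalizing l j with
  | nil => simp at hp
  | cons q ps ih =>
    simp only [independent, PMF.mem_support_bind_iff, PMF.mem_support_map_iff] at h
    obtain ⟨a, ha, l', hl', rfl⟩ := h
    cases j with
    | zero => simp_all
    | succ j => exact ih hl' j (by simpa using hp) (by simpa using hx)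

lemma mem_support_of_mem_independent_replicate {β : Type} {k : ℕ} {p : PMF β} {l : List β}
    (h : l ∈ (independent (List.replicate k p)).support) {x : β} (hx : x ∈ l) :
    x ∈ p.support := by
  obtain ⟨j, hj⟩ := List.mem_iff_getElem?.1 hx
  have hlt : j < k := by
    have := (List.getElem?_eq_some_iff.1 hj).1
    rw [length_of_mem_support_independent h] at this
    simpa using this
  exact getElem_mem_support_of_independent h j (by simp [hlt]) hj

lemma expect_independent_getElem {β : Type} (ps : List (PMF β)) (j : ℕ) (p : PMF β)
    (hp : ps[j]? = some p) (g : Option β → ℝ≥0∞) :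
    expect (independent ps) (fun l => g l[j]?) = expect p fun a => g (some a) := by
  induction ps generalizing j with
  | nil => simp at hp
  | cons q ps ih =>
    rw [expect_independent_cons]
    cases j with
    | zero =>
      simp only [List.getElem?_cons_zero, Option.some.injEq] at hp ⊢
      subst hp
      simp [expect_const]
    | succ j =>
      simp only [List.getElem?_cons_succ] at hp ⊢
      rw [ih j hp, expect_const]

lemma expect_independent_getElem₂_of_lt {β : Type} (ps : List (PMF β)) {j j' : ℕ} (hj : j < j')
    {p p' : PMF β} (hp : ps[j]? = some p) (hp' : ps[j']? = some p')
    (g : Option β → Option β → ℝ≥0∞) :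
    expect (independent ps) (fun l => g l[j]? l[j']?) =
      expect p fun a => expect p' fun b => g (some a) (some b) := by
  induction ps generalizing j j' with
  | nil => simp at hp
  | cons q ps ih =>
    rw [expect_independent_cons]
    obtain ⟨j', rfl⟩ : ∃ i, j' = i + 1 := ⟨j' - 1, by omega⟩
    cases j with
    | zero =>
      simp only [List.getElem?_cons_zero, List.getElem?_cons_succ, Option.some.injEq] at hp hp' ⊢
      subst hp
      simp only [expect_independent_getElem ps j' p' hp']
    | succ j =>
      simp only [List.getElem?_cons_succ] at hp hp' ⊢
      rw [ih (by omega) hp hp', expect_const]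

lemma expect_independent_getElem₂ {β : Type} (ps : List (PMF β)) {j j' : ℕ} (hj : j ≠ j')
    {p p' : PMF β} (hp : ps[j]? = some p) (hp' : ps[j']? = some p')
    (g : Option β → Option β → ℝ≥0∞) :
    expect (independent ps) (fun l => g l[j]? l[j']?) =
      expect p fun a => expect p' fun b => g (some a) (some b) := by
  rcases lt_or_gt_of_ne hj with h | h
  · exact expect_independent_getElem₂_of_lt ps h hp hp' g
  · rw [expect_independent_getElem₂_of_lt ps h hp' hp fun a b => g b a, expect_comm]

lemma pow_le_expect_independent_forall {β : Type} (ps : List (PMF β)) (A : Set β) (c : ℝ≥0∞)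
    (h : ∀ p ∈ ps, c ≤ expect p (A.indicator 1)) :
    c ^ ps.length ≤ expect (independent ps) ({l | ∀ x ∈ l, x ∈ A}.indicator 1) := by
  classical
  induction ps with
  | nil => simp [expect_independent_nil]
  | cons p ps ih =>
    rw [expect_independent_cons]
    have : ∀ (a : β) (l : List β), ({l : List β | ∀ x ∈ l, x ∈ A}.indicator 1 (a :: l) : ℝ≥0∞) =
        A.indicator 1 a * ({l : List β | ∀ x ∈ l, x ∈ A}.indicator 1 l : ℝ≥0∞) := by
      intro a l
      by_cases ha : a ∈ A <;> simp [Set.indicator_apply, ha]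
    simp only [this, expect_const_mul, expect_mul_const]
    rw [List.length_cons, pow_succ']
    gcongr
    · exact h p (by simp)
    · exact ih fun q hq => h q (by simp [hq])

lemma expect_independent_replicate_sum {β : Type} (k : ℕ) (p : PMF β) (g : β → ℝ≥0∞) :
    expect (independent (List.replicate k p)) (fun l => (l.map g).sum) = k * expect p g := by
  induction k with
  | zero => simp [expect_independent_nil]
  | succ k ih =>
    rw [List.replicate_succ, expect_independent_cons]
    simp only [List.map_cons, List.sum_cons, expect_add, expect_const, ih]
    push_cast; ring

/-- Different samples are independent and contribute at most `k ^ 2` products of means; the diagonal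
of the expanded square gives the first term. -/
lemma expect_independent_replicate_sum_sq_le {β : Type} (k : ℕ) (p : PMF β) (g : β → ℝ≥0∞) :
    expect (independent (List.replicate k p)) (fun l => (l.map g).sum ^ 2) ≤
      k * expect p (fun x => g x ^ 2) + k ^ 2 * expect p g ^ 2 := by
  induction k with
  | zero => simp [expect_independent_nil]
  | succ k ih =>
    rw [List.replicate_succ, expect_independent_cons]
    have : ∀ (a : β) (l : List β), (((a :: l).map g).sum ^ 2 : ℝ≥0∞) =
        g a ^ 2 + (2 * g a * (l.map g).sum + (l.map g).sum ^ 2) := by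
      intro a l; simp only [List.map_cons, List.sum_cons]; ring
    simp only [this, expect_add, expect_const, expect_const_mul, expect_mul_const,
      expect_independent_replicate_sum]
    calc _ ≤ expect p (fun x => g x ^ 2) + (2 * expect p g * (k * expect p g) +
          (k * expect p (fun x => g x ^ 2) + k ^ 2 * expect p g ^ 2)) := by gcongr
      _ ≤ (k + 1 : ℝ≥0∞) * expect p (fun x => g x ^ 2) + (k + 1 : ℝ≥0∞) ^ 2 * expect p g ^ 2 := by
          have : (k + 1 : ℝ≥0∞) * expect p (fun x => g x ^ 2) + (k + 1 : ℝ≥0∞) ^ 2 * expect p g ^ 2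
            = expect p (fun x => g x ^ 2) + (2 * expect p g * (k * expect p g) +
              (k * expect p (fun x => g x ^ 2) + k ^ 2 * expect p g ^ 2)) + expect p g ^ 2 := by
            ring
          rw [this]; exact le_self_add
      _ = _ := by push_cast; rfl

lemma expect_independent_replicate_ofFn {V : Type} [Fintype V] (N : ℕ) (p : PMF V)
    (f : List V → ℝ≥0∞) :
    expect (independent (List.replicate N p)) f =
      ∑ a : Fin N → V, (∏ x, p (a x)) * f (List.ofFn a) := by
  induction N generalizing f with
  | zero => simp [expect_independent_nil]
  | succ N ih =>
    rw [List.replicate_succ, expect_independent_cons, expect_fintype]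
    simp only [ih]
    rw [← (Fin.consEquiv fun _ : Fin (N + 1) => V).sum_comp, Fintype.sum_prod_type]
    refine Finset.sum_congr rfl fun a _ => ?_
    rw [Finset.mul_sum]
    refine Finset.sum_congr rfl fun b _ => ?_
    simp [Fin.consEquiv, Fin.prod_univ_succ, List.ofFn_succ, mul_assoc]

/-! ### Repetition until success -/

/-- The runs use fresh randomness, so failure probabilities multiply. -/
lemma expect_firstOutput_isNone {β : Type} (ps : List (PMF (Option β))) :
    expect (firstOutput ps) ({o | o.isNone}.indicator 1) =
      (ps.map fun p => expect p ({o | o.isNone}.indicator 1)).prod := by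
  induction ps with
  | nil => simp [firstOutput, expect_pure]
  | cons p ps ih =>
    simp only [firstOutput, expect_bind, List.map_cons, List.prod_cons, ← expect_mul_const]
    congr 1
    funext o
    cases o with
    | none => simpa using ih
    | some b => simp [expect_pure]

lemma expect_isNone_add_isSome {β : Type} (p : PMF (Option β)) :
    expect p ({o | o.isNone}.indicator 1) + expect p ({o | o.isSome}.indicator 1) = 1 := by
  rw [← expect_add, ← expect_const p 1]
  congr 1
  funext o
  cases o <;> simp

/-- Compare failure probabilities: in the product of `expect_firstOutput_isNone` every other factor
is at most one. -/
lemma expect_isSome_le_firstOutput {β : Type} {ps : List (PMF (Option β))} {p : PMF (Option β)}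
    (hp : p ∈ ps) :
    expect p ({o | o.isSome}.indicator 1) ≤
      expect (firstOutput ps) ({o | o.isSome}.indicator 1) := by
  have hle : ∀ q : PMF (Option β), expect q ({o | o.isNone}.indicator 1) ≤ 1 := fun q =>
    le_self_add.trans (expect_isNone_add_isSome q).le
  have hnone : expect (firstOutput ps) ({o | o.isNone}.indicator 1) ≤
      expect p ({o | o.isNone}.indicator 1) := by
    rw [expect_firstOutput_isNone]
    obtain ⟨l₁, l₂, rfl⟩ := List.append_of_mem hp
    rw [List.map_append, List.map_cons, List.prod_append, List.prod_cons]
    have hprod : ∀ l : List (PMF (Option β)),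
        (l.map fun p => expect p ({o | o.isNone}.indicator 1)).prod ≤ 1 := by
      intro l
      induction l with
      | nil => simp
      | cons q l ih => simpa using mul_le_one' (hle q) ih
    calc _ ≤ 1 * (expect p ({o | o.isNone}.indicator 1) * 1) := by
          gcongr <;> exact hprod _
      _ = _ := by simp
  have h1 := expect_isNone_add_isSome p
  have h2 := expect_isNone_add_isSome (firstOutput ps)
  have hfin : expect p ({o | o.isNone}.indicator 1) ≠ ⊤ := ne_top_of_le_ne_top (by simp) (hle p)
  by_contra! hlt
  have := ENNReal.add_lt_add_of_le_of_lt
    (ne_top_of_le_ne_top (by simp) (hle (firstOutput ps))) hnone hlt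
  rw [h1, h2] at this
  exact lt_irrefl _ this

end Expect

end MinorFinding

namespace MinorFinding

open scoped ENNReal Matrix

set_option linter.unusedSectionVars false

/-! ### The transition matrix -/

/-- The transition matrix of the lazy walk. -/
noncomputable def stepMatrix {n : ℕ} (G : SimpleGraph (Fin n)) [DecidableRel G.Adj] (d : ℕ)
    [NeZero d] : Matrix (Fin n) (Fin n) ℝ :=
  Matrix.of fun u v => (step G d u v).toReal

section StepMatrix

variable {n : ℕ} (G : SimpleGraph (Fin n)) [DecidableRel G.Adj] (d : ℕ) [NeZero d]

lemma ofReal_stepMatrix (u v : Fin n) : ENNReal.ofReal (stepMatrix G d u v) = step G d u v := by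
  simp [stepMatrix, PMF.apply_ne_top]

lemma stepMatrix_nonneg (u v : Fin n) : 0 ≤ stepMatrix G d u v := ENNReal.toReal_nonneg

lemma stepMatrix_row_sum (u : Fin n) : ∑ v, stepMatrix G d u v = 1 := by
  simp only [stepMatrix, Matrix.of_apply]
  rw [← ENNReal.toReal_sum fun v _ => PMF.apply_ne_top _ _, ← tsum_fintype (L := .unconditional _),
    PMF.tsum_coe, ENNReal.toReal_one]

/-- Pushing forward along `Fin.val` and then along a map on `ℕ` is a single pushforward from `Fin
d`. -/
lemma step_eq (u : Fin n) :
    step G d u = (PMF.uniformOfFintype Bool).bind fun lazy =>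
      if lazy then PMF.pure u else (PMF.uniformOfFintype (Fin d)).map fun i : Fin d =>
        ((G.neighborFinset u).sort (· ≤ ·)).getD (i : ℕ) u := by
  unfold step
  congr 1
  funext lazy
  cases lazy
  · exact PMF.map_comp (p := PMF.uniformOfFintype (Fin d)) Fin.val
      (fun i : ℕ => ((G.neighborFinset u).sort (· ≤ ·)).getD i u)
  · rfl

lemma stepMatrix_apply (u v : Fin n) :
    stepMatrix G d u v = (if v = u then 1 / 2 else 0) + 1 / 2 * ((d : ℝ)⁻¹ *
      (Finset.univ.filter fun i : Fin d =>
        v = ((G.neighborFinset u).sort (· ≤ ·)).getD i u).card) := by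
  have h2 : (2⁻¹ : ℝ≥0∞).toReal = 1 / 2 := by simp
  have hsum : (∑' a : Fin d, if v = ((G.neighborFinset u).sort (· ≤ ·)).getD a u then
      (d : ℝ≥0∞)⁻¹ else 0) = (d : ℝ≥0∞)⁻¹ * (Finset.univ.filter fun i : Fin d =>
        v = ((G.neighborFinset u).sort (· ≤ ·)).getD i u).card := by
    rw [tsum_fintype, ← Finset.sum_filter, Finset.sum_const, nsmul_eq_mul, mul_comm]
  have hd : (d : ℝ≥0∞)⁻¹ ≠ ⊤ := by simp [NeZero.ne d]
  simp only [stepMatrix, Matrix.of_apply, step_eq, PMF.bind_apply, tsum_bool, PMF.uniformOfFintype_apply,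
    PMF.map_apply, Fintype.card_bool, Fintype.card_fin, Bool.false_eq_true, if_false, if_true,
    PMF.pure_apply, hsum]
  rw [ENNReal.toReal_add, add_comm]
  · congr 1
    · split_ifs <;> simp
    · simp
  · refine ENNReal.mul_ne_top (by simp) (ENNReal.mul_ne_top hd (by simp))
  · split_ifs <;> simp

/-- The neighbour list has no repetitions and, by the degree bound, at most `d` entries, so exactly
one index leads to a given neighbour. The default value `u` does not interfere because `v ≠ u`. -/
lemma card_filter_getD (hd : ∀ v, G.degree v ≤ d) {u v : Fin n} (huv : v ≠ u) :
    (Finset.univ.filter fun i : Fin d =>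
        v = ((G.neighborFinset u).sort (· ≤ ·)).getD i u).card = if G.Adj u v then 1 else 0 := by
  set L := (G.neighborFinset u).sort (· ≤ ·) with hL
  have hlen : L.length ≤ d := by
    rw [hL, Finset.length_sort]; exact hd u
  have hnd : L.Nodup := Finset.sort_nodup _ _
  have hmem : v ∈ L ↔ G.Adj u v := by simp [hL]
  have key : ∀ i : ℕ, v = L.getD i u ↔ ∃ h : i < L.length, L[i] = v := by
    intro i
    by_cases h : i < L.length
    · simp [h, eq_comm]
    · simp [h, huv]
  simp only [key]
  split_ifs with h
  · obtain ⟨i, hi, rfl⟩ := List.mem_iff_getElem.1 (hmem.2 h)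
    rw [Finset.card_eq_one]
    refine ⟨⟨i, by omega⟩, ?_⟩
    ext j
    simp only [Finset.mem_filter, Finset.mem_univ, true_and, Finset.mem_singleton]
    constructor
    · rintro ⟨hj, hij⟩
      exact Fin.ext ((hnd.getElem_inj_iff).1 hij)
    · rintro rfl; exact ⟨hi, rfl⟩
  · rw [Finset.card_eq_zero, Finset.filter_eq_empty_iff]
    rintro j - ⟨hj, hv⟩
    exact h (hmem.1 (hv ▸ List.getElem_mem hj))

lemma stepMatrix_of_ne (hd : ∀ v, G.degree v ≤ d) {u v : Fin n} (huv : u ≠ v) :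
    stepMatrix G d u v = if G.Adj u v then 1 / (2 * d : ℝ) else 0 := by
  rw [stepMatrix_apply, card_filter_getD G d hd huv.symm, if_neg huv.symm]
  split_ifs <;> simp [mul_comm]

/-- An edge carries `1 / (2d)` in both directions, whatever the degrees of its ends: unused indices
become waiting time. -/
lemma stepMatrix_isSymm (hd : ∀ v, G.degree v ≤ d) (u v : Fin n) :
    stepMatrix G d u v = stepMatrix G d v u := by
  by_cases h : u = v
  · rw [h]
  · rw [stepMatrix_of_ne G d hd h, stepMatrix_of_ne G d hd (Ne.symm h)]
    simp [G.adj_comm]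

lemma half_le_stepMatrix_self (v : Fin n) : 1 / 2 ≤ stepMatrix G d v v := by
  rw [stepMatrix_apply, if_pos rfl]
  have : (0 : ℝ) ≤ 1 / 2 * ((d : ℝ)⁻¹ * (Finset.univ.filter fun i : Fin d =>
        v = ((G.neighborFinset v).sort (· ≤ ·)).getD i v).card) := by positivity
  linarith

end StepMatrix

/-! ### Doubly substochastic matrices -/

/-- Nonnegative matrices all of whose row and column sums are at most one. -/
structure DoublySub {V : Type*} [Fintype V] (A : Matrix V V ℝ) : Prop where
  nonneg : ∀ u v, 0 ≤ A u v
  row : ∀ u, ∑ v, A u v ≤ 1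
  col : ∀ v, ∑ u, A u v ≤ 1

/-- The diagonal matrix that projects onto the coordinates of `R`. -/
noncomputable def restr {V : Type*} [DecidableEq V] (R : Set V) : Matrix V V ℝ :=
  Matrix.diagonal (R.indicator 1)

section DoublySub

variable {V : Type*} [Fintype V] [DecidableEq V] {A B : Matrix V V ℝ}

lemma DoublySub.mul (hA : DoublySub A) (hB : DoublySub B) : DoublySub (A * B) where
  nonneg u v := Finset.sum_nonneg fun w _ => mul_nonneg (hA.nonneg _ _) (hB.nonneg _ _)
  row u := by
    simp only [Matrix.mul_apply]
    rw [Finset.sum_comm]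
    simp only [← Finset.mul_sum]
    exact (Finset.sum_le_sum fun w _ =>
      mul_le_of_le_one_right (hA.nonneg _ _) (hB.row w)).trans (hA.row u)
  col v := by
    simp only [Matrix.mul_apply]
    rw [Finset.sum_comm]
    simp only [← Finset.sum_mul]
    exact (Finset.sum_le_sum fun w _ =>
      mul_le_of_le_one_left (hB.nonneg _ _) (hA.col w)).trans (hB.col v)

lemma DoublySub.one : DoublySub (1 : Matrix V V ℝ) where
  nonneg u v := by rw [Matrix.one_apply]; split_ifs <;> norm_num
  row u := by simp [Matrix.one_apply]
  col v := by simp [Matrix.one_apply]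

lemma DoublySub.pow (hA : DoublySub A) (k : ℕ) : DoublySub (A ^ k) := by
  induction k with
  | zero => simpa using DoublySub.one
  | succ k ih => rw [pow_succ]; exact ih.mul hA

lemma restr_apply (R : Set V) (u v : V) :
    restr R u v = if u = v then R.indicator 1 u else 0 := by
  simp [restr, Matrix.diagonal_apply]

lemma restr_doublySub (R : Set V) : DoublySub (restr R) := by
  have h0 : ∀ u, 0 ≤ R.indicator (1 : V → ℝ) u := fun u =>
    Set.indicator_nonneg (fun _ _ => zero_le_one) u
  have h1 : ∀ u, R.indicator (1 : V → ℝ) u ≤ 1 := fun u =>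
    Set.indicator_le_self' (fun _ _ => zero_le_one) u
  refine ⟨fun u v => ?_, fun u => ?_, fun v => ?_⟩
  · rw [restr_apply]; split_ifs <;> simp [h0]
  · simp [restr_apply, h1]
  · simp [restr_apply, h1]

lemma restr_mul_apply (R : Set V) (A : Matrix V V ℝ) (u v : V) :
    (restr R * A) u v = R.indicator 1 u * A u v := by
  simp [restr, Matrix.diagonal_mul]

lemma mul_restr_apply (R : Set V) (A : Matrix V V ℝ) (u v : V) :
    (A * restr R) u v = A u v * R.indicator 1 v := by
  simp [restr, Matrix.mul_diagonal]

lemma restr_mul_restr (R R' : Set V) : restr R * restr R' = restr (R ∩ R') := by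
  rw [restr, restr, Matrix.diagonal_mul_diagonal, restr]
  congr 1
  funext u
  by_cases h : u ∈ R <;> by_cases h' : u ∈ R' <;> simp [h, h']

lemma restr_mul_self (R : Set V) : restr R * restr R = restr R := by
  rw [restr_mul_restr, Set.inter_self]

lemma restr_univ : restr (Set.univ : Set V) = 1 := by
  simp [restr]

lemma restr_transpose (R : Set V) : (restr R)ᵀ = restr R := by simp [restr]

lemma restr_mulVec (R : Set V) (x : V → ℝ) (u : V) :
    (restr R *ᵥ x) u = R.indicator 1 u * x u := by
  simp [restr, Matrix.mulVec_diagonal]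

lemma DoublySub.transpose (hA : DoublySub A) : DoublySub Aᵀ :=
  ⟨fun u v => hA.nonneg v u, fun u => hA.col u, fun v => hA.row v⟩

lemma DoublySub.mulVec_nonneg (hA : DoublySub A) {x : V → ℝ} (hx : ∀ v, 0 ≤ x v) (u : V) :
    0 ≤ (A *ᵥ x) u :=
  Finset.sum_nonneg fun v _ => mul_nonneg (hA.nonneg _ _) (hx v)

lemma DoublySub.mulVec_mono (hA : DoublySub A) {x y : V → ℝ} (h : ∀ v, x v ≤ y v) (u : V) :
    (A *ᵥ x) u ≤ (A *ᵥ y) u :=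
  Finset.sum_le_sum fun v _ => mul_le_mul_of_nonneg_left (h v) (hA.nonneg _ _)

lemma DoublySub.mulVec_le (hA : DoublySub A) {x : V → ℝ} {c : ℝ} (hc : 0 ≤ c)
    (hx : ∀ v, x v ≤ c) (u : V) : (A *ᵥ x) u ≤ c := by
  calc (A *ᵥ x) u ≤ ∑ v, A u v * c :=
        Finset.sum_le_sum fun v _ => mul_le_mul_of_nonneg_left (hx v) (hA.nonneg _ _)
    _ ≤ 1 * c := by rw [← Finset.sum_mul]; exact mul_le_mul_of_nonneg_right (hA.row u) hc
    _ = c := one_mul c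

lemma DoublySub.sum_mulVec_le (hA : DoublySub A) {x : V → ℝ} (hx : ∀ v, 0 ≤ x v) :
    ∑ u, (A *ᵥ x) u ≤ ∑ v, x v := by
  simp only [Matrix.mulVec, dotProduct]
  rw [Finset.sum_comm]
  simp only [← Finset.sum_mul]
  exact Finset.sum_le_sum fun v _ => mul_le_of_le_one_left (hx v) (hA.col v)

/-- Doubly substochastic matrices are contractions of the Euclidean norm. -/
lemma DoublySub.sum_mulVec_sq_le (hA : DoublySub A) (x : V → ℝ) :
    ∑ u, (A *ᵥ x) u ^ 2 ≤ ∑ v, x v ^ 2 := by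
  have key : ∀ u, (A *ᵥ x) u ^ 2 ≤ (A *ᵥ fun v => x v ^ 2) u := by
    intro u
    -- Cauchy–Schwarz with the weights `A u v`, whose total over `v` is at most one.
    have := Finset.sum_mul_sq_le_sq_mul_sq Finset.univ (fun v => √(A u v))
      (fun v => √(A u v) * x v)
    have e1 : ∀ v, √(A u v) * (√(A u v) * x v) = A u v * x v := fun v => by
      rw [← mul_assoc, Real.mul_self_sqrt (hA.nonneg _ _)]
    have e2 : ∀ v, √(A u v) ^ 2 = A u v := fun v => Real.sq_sqrt (hA.nonneg _ _)
    simp only [e1, mul_pow, e2] at this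
    refine this.trans ?_
    exact mul_le_of_le_one_left
      (Finset.sum_nonneg fun v _ => mul_nonneg (hA.nonneg _ _) (sq_nonneg _)) (hA.row u)
  exact (Finset.sum_le_sum fun u _ => key u).trans (hA.sum_mulVec_le fun v => sq_nonneg _)

end DoublySub

lemma stepMatrix_doublySub {n : ℕ} (G : SimpleGraph (Fin n)) [DecidableRel G.Adj] (d : ℕ)
    [NeZero d] (hd : ∀ v, G.degree v ≤ d) : DoublySub (stepMatrix G d) where
  nonneg := stepMatrix_nonneg G d
  row u := (stepMatrix_row_sum G d u).le
  col v := by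
    simp only [fun u => stepMatrix_isSymm G d hd u v]
    exact (stepMatrix_row_sum G d v).le

/-! ### Walks subject to constraints -/

/-- The list stays in the set `Φ t` at each of its positions `t`. -/
def Obeys {V : Type*} (Φ : ℕ → Set V) (W : List V) : Prop :=
  ∀ t w, W[t]? = some w → w ∈ Φ t

lemma obeys_cons {V : Type*} (Φ : ℕ → Set V) (v : V) (W : List V) :
    Obeys Φ (v :: W) ↔ v ∈ Φ 0 ∧ Obeys (fun t => Φ (t + 1)) W := by
  constructor
  · intro h
    exact ⟨h 0 v (by simp), fun t w hw => h (t + 1) w (by simpa using hw)⟩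
  · rintro ⟨h0, h⟩ t w hw
    cases t with
    | zero => simp at hw; exact hw ▸ h0
    | succ t => exact h t w (by simpa using hw)

section Constrained

variable {n : ℕ} (G : SimpleGraph (Fin n)) [DecidableRel G.Adj] (d : ℕ) [NeZero d]

/-- `pathMatrix Φ T s u` is the probability that the walk of length `T` from `s` obeys `Φ` and
ends at `u`. -/
noncomputable def pathMatrix (Φ : ℕ → Set (Fin n)) : ℕ → Matrix (Fin n) (Fin n) ℝ
  | 0 => restr (Φ 0)
  | T + 1 => pathMatrix Φ T * stepMatrix G d * restr (Φ (T + 1))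

lemma pathMatrix_nonneg (Φ : ℕ → Set (Fin n)) (T : ℕ) (u v : Fin n) :
    0 ≤ pathMatrix G d Φ T u v := by
  induction T generalizing v with
  | zero => exact (restr_doublySub _).nonneg _ _
  | succ T ih =>
    rw [pathMatrix, mul_restr_apply]
    refine mul_nonneg ?_ (Set.indicator_nonneg (fun _ _ => zero_le_one) _)
    rw [Matrix.mul_apply]
    exact Finset.sum_nonneg fun w _ => mul_nonneg (ih w) (stepMatrix_nonneg G d _ _)

lemma pathMatrix_doublySub (hd : ∀ v, G.degree v ≤ d) (Φ : ℕ → Set (Fin n)) (T : ℕ) :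
    DoublySub (pathMatrix G d Φ T) := by
  induction T with
  | zero => exact restr_doublySub _
  | succ T ih => exact (ih.mul (stepMatrix_doublySub G d hd)).mul (restr_doublySub _)

lemma pathMatrix_mul_restr (Φ : ℕ → Set (Fin n)) (T : ℕ) :
    pathMatrix G d Φ T * restr (Φ T) = pathMatrix G d Φ T := by
  cases T with
  | zero => exact restr_mul_self _
  | succ T => rw [pathMatrix, mul_assoc, restr_mul_self]

/-- Both factors impose the constraint at time `T`; this is harmless because `restr` is idempotent.
-/
lemma pathMatrix_add (Φ : ℕ → Set (Fin n)) (T T' : ℕ) :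
    pathMatrix G d Φ (T + T') = pathMatrix G d Φ T * pathMatrix G d (fun t => Φ (T + t)) T' := by
  induction T' with
  | zero => simp only [pathMatrix, add_zero, pathMatrix_mul_restr]
  | succ T' ih => rw [← add_assoc, pathMatrix, ih, pathMatrix, add_assoc T T' 1]; simp only [mul_assoc]

lemma pathMatrix_congr {Φ Φ' : ℕ → Set (Fin n)} {T : ℕ} (h : ∀ t ≤ T, Φ t = Φ' t) :
    pathMatrix G d Φ T = pathMatrix G d Φ' T := by
  induction T with
  | zero => simp [pathMatrix, h 0 le_rfl]
  | succ T ih => rw [pathMatrix, pathMatrix, ih fun t ht => h t (by omega), h _ le_rfl]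

lemma pathMatrix_univ (T : ℕ) : pathMatrix G d (fun _ => Set.univ) T = stepMatrix G d ^ T := by
  induction T with
  | zero => simp [pathMatrix, restr_univ]
  | succ T ih => rw [pathMatrix, ih, restr_univ, mul_one, pow_succ]

lemma head?_of_mem_support_walk {s : Fin n} {T : ℕ} {W : List (Fin n)}
    (h : W ∈ (walk G d s T).support) : W.head? = some s := by
  cases T with
  | zero => simp [walk] at h; simp [h]
  | succ T =>
    simp only [walk, PMF.mem_support_bind_iff, PMF.mem_support_map_iff] at h
    obtain ⟨v, -, W', -, rfl⟩ := h
    simp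

lemma length_of_mem_support_walk {s : Fin n} {T : ℕ} {W : List (Fin n)}
    (h : W ∈ (walk G d s T).support) : W.length = T + 1 := by
  induction T generalizing s W with
  | zero => simp [walk] at h; simp [h]
  | succ T ih =>
    simp only [walk, PMF.mem_support_bind_iff, PMF.mem_support_map_iff] at h
    obtain ⟨v, -, W', h, rfl⟩ := h
    simp [ih h]

lemma eq_or_adj_of_mem_support_step {s v : Fin n} (h : v ∈ (step G d s).support) :
    s = v ∨ G.Adj s v := by
  simp only [step_eq, PMF.mem_support_bind_iff] at h
  obtain ⟨b, -, hb⟩ := h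
  cases b with
  | true => left; simpa [eq_comm] using hb
  | false =>
    simp only [Bool.false_eq_true, if_false, PMF.mem_support_map_iff] at hb
    obtain ⟨i, -, rfl⟩ := hb
    by_cases hi : (i : ℕ) < ((G.neighborFinset s).sort (· ≤ ·)).length
    · right
      rw [List.getD_eq_getElem _ _ hi]
      exact (SimpleGraph.mem_neighborFinset _ _ _).1 ((Finset.mem_sort _).1 (List.getElem_mem hi))
    · left
      rw [List.getD_eq_default _ _ (not_lt.1 hi)]

lemma isChain_of_mem_support_walk {s : Fin n} {T : ℕ} {W : List (Fin n)}
    (h : W ∈ (walk G d s T).support) : W.IsChain fun u v => u = v ∨ G.Adj u v := by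
  induction T generalizing s W with
  | zero => simp [walk] at h; simp [h]
  | succ T ih =>
    simp only [walk, PMF.mem_support_bind_iff, PMF.mem_support_map_iff] at h
    obtain ⟨v, hv, W', h, rfl⟩ := h
    have hh := head?_of_mem_support_walk G d h
    rw [List.isChain_cons]
    refine ⟨fun y hy => ?_, ih h⟩
    rw [hh] at hy
    obtain rfl : v = y := by simpa using hy
    exact eq_or_adj_of_mem_support_step G d hv

-- Induction on the first step of the walk. Since `pathMatrix` grows by last steps, `hsplit` first
-- reorganises it around its first step.
open Classical in
lemma expect_walk_obeys (Φ : ℕ → Set (Fin n)) (T : ℕ) (s : Fin n) (g : Fin n → ℝ)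
    (hg : ∀ u, 0 ≤ g u) :
    expect (walk G d s T) (fun W => {W | Obeys Φ W}.indicator 1 W *
      ENNReal.ofReal (g (W.getLastD s))) =
      ENNReal.ofReal ((pathMatrix G d Φ T *ᵥ g) s) := by
  induction T generalizing s Φ with
  | zero =>
    have : ∀ h : s ∈ Φ 0, Obeys (fun t => Φ (t + 1)) ([] : List (Fin n)) := by
      intro _ t w hw; simp at hw
    simp only [walk, expect_pure, pathMatrix, restr_mulVec]
    by_cases h : s ∈ Φ 0 <;> simp [h, obeys_cons, this]
  | succ T ih =>
    have hsplit : pathMatrix G d Φ (T + 1) =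
        restr (Φ 0) * stepMatrix G d * pathMatrix G d (fun t => Φ (t + 1)) T := by
      have h1 := pathMatrix_add G d Φ 1 T
      rw [add_comm 1 T] at h1
      rw [h1]
      simp only [pathMatrix, zero_add, add_comm 1]
      rw [mul_assoc _ (restr (Φ 1))]
      congr 1
      have h2 := pathMatrix_add G d (fun t => Φ (t + 1)) 0 T
      simp only [pathMatrix, zero_add] at h2
      exact h2.symm
    rw [hsplit, walk, expect_bind, expect_fintype]
    simp only [expect_map]
    have hlast : ∀ v, ∀ W ∈ (walk G d v T).support, (s :: W).getLastD s = W.getLastD v := by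
      intro v W hW
      have hne : W ≠ [] := by
        intro h0; simpa [h0] using length_of_mem_support_walk G d hW
      obtain ⟨w, W', rfl⟩ := List.exists_cons_of_ne_nil hne
      simp only [List.getLastD_cons]
    have : ∀ v, expect (walk G d v T) (fun W => {W | Obeys Φ W}.indicator 1 (s :: W) *
        ENNReal.ofReal (g ((s :: W).getLastD s))) =
        (Φ 0).indicator 1 s * expect (walk G d v T) (fun W =>
          {W | Obeys (fun t => Φ (t + 1)) W}.indicator 1 W *
          ENNReal.ofReal (g (W.getLastD v))) := by
      intro v
      rw [← expect_const_mul]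
      refine expect_congr_support fun W hW => ?_
      rw [hlast v W hW, ← mul_assoc]
      congr 1
      by_cases h : s ∈ Φ 0 <;> simp [Set.indicator_apply, obeys_cons, h]
    simp only [this, ih, ← ofReal_stepMatrix]
    rw [Matrix.mul_assoc, ← Matrix.mulVec_mulVec, restr_mulVec, ← Matrix.mulVec_mulVec]
    by_cases h : s ∈ Φ 0
    · simp only [h, Set.indicator_of_mem, Pi.one_apply, one_mul, Matrix.mulVec, dotProduct]
      rw [ENNReal.ofReal_sum_of_nonneg]
      · refine Finset.sum_congr rfl fun v _ => ?_
        rw [ENNReal.ofReal_mul (stepMatrix_nonneg G d s v)]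
      · intro v _
        exact mul_nonneg (stepMatrix_nonneg G d s v)
          (Finset.sum_nonneg fun w _ => mul_nonneg (pathMatrix_nonneg G d _ _ _ _) (hg w))
    · simp [h]

end Constrained

end MinorFinding

namespace MinorFinding

open scoped ENNReal Matrix

set_option linter.unusedSectionVars false

/-! ### The return matrix and the return vectors -/

section Returning

variable {n : ℕ} (G : SimpleGraph (Fin n)) [DecidableRel G.Adj] (d : ℕ) [NeZero d]

lemma stepMatrix_transpose (hd : ∀ v, G.degree v ≤ d) : (stepMatrix G d)ᵀ = stepMatrix G d := by
  ext u v
  exact stepMatrix_isSymm G d hd v u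

lemma expect_walk_obeys_last (Φ : ℕ → Set (Fin n)) (T : ℕ) (s u : Fin n) :
    (walk G d s T).toOuterMeasure {W | Obeys Φ W ∧ W.getLast? = some u} =
      ENNReal.ofReal (pathMatrix G d Φ T s u) := by
  classical
  have := expect_walk_obeys G d Φ T s (fun v => if v = u then 1 else 0)
    (fun v => by split_ifs <;> norm_num)
  have e : (pathMatrix G d Φ T *ᵥ fun v => if v = u then 1 else 0) s = pathMatrix G d Φ T s u := by
    simp [Matrix.mulVec, dotProduct]
  rw [e] at this
  rw [← this, toOuterMeasure_eq_expect]
  refine expect_congr_support fun W hW => ?_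
  have hne : W ≠ [] := by
    intro h0; simpa [h0] using length_of_mem_support_walk G d hW
  obtain ⟨w, W', rfl⟩ := List.exists_cons_of_ne_nil hne
  have hl : (w :: W').getLast? = some ((w :: W').getLastD s) := by
    rw [List.getLastD_eq_getLast?, List.getLast?_eq_some_getLast hne]; rfl
  rw [Set.indicator_apply, Set.indicator_apply]
  simp only [Set.mem_ofPred_eq, hl, Option.some.injEq]
  generalize (w :: W').getLastD s = z
  by_cases h1 : Obeys Φ (w :: W') <;> by_cases h2 : z = u <;> simp [h1, h2]

lemma walkProb_eq (s v : Fin n) (t : ℕ) : walkProb G d s t v = (stepMatrix G d ^ t) s v := by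
  have h := expect_walk_obeys_last G d (fun _ => Set.univ) t s v
  rw [pathMatrix_univ] at h
  have hnn : 0 ≤ (stepMatrix G d ^ t) s v := by
    rw [← pathMatrix_univ]; exact pathMatrix_nonneg G d _ _ _ _
  rw [walkProb, dest, ← PMF.toOuterMeasure_apply_singleton, PMF.toOuterMeasure_map_apply,
    ← ENNReal.toReal_ofReal hnn, ← h]
  congr 1
  refine PMF.toOuterMeasure_apply_eq_of_inter_support_eq _ ?_
  ext W
  simp only [Set.mem_inter_iff, Set.mem_preimage, Set.mem_singleton_iff, Set.mem_ofPred_eq,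
    and_congr_left_iff]
  intro hW
  have hne : W ≠ [] := by
    intro h0; simpa [h0] using length_of_mem_support_walk G d hW
  have hl : W.getLast? = some (W.getLastD s) := by
    rw [List.getLastD_eq_getLast?, List.getLast?_eq_some_getLast hne]; rfl
  have : Obeys (fun _ => Set.univ) W := fun _ _ _ => Set.mem_univ _
  rw [hl]
  simp only [this, true_and, Option.some.injEq]

/-- The constraint to be in `R` at all times divisible by `ℓ`. -/
def returnConstraint (ℓ : ℕ) (R : Finset (Fin n)) (t : ℕ) : Set (Fin n) :=
  {v | ℓ ∣ t → v ∈ R}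

/-- The transition matrix of the walk of length `ℓ`, restricted to `R`. -/
noncomputable def returnMatrix (ℓ : ℕ) (R : Finset (Fin n)) : Matrix (Fin n) (Fin n) ℝ :=
  restr (R : Set (Fin n)) * stepMatrix G d ^ ℓ * restr (R : Set (Fin n))

variable {G d}

lemma returnMatrix_doublySub (hd : ∀ v, G.degree v ≤ d) (ℓ : ℕ) (R : Finset (Fin n)) :
    DoublySub (returnMatrix G d ℓ R) :=
  ((restr_doublySub _).mul ((stepMatrix_doublySub G d hd).pow ℓ)).mul (restr_doublySub _)

lemma returnMatrix_transpose (hd : ∀ v, G.degree v ≤ d) (ℓ : ℕ) (R : Finset (Fin n)) :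
    (returnMatrix G d ℓ R)ᵀ = returnMatrix G d ℓ R := by
  rw [returnMatrix, Matrix.transpose_mul, Matrix.transpose_mul, Matrix.transpose_pow,
    stepMatrix_transpose G d hd, restr_transpose, mul_assoc]

lemma returnMatrix_pow_symm (hd : ∀ v, G.degree v ≤ d) (ℓ : ℕ) (R : Finset (Fin n)) (m : ℕ)
    (u v : Fin n) : (returnMatrix G d ℓ R ^ m) u v = (returnMatrix G d ℓ R ^ m) v u := by
  conv_lhs => rw [← returnMatrix_transpose hd, ← Matrix.transpose_pow, Matrix.transpose_apply]

lemma restr_mul_returnMatrix_pow (ℓ : ℕ) (R : Finset (Fin n)) {m : ℕ} (hm : m ≠ 0) :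
    restr (R : Set (Fin n)) * returnMatrix G d ℓ R ^ m = returnMatrix G d ℓ R ^ m := by
  obtain ⟨m, rfl⟩ := Nat.exists_eq_succ_of_ne_zero hm
  rw [pow_succ', ← mul_assoc]
  congr 1
  rw [returnMatrix, ← mul_assoc, ← mul_assoc, restr_mul_self]

lemma returnMatrix_pow_mul_restr (ℓ : ℕ) (R : Finset (Fin n)) {m : ℕ} (hm : m ≠ 0) :
    returnMatrix G d ℓ R ^ m * restr (R : Set (Fin n)) = returnMatrix G d ℓ R ^ m := by
  obtain ⟨m, rfl⟩ := Nat.exists_eq_succ_of_ne_zero hm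
  rw [pow_succ, mul_assoc]
  congr 1
  rw [returnMatrix, mul_assoc, restr_mul_self]

lemma returnMatrix_pow_eq_zero_left (ℓ : ℕ) (R : Finset (Fin n)) {m : ℕ} (hm : m ≠ 0)
    {u : Fin n} (hu : u ∉ R) (v : Fin n) : (returnMatrix G d ℓ R ^ m) u v = 0 := by
  rw [← restr_mul_returnMatrix_pow ℓ R hm, restr_mul_apply]
  simp [hu]

lemma returnMatrix_pow_eq_zero_right (ℓ : ℕ) (R : Finset (Fin n)) {m : ℕ} (hm : m ≠ 0)
    (u : Fin n) {v : Fin n} (hv : v ∉ R) : (returnMatrix G d ℓ R ^ m) u v = 0 := by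
  rw [← returnMatrix_pow_mul_restr ℓ R hm, mul_restr_apply]
  simp [hv]

/-- The constraint has period `ℓ` and is void between multiples of `ℓ`, so blocks of length `ℓ`
multiply. Time `0` is constrained as well, whence the left factor in `returnMatrix` and the
condition `m ≠ 0`: the empty product would be the identity instead of `restr R`. -/
lemma pathMatrix_returnConstraint {ℓ : ℕ} (hℓ : 0 < ℓ) (R : Finset (Fin n)) {m : ℕ} (hm : m ≠ 0) :
    pathMatrix G d (returnConstraint ℓ R) (m * ℓ) = returnMatrix G d ℓ R ^ m := by
  have hlt : ∀ t < ℓ, pathMatrix G d (returnConstraint ℓ R) t =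
      restr (R : Set (Fin n)) * stepMatrix G d ^ t := by
    intro t ht
    induction t with
    | zero => simp [pathMatrix, returnConstraint]
    | succ t ih =>
      have : returnConstraint ℓ R (t + 1) = Set.univ := by
        ext v
        simp [returnConstraint, Nat.not_dvd_of_pos_of_lt (Nat.succ_pos t) ht]
      rw [pathMatrix, ih (by omega), this, restr_univ, mul_one, mul_assoc, ← pow_succ]
  have hone : pathMatrix G d (returnConstraint ℓ R) ℓ = returnMatrix G d ℓ R := by
    obtain ⟨ℓ, rfl⟩ := Nat.exists_eq_succ_of_ne_zero hℓ.ne'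
    have : returnConstraint (ℓ + 1) R (ℓ + 1) = (R : Set (Fin n)) := by
      ext v
      simp [returnConstraint]
    rw [Nat.succ_eq_add_one, pathMatrix, hlt ℓ (by omega), this, mul_assoc (restr _), ← pow_succ]
    rfl
  obtain ⟨m, rfl⟩ := Nat.exists_eq_succ_of_ne_zero hm
  induction m with
  | zero => simpa using hone
  | succ m ih =>
    have hshift : (fun t => returnConstraint ℓ R ((m + 1) * ℓ + t)) = returnConstraint ℓ R := by
      funext t
      ext v
      simp [returnConstraint, Nat.dvd_add_right (Dvd.intro_left (m + 1) rfl : ℓ ∣ (m + 1) * ℓ)]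
    rw [Nat.succ_eq_add_one, Nat.succ_mul, pathMatrix_add, hshift, hone, ih (by simp),
      Nat.succ_eq_add_one, ← pow_succ]

/-- `returnProb` leaves time `0` free and `returnConstraint` does not; `hs` reconciles the two. -/
lemma returnProb_eq {δ : ℝ} (hℓ : 0 < baseLength n δ) {R : Finset (Fin n)} (i : ℕ) {s : Fin n}
    (hs : s ∈ R) (u : Fin n) :
    returnProb G d δ R i s u = (returnMatrix G d (baseLength n δ) R ^ 2 ^ i) s u := by
  have h := expect_walk_obeys_last G d (returnConstraint (baseLength n δ) R)
    (2 ^ i * baseLength n δ) s u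
  rw [pathMatrix_returnConstraint hℓ R (by positivity)] at h
  have hnn : 0 ≤ (returnMatrix G d (baseLength n δ) R ^ 2 ^ i) s u := by
    rw [← pathMatrix_returnConstraint hℓ R (by positivity)]; exact pathMatrix_nonneg G d _ _ _ _
  rw [returnProb, ← ENNReal.toReal_ofReal hnn, ← h]
  congr 1
  refine PMF.toOuterMeasure_apply_eq_of_inter_support_eq _ ?_
  ext W
  simp only [Set.mem_inter_iff, Set.mem_ofPred_eq, and_congr_left_iff]
  intro hW
  have hlen := length_of_mem_support_walk G d hW
  have hhead := head?_of_mem_support_walk G d hW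
  rw [and_comm, and_congr_left_iff]
  intro _
  constructor
  · rintro h t w hw ⟨j, rfl⟩
    rw [mul_comm] at hw
    rcases Nat.eq_zero_or_pos j with rfl | hj
    · rw [Nat.zero_mul, ← List.head?_eq_getElem?, hhead] at hw
      exact (Option.some.inj hw) ▸ hs
    · have hlt := (List.getElem?_eq_some_iff.1 hw).1
      rw [hlen] at hlt
      have hj2 : j ≤ 2 ^ i := Nat.le_of_mul_le_mul_right (Nat.lt_succ_iff.1 hlt) hℓ
      obtain ⟨w', hw', he⟩ := h j hj hj2
      rw [hw] at he
      exact Option.some.inj he ▸ hw'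
  · intro h j _ hj2
    have hlt : j * baseLength n δ < W.length := by
      rw [hlen]
      exact Nat.lt_succ_of_le (Nat.mul_le_mul_right _ hj2)
    exact ⟨W[j * baseLength n δ], h _ _ (List.getElem?_eq_getElem hlt) (Dvd.intro_left j rfl),
      List.getElem?_eq_getElem hlt⟩

/-! ### Norms of return vectors -/

/-- By symmetry the squared norm of a row is a return probability after twice the time. Most later
estimates of return norms are made on these diagonal entries. -/
lemma sum_returnMatrix_pow_sq (hd : ∀ v, G.degree v ≤ d) (ℓ : ℕ) (R : Finset (Fin n)) (m : ℕ)
    (s : Fin n) :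
    ∑ u, (returnMatrix G d ℓ R ^ m) s u ^ 2 = (returnMatrix G d ℓ R ^ (2 * m)) s s := by
  rw [two_mul, pow_add, Matrix.mul_apply]
  refine Finset.sum_congr rfl fun u _ => ?_
  rw [sq, returnMatrix_pow_symm hd ℓ R m u s]

lemma returnNormSq_eq (hd : ∀ v, G.degree v ≤ d) {δ : ℝ} (hℓ : 0 < baseLength n δ)
    {R : Finset (Fin n)} (i : ℕ) {s : Fin n} (hs : s ∈ R) :
    returnNormSq G d δ R i s = (returnMatrix G d (baseLength n δ) R ^ (2 * 2 ^ i)) s s := by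
  rw [← sum_returnMatrix_pow_sq hd, returnNormSq]
  simp only [returnProb_eq hℓ i hs]
  refine Finset.sum_subset (Finset.subset_univ _) fun u _ hu => ?_
  rw [returnMatrix_pow_eq_zero_right _ _ (by positivity) s hu]
  simp

/-- The additional factor `Q ^ m'` is a contraction applied to the row of `s`. -/
lemma returnMatrix_pow_mulVec_sq (hd : ∀ v, G.degree v ≤ d) (ℓ : ℕ) (R : Finset (Fin n)) (m m' : ℕ)
    (s : Fin n) : (returnMatrix G d ℓ R ^ (2 * (m + m'))) s s ≤
      (returnMatrix G d ℓ R ^ (2 * m)) s s := by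
  rw [← sum_returnMatrix_pow_sq hd, ← sum_returnMatrix_pow_sq hd]
  have := ((returnMatrix_doublySub (d := d) hd ℓ R).pow m').sum_mulVec_sq_le
    fun u => (returnMatrix G d ℓ R ^ m) s u
  refine le_trans (le_of_eq (Finset.sum_congr rfl fun u _ => ?_)) this
  rw [returnMatrix_pow_symm hd, add_comm m m', pow_add, Matrix.mul_apply]
  simp only [returnMatrix_pow_symm hd ℓ R m _ s]
  rfl

lemma returnMatrix_mono (hd : ∀ v, G.degree v ≤ d) (ℓ : ℕ) {R R' : Finset (Fin n)} (h : R ⊆ R')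
    (u v : Fin n) : returnMatrix G d ℓ R u v ≤ returnMatrix G d ℓ R' u v := by
  have hM := ((stepMatrix_doublySub G d hd).pow ℓ).nonneg u v
  rw [returnMatrix, returnMatrix, mul_restr_apply, mul_restr_apply, restr_mul_apply,
    restr_mul_apply]
  have hi : ∀ w, (R : Set (Fin n)).indicator (1 : Fin n → ℝ) w ≤
      (R' : Set (Fin n)).indicator 1 w := fun w =>
    Set.indicator_le_indicator_of_subset (by exact_mod_cast h) (fun _ => zero_le_one) w
  have h0 : ∀ (R : Finset (Fin n)) w, 0 ≤ (R : Set (Fin n)).indicator (1 : Fin n → ℝ) w :=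
    fun R w => Set.indicator_nonneg (fun _ _ => zero_le_one) w
  exact mul_le_mul (mul_le_mul_of_nonneg_right (hi u) hM) (hi v) (h0 R v)
    (mul_nonneg (h0 R' u) hM)

lemma matrix_pow_mono {V : Type*} [Fintype V] [DecidableEq V] {A B : Matrix V V ℝ}
    (hA : ∀ u v, 0 ≤ A u v) (h : ∀ u v, A u v ≤ B u v) (m : ℕ) (u v : V) :
    0 ≤ (A ^ m) u v ∧ (A ^ m) u v ≤ (B ^ m) u v := by
  induction m generalizing v with
  | zero => simp only [pow_zero, le_refl, and_true, Matrix.one_apply]; split_ifs <;> norm_num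
  | succ m ih =>
    simp only [pow_succ, Matrix.mul_apply]
    exact ⟨Finset.sum_nonneg fun w _ => mul_nonneg (ih w).1 (hA _ _),
      Finset.sum_le_sum fun w _ => mul_le_mul (ih w).2 (h _ _) (hA _ _) ((ih w).1.trans (ih w).2)⟩

lemma returnMatrix_pow_mono (hd : ∀ v, G.degree v ≤ d) (ℓ : ℕ) {R R' : Finset (Fin n)} (h : R ⊆ R')
    (m : ℕ) (u v : Fin n) : (returnMatrix G d ℓ R ^ m) u v ≤ (returnMatrix G d ℓ R' ^ m) u v :=
  (matrix_pow_mono (returnMatrix_doublySub (d := d) hd ℓ R).nonneg (returnMatrix_mono hd ℓ h) m u v).2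

/-- Entrywise monotonicity of nonnegative matrices survives powers. This is what lets bounds from
earlier phases persist while `S` shrinks. -/
lemma returnNormSq_mono (hd : ∀ v, G.degree v ≤ d) {δ : ℝ} (hℓ : 0 < baseLength n δ)
    {R R' : Finset (Fin n)} (h : R ⊆ R') (i : ℕ) {s : Fin n} (hs : s ∈ R) :
    returnNormSq G d δ R i s ≤ returnNormSq G d δ R' i s := by
  rw [returnNormSq_eq hd hℓ i hs, returnNormSq_eq hd hℓ i (h hs)]
  exact returnMatrix_pow_mono hd _ h _ _ _

/-- An even power of a symmetric matrix is a Gram matrix. -/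
lemma returnMatrix_pow_apply_sq_le (hd : ∀ v, G.degree v ≤ d) (ℓ : ℕ) (R : Finset (Fin n)) (m : ℕ)
    (u v : Fin n) : (returnMatrix G d ℓ R ^ (2 * m)) u v ^ 2 ≤
      (returnMatrix G d ℓ R ^ (2 * m)) u u * (returnMatrix G d ℓ R ^ (2 * m)) v v := by
  rw [← sum_returnMatrix_pow_sq hd, ← sum_returnMatrix_pow_sq hd, two_mul, pow_add,
    Matrix.mul_apply]
  simp only [returnMatrix_pow_symm hd ℓ R m _ v]
  exact Finset.sum_mul_sq_le_sq_mul_sq _ _ _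

lemma baseLength_pos (hn : 0 < n) (δ : ℝ) : 0 < baseLength n δ :=
  Nat.ceil_pos.2 (Real.rpow_pos_of_pos (by exact_mod_cast hn) _)

end Returning

end MinorFinding

namespace MinorFinding

open scoped ENNReal Matrix

set_option linter.unusedSectionVars false

/-! ### The Lovász–Simonovits method -/

section LovaszSimonovits

variable {V : Type*} [Fintype V] [DecidableEq V]

/-- Passage from sets to fractional weights: `h (∑ w) - ∑ p w` is concave in `w`, so on the cube it
is bounded below by its value at some vertex, that is, at an indicator function. -/
lemma sum_mul_le_of_forall_finset {h : ℝ → ℝ} (hc : ConcaveOn ℝ (Set.Ici 0) h) {p : V → ℝ}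
    (hp : ∀ P : Finset V, ∑ v ∈ P, p v ≤ h P.card) {w : V → ℝ} (hw : ∀ v, w v ∈ Set.Icc (0 : ℝ) 1) :
    ∑ v, p v * w v ≤ h (∑ v, w v) := by
  have hmem : w ∈ convexHull ℝ (Set.univ.pi fun _ : V => ({0, 1} : Set ℝ)) := by
    rw [convexHull_pi]
    intro v _
    rw [convexHull_pair, segment_eq_Icc zero_le_one]
    exact hw v
  have hconc : ConcaveOn ℝ {w : V → ℝ | ∀ v, 0 ≤ w v} fun w => h (∑ v, w v) - ∑ v, p v * w v := by
    refine ⟨?_, ?_⟩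
    · intro x hx y hy a b ha hb _ v
      exact add_nonneg (mul_nonneg ha (hx v)) (mul_nonneg hb (hy v))
    · intro x hx y hy a b ha hb hab
      have := hc.2 (Finset.sum_nonneg fun v _ => hx v : (0 : ℝ) ≤ ∑ v, x v)
        (Finset.sum_nonneg fun v _ => hy v : (0 : ℝ) ≤ ∑ v, y v) ha hb hab
      simp only [smul_eq_mul, Pi.add_apply, Pi.smul_apply, mul_add, Finset.sum_add_distrib] at this ⊢
      rw [← Finset.mul_sum, ← Finset.mul_sum]
      have e1 : ∀ (c : ℝ) (z : V → ℝ), ∑ v, p v * (c * z v) = c * ∑ v, p v * z v := by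
        intro c z
        rw [Finset.mul_sum]
        exact Finset.sum_congr rfl fun v _ => by ring
      rw [e1, e1]
      linarith
  obtain ⟨y, hy, hle⟩ := hconc.exists_le_of_mem_convexHull (t := Set.univ.pi fun _ : V =>
    ({0, 1} : Set ℝ)) (fun x hx v => by
      rcases hx v (Set.mem_univ _) with h | h
      · exact h.ge
      · rw [Set.mem_singleton_iff.1 h]; exact zero_le_one) hmem
  have hy' : ∀ v, y v = if v ∈ Finset.univ.filter (fun v => y v = 1) then 1 else 0 := by
    intro v
    rcases hy v (Set.mem_univ _) with h | h
    · simp [h]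
    · simp [Set.mem_singleton_iff.1 h]
  have h1 : ∑ v, y v = (Finset.univ.filter (fun v => y v = 1)).card := by
    rw [Finset.sum_congr rfl fun v _ => hy' v]
    simp
  have h2 : ∑ v, p v * y v = ∑ v ∈ Finset.univ.filter (fun v => y v = 1), p v := by
    rw [Finset.sum_congr rfl fun v _ => by rw [hy' v]]
    simp [Finset.sum_filter]
  have := hp (Finset.univ.filter (fun v => y v = 1))
  simp only [h1, h2] at hle
  linarith

/-- Quantitative concavity of the square root. The product of the two roots is at most `x - 2φc`, so
the square of their mean is at most `x - φc ≤ x (1 - φ²)`. -/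
lemma half_sqrt_add_sqrt_le {x c φ : ℝ} (hx : 0 < x) (hφ : 0 ≤ φ) (hc : φ * x ≤ c)
    (hcx : 2 * c ≤ x) : (√(x - 2 * c) + √(x + 2 * c)) / 2 ≤ √x * (1 - φ ^ 2 / 2) := by
  have hc0 : 0 ≤ c := (mul_nonneg hφ hx.le).trans hc
  have hφ1 : φ ≤ 1 / 2 := by
    by_contra! h
    nlinarith
  have hprod : √(x - 2 * c) * √(x + 2 * c) ≤ x - 2 * φ * c := by
    rw [← Real.sqrt_mul (by linarith)]
    refine Real.sqrt_le_iff.2 ⟨by nlinarith, ?_⟩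
    nlinarith [mul_nonneg hφ hc0, mul_nonneg (mul_nonneg hφ hc0) hx.le,
      mul_le_mul_of_nonneg_left hc hc0, sq_nonneg (φ * c)]
  have h1 := Real.sq_sqrt (by linarith : 0 ≤ x - 2 * c)
  have h2 := Real.sq_sqrt (by linarith : 0 ≤ x + 2 * c)
  have h3 := Real.sq_sqrt hx.le
  refine le_of_sq_le_sq ?_ (mul_nonneg (Real.sqrt_nonneg _) (by nlinarith))
  have e1 : ((√(x - 2 * c) + √(x + 2 * c)) / 2) ^ 2 ≤ x - φ * c := by nlinarith
  have e2 : (√x * (1 - φ ^ 2 / 2)) ^ 2 = x * (1 - φ ^ 2 / 2) ^ 2 := by rw [mul_pow, h3]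
  rw [e2]
  nlinarith [mul_le_mul_of_nonneg_left hc hφ, mul_nonneg hx.le (sq_nonneg (φ ^ 2))]

lemma concaveOn_sqrt_add_linear {a b : ℝ} (ha : 0 ≤ a) :
    ConcaveOn ℝ (Set.Ici 0) fun y => √y * a + b * y := by
  have h1 : ConcaveOn ℝ (Set.Ici 0) fun y : ℝ => a * √y := by
    simpa using Real.strictConcaveOn_sqrt.concaveOn.smul ha
  have h2 : ConcaveOn ℝ (Set.Ici 0) fun y : ℝ => b * y := by
    refine ⟨convex_Ici 0, fun x _ y _ s t _ _ _ => le_of_eq ?_⟩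
    simp only [smul_eq_mul]; ring
  have := h1.add h2
  refine this.congr fun y _ => ?_
  simp [mul_comm]

variable {K : Matrix V V ℝ} {S : Finset V}

/-- One Lovász–Simonovits step. The mass arriving in `P` is `p` weighted by `q = K 1_P`. Laziness
gives `q ≥ 1/2` on `P` and `q ≤ 1/2` off `P`, so `q` is the mean of weights `b`, `c` in `[0, 1]`. If
`A` is the total of `q` on `P` and `x = |P|`, then `b` has total `x - 2 (x - A)` and `c` at most `x
+ 2 (x - A)`. The cut makes `x - A ≥ φ x`, and concavity of the square root yields the gain. -/
lemma sum_mulVec_le_of_isLarge_cut (hK : DoublySub K) (hsymm : ∀ u v, K u v = K v u)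
    (hS : ∀ u v, u ∉ S → K u v = 0) (hlazy : ∀ v ∈ S, 1 / 2 ≤ K v v)
    {φ θ a : ℝ} (hφ : 0 ≤ φ) (hθ : 0 ≤ θ) (ha : 0 ≤ a) {p : V → ℝ}
    (hp : ∀ P : Finset V, ∑ v ∈ P, p v ≤ √P.card * a + θ * P.card)
    {P : Finset V} (hPS : P ⊆ S) (hP : P.Nonempty)
    (hcut : φ * P.card ≤ ∑ u ∈ P, ∑ v ∈ S \ P, K u v) :
    ∑ v ∈ P, (K *ᵥ p) v ≤ √P.card * (a * (1 - φ ^ 2 / 2)) + θ * P.card := by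
  set x : ℝ := (P.card : ℝ) with hx
  have hxpos : 0 < x := by rw [hx]; exact_mod_cast hP.card_pos
  set q : V → ℝ := fun u => ∑ v ∈ P, K u v with hq
  have hq0 : ∀ u, 0 ≤ q u := fun u => Finset.sum_nonneg fun v _ => hK.nonneg _ _
  have hq1 : ∀ u, q u ≤ 1 := fun u =>
    (Finset.sum_le_sum_of_subset_of_nonneg (Finset.subset_univ P)
      fun v _ _ => hK.nonneg u v).trans (hK.row u)
  have hqin : ∀ u ∈ P, 1 / 2 ≤ q u := fun u hu =>
    (hlazy u (hPS hu)).trans (Finset.single_le_sum (fun v _ => hK.nonneg u v) hu)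
  have hqout : ∀ u, u ∉ P → q u ≤ 1 / 2 := by
    intro u hu
    by_cases huS : u ∈ S
    · have : q u + K u u ≤ 1 := by
        rw [add_comm, hq, ← Finset.sum_insert hu]
        exact (Finset.sum_le_sum_of_subset_of_nonneg (Finset.subset_univ _)
          fun v _ _ => hK.nonneg u v).trans (hK.row u)
      linarith [hlazy u huS]
    · have : q u = 0 := Finset.sum_eq_zero fun v _ => hS u v huS
      rw [this]; norm_num
  have hsum : ∑ v ∈ P, (K *ᵥ p) v = ∑ u, p u * q u := by
    simp only [Matrix.mulVec, dotProduct]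
    rw [Finset.sum_comm]
    refine Finset.sum_congr rfl fun u _ => ?_
    rw [hq, Finset.mul_sum]
    exact Finset.sum_congr rfl fun v _ => by rw [hsymm v u, mul_comm]
  set b : V → ℝ := fun u => if u ∈ P then 2 * q u - 1 else 0 with hb
  set c : V → ℝ := fun u => if u ∈ P then 1 else 2 * q u with hc
  have hbI : ∀ u, b u ∈ Set.Icc (0 : ℝ) 1 := by
    intro u
    simp only [hb]
    split_ifs with hu
    · constructor <;> linarith [hqin u hu, hq1 u]
    · simp
  have hcI : ∀ u, c u ∈ Set.Icc (0 : ℝ) 1 := by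
    intro u
    simp only [hc]
    split_ifs with hu
    · simp
    · constructor <;> linarith [hqout u hu, hq0 u]
  have hbc : ∀ u, p u * q u = (p u * b u + p u * c u) / 2 := by
    intro u
    simp only [hb, hc]
    split_ifs <;> ring
  set A := ∑ u ∈ P, q u with hA
  have hsumb : ∑ u, b u = 2 * A - x := by
    simp only [hb]
    rw [← Finset.sum_filter, Finset.filter_mem_eq_inter, Finset.univ_inter, Finset.sum_sub_distrib,
      ← Finset.mul_sum]
    simp [hx, hA]
  have hsumc : ∑ u, c u ≤ x + 2 * (x - A) := by
    have h1 : ∑ u, q u ≤ x := by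
      calc ∑ u, q u = ∑ v ∈ P, ∑ u, K u v := Finset.sum_comm
        _ ≤ ∑ v ∈ P, (1 : ℝ) := Finset.sum_le_sum fun v _ => hK.col v
        _ = x := by simp [hx]
    have h2 : ∑ u, c u = ∑ u, (2 * q u + (if u ∈ P then 1 - 2 * q u else 0)) := by
      refine Finset.sum_congr rfl fun u _ => ?_
      simp only [hc]
      split_ifs <;> ring
    rw [h2, Finset.sum_add_distrib, ← Finset.mul_sum, ← Finset.sum_filter,
      Finset.filter_mem_eq_inter, Finset.univ_inter, Finset.sum_sub_distrib, ← Finset.mul_sum]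
    simp only [Finset.sum_const, nsmul_eq_mul, mul_one, ← hx, ← hA]
    linarith
  have hAcut : φ * x ≤ x - A := by
    have : A + ∑ u ∈ P, ∑ v ∈ S \ P, K u v ≤ x := by
      rw [hA, ← Finset.sum_add_distrib]
      calc _ ≤ ∑ u ∈ P, (1 : ℝ) := by
            refine Finset.sum_le_sum fun u _ => ?_
            rw [hq, add_comm, Finset.sum_sdiff hPS]
            exact (Finset.sum_le_sum_of_subset_of_nonneg (Finset.subset_univ _)
              fun v _ _ => hK.nonneg u v).trans (hK.row u)
        _ = x := by simp [hx]
    linarith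
  have hA2 : x / 2 ≤ A := by
    calc x / 2 = ∑ u ∈ P, (1 / 2 : ℝ) := by simp [hx]; ring
      _ ≤ A := Finset.sum_le_sum hqin
  have hIb := sum_mul_le_of_forall_finset (concaveOn_sqrt_add_linear (b := θ) ha) hp hbI
  have hIc := sum_mul_le_of_forall_finset (concaveOn_sqrt_add_linear (b := θ) ha) hp hcI
  rw [hsum, Finset.sum_congr rfl fun u _ => hbc u, ← Finset.sum_div, Finset.sum_add_distrib]
  have hs := half_sqrt_add_sqrt_le (c := x - A) hxpos hφ hAcut (by linarith)
  have hsb : √(∑ u, b u) = √(x - 2 * (x - A)) := by rw [hsumb]; congr 1; ring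
  have hsc : √(∑ u, c u) ≤ √(x + 2 * (x - A)) := Real.sqrt_le_sqrt hsumc
  have e1 := mul_le_mul_of_nonneg_right hs ha
  have e2 := mul_le_mul_of_nonneg_right hsc ha
  have e3 := mul_le_mul_of_nonneg_left hsumc hθ
  rw [hsb, hsumb] at hIb
  have : θ * (2 * A - x) + θ * (x + 2 * (x - A)) = 2 * (θ * x) := by ring
  nlinarith

/-- If no set of vertices of large probability is sparse, the chain mixes down to `θ`. -/
theorem sum_pow_mulVec_le (hK : DoublySub K) (hsymm : ∀ u v, K u v = K v u)
    (hS : ∀ u v, u ∉ S → K u v = 0) (hlazy : ∀ v ∈ S, 1 / 2 ≤ K v v)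
    {φ θ : ℝ} (hφ : 0 ≤ φ) (hφ1 : φ ≤ 1) (hθ : 0 ≤ θ) {s : V} {T : ℕ}
    (hcut : ∀ t < T, ∀ P ⊆ S, P.Nonempty → (∀ v ∈ P, θ ≤ (K ^ (t + 1)) s v) →
      φ * P.card ≤ ∑ u ∈ P, ∑ v ∈ S \ P, K u v) (P : Finset V) :
    ∑ v ∈ P, (K ^ T) s v ≤ √P.card * (1 - φ ^ 2 / 2) ^ T + θ * P.card := by
  have hrate : 0 ≤ 1 - φ ^ 2 / 2 := by nlinarith
  induction T generalizing P with
  | zero =>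
    have h1 : ∑ v ∈ P, (K ^ 0) s v ≤ if P.Nonempty then 1 else 0 := by
      split_ifs with h
      · exact (Finset.sum_le_sum_of_subset_of_nonneg (Finset.subset_univ _)
          fun v _ _ => (hK.pow 0).nonneg s v).trans ((hK.pow 0).row s)
      · simp [Finset.not_nonempty_iff_eq_empty.1 h]
    refine h1.trans ?_
    have h2 : 0 ≤ θ * P.card := by positivity
    split_ifs with h
    · have : (1 : ℝ) ≤ √P.card := by
        rw [Real.one_le_sqrt]
        exact_mod_cast h.card_pos
      simp; linarith
    · positivity
  | succ T ih =>
    have hih := ih fun t ht => hcut t (by omega)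
    have hstep : ∀ v, (K ^ (T + 1)) s v = (K *ᵥ fun u => (K ^ T) s u) v := by
      intro v
      rw [pow_succ, Matrix.mul_apply, Matrix.mulVec, dotProduct]
      exact Finset.sum_congr rfl fun u _ => by rw [hsymm u v, mul_comm]
    classical
    -- `hcut` applies only to vertices of `S` with probability at least `θ`. Each remaining vertex
    -- of `P` has probability at most `θ` and is paid for by the linear term.
    set P₁ := P.filter fun v => v ∈ S ∧ θ ≤ (K ^ (T + 1)) s v with hP₁
    have hlow : ∀ v ∈ P \ P₁, (K ^ (T + 1)) s v ≤ θ := by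
      intro v hv
      simp only [hP₁, Finset.mem_sdiff, Finset.mem_filter, not_and] at hv
      by_cases hvS : v ∈ S
      · exact (not_le.1 (hv.2 hv.1 hvS)).le
      · rw [hstep]
        simp only [Matrix.mulVec, dotProduct, hS v _ hvS, zero_mul, Finset.sum_const_zero]
        exact hθ
    have hhigh : ∑ v ∈ P₁, (K ^ (T + 1)) s v ≤
        √P₁.card * (1 - φ ^ 2 / 2) ^ (T + 1) + θ * P₁.card := by
      rcases P₁.eq_empty_or_nonempty with h | h
      · simp [h]
      · simp only [hstep]
        rw [pow_succ]
        have hsub : P₁ ⊆ S := fun v hv => (Finset.mem_filter.1 hv).2.1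
        exact sum_mulVec_le_of_isLarge_cut hK hsymm hS hlazy hφ hθ (pow_nonneg hrate _)
          hih hsub h
          (hcut T (by omega) P₁ hsub h fun v hv => (Finset.mem_filter.1 hv).2.2)
    have hsub : P₁ ⊆ P := Finset.filter_subset _ _
    have hcard : ((P \ P₁).card : ℝ) + P₁.card = P.card := by
      exact_mod_cast Finset.card_sdiff_add_card_eq_card hsub
    have h1 := Finset.sum_le_sum hlow
    rw [Finset.sum_const, nsmul_eq_mul] at h1
    rw [← Finset.sum_sdiff hsub, ← hcard]
    have h2 : √(P₁.card : ℝ) ≤ √((P \ P₁).card + P₁.card : ℝ) := Real.sqrt_le_sqrt (by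
      have : (0 : ℝ) ≤ (P \ P₁).card := Nat.cast_nonneg _
      linarith)
    have h3 := mul_le_mul_of_nonneg_right h2 (pow_nonneg hrate (T + 1))
    linarith

end LovaszSimonovits

end MinorFinding

namespace MinorFinding

open scoped ENNReal Matrix

set_option linter.unusedSectionVars false

/-! ### Visits of a walk to a set of vertices, and the induced chain -/

section Visits

variable {V : Type*} [Fintype V] [DecidableEq V] (M : Matrix V V ℝ) (S : Finset V)

/-- `visits M S x t j u` is the mass at `u` after `t` steps of the chain started from the mass
distribution `x`, restricted to the trajectories that are in `S` at exactly `j` of the times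
`1, …, t`. -/
noncomputable def visits (x : V → ℝ) : ℕ → ℕ → V → ℝ
  | 0, 0 => x
  | 0, _ + 1 => 0
  | t + 1, 0 => fun u => if u ∈ S then 0 else (M *ᵥ visits x t 0) u
  | t + 1, j + 1 => fun u => if u ∈ S then (M *ᵥ visits x t j) u else (M *ᵥ visits x t (j + 1)) u

/-- The mass at `u ∈ S` at time `t` of the trajectories for which `t` is the time of the `k`-th visit
to `S`. -/
noncomputable def hits (x : V → ℝ) (k t : ℕ) (u : V) : ℝ :=
  if u ∈ S then visits M S x t k u else 0

/-- The transition matrix of the chain induced on `S`, with excursions of length at most `ℓ`. -/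
noncomputable def inducedMatrix (ℓ : ℕ) : Matrix V V ℝ :=
  ∑ g ∈ Finset.range ℓ, restr (S : Set V) * M * (restr ((S : Set V)ᶜ) * M) ^ g * restr (S : Set V)

variable {M S} {x : V → ℝ}

lemma visits_nonneg (hM : DoublySub M) (hx : ∀ u, 0 ≤ x u) (t j : ℕ) (u : V) :
    0 ≤ visits M S x t j u := by
  induction t generalizing j u with
  | zero => cases j <;> simp [visits, hx]
  | succ t ih =>
    cases j <;> simp only [visits] <;> split_ifs <;>
      first | exact le_rfl | exact hM.mulVec_nonneg (ih _) u

lemma hits_nonneg (hM : DoublySub M) (hx : ∀ u, 0 ≤ x u) (k t : ℕ) (u : V) :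
    0 ≤ hits M S x k t u := by
  unfold hits
  split_ifs
  · exact visits_nonneg hM hx t k u
  · exact le_rfl

lemma visits_sum {ι : Type*} (A : Finset ι) (y : ι → V → ℝ) (t j : ℕ) :
    visits M S (∑ a ∈ A, y a) t j = ∑ a ∈ A, visits M S (y a) t j := by
  induction t generalizing j with
  | zero => cases j <;> simp [visits]
  | succ t ih =>
    cases j <;> funext u <;> simp only [visits, Finset.sum_apply, ih] <;> split_ifs <;>
      simp [Matrix.mulVec_sum]

/-- Each vertex receives at most one unit of mass in all before the `j`-th return to `S`. -/
lemma sum_visits_indicator_le_one (hM : DoublySub M) (T j : ℕ) (u : V) :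
    ∑ t ∈ Finset.range T, visits M S ((S : Set V).indicator 1) t j u ≤ 1 := by
  have hmul : ∀ (T j : ℕ) (u : V), ∑ t ∈ Finset.range T,
      (M *ᵥ visits M S ((S : Set V).indicator 1) t j) u =
      (M *ᵥ ∑ t ∈ Finset.range T, visits M S ((S : Set V).indicator 1) t j) u := by
    intro T j u
    rw [Matrix.mulVec_sum, Finset.sum_apply]
  induction T generalizing j u with
  | zero => simp
  | succ T ih =>
    have hle : ∀ j u, (M *ᵥ ∑ t ∈ Finset.range T, visits M S ((S : Set V).indicator 1) t j) u ≤ 1 :=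
      fun j u => hM.mulVec_le zero_le_one (fun v => by rw [Finset.sum_apply]; exact ih j v) u
    -- Separate time `0`. Initial mass is counted only for `u ∈ S` and `j = 0`, where nothing is
    -- counted later; in all other cases the sum is `M` applied to a sum covered by induction.
    rw [Finset.sum_range_succ']
    by_cases hu : u ∈ S <;> cases j <;> simp [visits, hu, hmul, hle]

/-- Conservation of mass: a trajectory with at most `k` visits either keeps this property in the
next step or is then making visit `k + 1`. -/
lemma sum_visits_succ_add_hits (k t : ℕ) (u : V) :
    ∑ j ∈ Finset.range (k + 1), visits M S x (t + 1) j u + hits M S x (k + 1) (t + 1) u =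
      (M *ᵥ fun v => ∑ j ∈ Finset.range (k + 1), visits M S x t j v) u := by
  have hmul : (M *ᵥ fun v => ∑ j ∈ Finset.range (k + 1), visits M S x t j v) u =
      ∑ j ∈ Finset.range (k + 1), (M *ᵥ visits M S x t j) u := by
    have : (fun v => ∑ j ∈ Finset.range (k + 1), visits M S x t j v) =
        ∑ j ∈ Finset.range (k + 1), visits M S x t j := by
      funext v; rw [Finset.sum_apply]
    rw [this, Matrix.mulVec_sum, Finset.sum_apply]
  rw [hmul]
  by_cases hu : u ∈ S
  · rw [Finset.sum_range_succ', Finset.sum_range_succ]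
    simp [visits, hits, hu]
  · simp only [hits, hu, if_false, add_zero]
    refine Finset.sum_congr rfl fun j _ => ?_
    cases j <;> simp [visits, hu]

lemma sum_visits_le_pow_mulVec (hM : DoublySub M) (hx : ∀ u, 0 ≤ x u) (k t : ℕ) (u : V) :
    ∑ j ∈ Finset.range (k + 1), visits M S x t j u ≤ (M ^ t *ᵥ x) u := by
  induction t generalizing u with
  | zero => rw [Finset.sum_range_succ']; simp [visits]
  | succ t ih =>
    have h1 := sum_visits_succ_add_hits (M := M) (S := S) (x := x) k t u
    have h2 := hits_nonneg (S := S) hM hx (k + 1) (t + 1) u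
    rw [pow_succ', ← Matrix.mulVec_mulVec]
    have := hM.mulVec_mono ih u
    linarith

lemma visits_le_pow_mulVec (hM : DoublySub M) (hx : ∀ u, 0 ≤ x u) (k t : ℕ) (u : V) :
    visits M S x t k u ≤ (M ^ t *ᵥ x) u :=
  (Finset.single_le_sum (f := fun j => visits M S x t j u) (fun j _ => visits_nonneg hM hx t j u)
    (Finset.self_mem_range_succ k)).trans (sum_visits_le_pow_mulVec hM hx k t u)

/-- The trajectories with more than `k` visits gain at most `c` at each vertex in each step, and `M`
does not increase the supremum. So they accumulate at most `t * c` anywhere. -/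
lemma pow_mulVec_le_sum_visits (hM : DoublySub M) {k T : ℕ} {c : ℝ} (hc : 0 ≤ c)
    (hhits : ∀ t ≤ T, ∀ u, hits M S x (k + 1) t u ≤ c) {t : ℕ} (ht : t ≤ T) (u : V) :
    (M ^ t *ᵥ x) u ≤ ∑ j ∈ Finset.range (k + 1), visits M S x t j u + t * c := by
  induction t generalizing u with
  | zero => rw [Finset.sum_range_succ']; simp [visits]
  | succ t ih =>
    have h1 := sum_visits_succ_add_hits (M := M) (S := S) (x := x) k t u
    have h2 := hhits (t + 1) ht u
    rw [pow_succ', ← Matrix.mulVec_mulVec]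
    have h3 := hM.mulVec_mono (ih (by omega)) u
    have h4 : (M *ᵥ fun v => ∑ j ∈ Finset.range (k + 1), visits M S x t j v + t * c) u ≤
        (M *ᵥ fun v => ∑ j ∈ Finset.range (k + 1), visits M S x t j v) u + t * c := by
      have : (fun v => ∑ j ∈ Finset.range (k + 1), visits M S x t j v + t * c) =
          (fun v => ∑ j ∈ Finset.range (k + 1), visits M S x t j v) + fun _ => t * c := rfl
      rw [this, Matrix.mulVec_add, Pi.add_apply]
      have := hM.mulVec_le (x := fun _ : V => t * c) (by positivity) (fun _ => le_rfl) u
      linarith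
    push_cast
    linarith

/-- Visit counts never decrease. Hence in Kac's count a sum over `ℓ` times is at least `ℓ` times the
mass at the end. -/
lemma sum_sum_visits_antitone (hM : DoublySub M) (hx : ∀ u, 0 ≤ x u) (k : ℕ) {t t' : ℕ}
    (h : t ≤ t') :
    ∑ u, ∑ j ∈ Finset.range (k + 1), visits M S x t' j u ≤
      ∑ u, ∑ j ∈ Finset.range (k + 1), visits M S x t j u := by
  induction t', h using Nat.le_induction with
  | base => exact le_rfl
  | succ t' _ ih =>
    refine le_trans ?_ ih
    refine le_trans (Finset.sum_le_sum fun u _ => ?_) (hM.sum_mulVec_le (x := fun v =>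
      ∑ j ∈ Finset.range (k + 1), visits M S x t' j v)
      fun v => Finset.sum_nonneg fun j _ => visits_nonneg hM hx t' j v)
    have h1 := sum_visits_succ_add_hits (M := M) (S := S) (x := x) k t' u
    have h2 := hits_nonneg (S := S) hM hx (k + 1) (t' + 1) u
    linarith

/-- Kac's formula, as an upper bound for the mass that needs longer than `ℓ` for `k + 1` visits. -/
lemma sum_sum_visits_single_le (hM : DoublySub M) (k ℓ : ℕ) :
    ∑ s ∈ S, (ℓ : ℝ) * ∑ u, ∑ j ∈ Finset.range (k + 1), visits M S (Pi.single s 1) ℓ j u ≤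
      (k + 1) * Fintype.card V := by
  have hx : ∀ s u : V, 0 ≤ (Pi.single s (1 : ℝ) : V → ℝ) u := fun s u => by
    rw [Pi.single_apply]; split_ifs <;> norm_num
  have hsum : (∑ s ∈ S, Pi.single s (1 : ℝ) : V → ℝ) = (S : Set V).indicator 1 := by
    funext u
    simp [Finset.sum_apply, Pi.single_apply, Set.indicator_apply]
  calc _ ≤ ∑ s ∈ S, ∑ t ∈ Finset.range ℓ, ∑ u, ∑ j ∈ Finset.range (k + 1),
        visits M S (Pi.single s 1) t j u := by
        refine Finset.sum_le_sum fun s _ => ?_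
        calc _ = ∑ t ∈ Finset.range ℓ, ∑ u, ∑ j ∈ Finset.range (k + 1),
              visits M S (Pi.single s 1) ℓ j u := by simp
          _ ≤ _ := Finset.sum_le_sum fun t ht =>
              sum_sum_visits_antitone hM (hx s) k (Finset.mem_range.1 ht).le
    _ = ∑ u, ∑ j ∈ Finset.range (k + 1), ∑ t ∈ Finset.range ℓ,
        visits M S ((S : Set V).indicator 1) t j u := by
        simp only [← hsum, visits_sum, Finset.sum_apply]
        rw [Finset.sum_comm]
        simp only [Finset.sum_comm (s := S)]
        rw [Finset.sum_comm]
        refine Finset.sum_congr rfl fun u _ => Finset.sum_comm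
    _ ≤ ∑ u : V, ∑ j ∈ Finset.range (k + 1), (1 : ℝ) :=
        Finset.sum_le_sum fun u _ => Finset.sum_le_sum fun j _ =>
          sum_visits_indicator_le_one hM ℓ j u
    _ = _ := by simp; ring

/-! ### The induced chain -/

/-- Split by the time `τ` of the `k`-th visit, after which `S` is avoided. By `hx` the start counts
as visit number zero. -/
lemma visits_eq_sum_hits (hx : ∀ u, u ∉ S → x u = 0) (k t : ℕ) :
    visits M S x t k = ∑ τ ∈ Finset.range (t + 1),
      ((restr ((S : Set V)ᶜ) * M) ^ (t - τ)) *ᵥ hits M S x k τ := by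
  induction t with
  | zero =>
    funext u
    cases k <;> by_cases hu : u ∈ S <;> simp [visits, hits, hu, hx]
  | succ t ih =>
    have hrec : visits M S x (t + 1) k =
        (restr ((S : Set V)ᶜ) * M) *ᵥ visits M S x t k + hits M S x k (t + 1) := by
      funext u
      rw [Pi.add_apply, ← Matrix.mulVec_mulVec, restr_mulVec]
      by_cases hu : u ∈ S <;> cases k <;> simp [visits, hits, hu]
    rw [Finset.sum_range_succ, hrec, Nat.sub_self, pow_zero, Matrix.one_mulVec]
    congr 1
    rw [ih, Matrix.mulVec_sum]
    refine Finset.sum_congr rfl fun τ hτ => ?_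
    rw [Matrix.mulVec_mulVec, ← pow_succ', Nat.succ_sub (Nat.lt_succ_iff.1 (Finset.mem_range.1 hτ))]

/-- Here `p.1` is the time of the previous visit and `p.2` the number of vertices outside `S` in
between, so the excursion lasts `p.2 + 1` steps. -/
lemma hits_succ_succ (hx : ∀ u, u ∉ S → x u = 0) (k t : ℕ) (u : V) :
    hits M S x (k + 1) (t + 1) u = ∑ p ∈ Finset.HasAntidiagonal.antidiagonal t,
      ((restr (S : Set V) * M * (restr ((S : Set V)ᶜ) * M) ^ p.2 * restr (S : Set V)) *ᵥ
        hits M S x k p.1) u := by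
  have h1 : hits M S x (k + 1) (t + 1) u = ((restr (S : Set V) * M) *ᵥ visits M S x t k) u := by
    rw [← Matrix.mulVec_mulVec, restr_mulVec]
    by_cases hu : u ∈ S <;> simp [visits, hits, hu]
  have h2 : ∀ τ, restr (S : Set V) *ᵥ hits M S x k τ = hits M S x k τ := by
    intro τ
    funext v
    rw [restr_mulVec]
    by_cases hv : v ∈ S <;> simp [hits, hv]
  rw [h1, visits_eq_sum_hits hx, Matrix.mulVec_sum, Finset.sum_apply,
    Finset.Nat.sum_antidiagonal_eq_sum_range_succ (fun a b =>
      ((restr (S : Set V) * M * (restr ((S : Set V)ᶜ) * M) ^ b * restr (S : Set V)) *ᵥ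
        hits M S x k a) u)]
  refine Finset.sum_congr rfl fun τ _ => ?_
  rw [← Matrix.mulVec_mulVec (M := _ * _), h2, Matrix.mulVec_mulVec]

lemma sum_range_sum_antidiagonal (f : ℕ × ℕ → ℝ) (T : ℕ) {X : Finset (ℕ × ℕ)}
    (hX : ∀ p : ℕ × ℕ, p.1 + p.2 < T → p ∈ X) :
    ∑ t ∈ Finset.range T, ∑ p ∈ Finset.HasAntidiagonal.antidiagonal t, f p =
      ∑ p ∈ X, if p.1 + p.2 < T then f p else 0 := by
  have : ∀ t ∈ Finset.range T, ∑ p ∈ Finset.HasAntidiagonal.antidiagonal t, f p =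
      ∑ p ∈ X, if t = p.1 + p.2 then f p else 0 := by
    intro t ht
    rw [← Finset.sum_filter]
    refine Finset.sum_congr ?_ fun _ _ => rfl
    ext p
    rw [Finset.HasAntidiagonal.mem_antidiagonal, Finset.mem_filter, eq_comm]
    exact ⟨fun h => ⟨hX p (by rw [← h]; exact Finset.mem_range.1 ht), h⟩, fun h => h.2⟩
  rw [Finset.sum_congr rfl this, Finset.sum_comm]
  refine Finset.sum_congr rfl fun p _ => ?_
  rw [Finset.sum_ite_eq']
  simp

lemma inducedMatrix_summand_doublySub (hM : DoublySub M) (g : ℕ) :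
    DoublySub (restr (S : Set V) * M * (restr ((S : Set V)ᶜ) * M) ^ g * restr (S : Set V)) :=
  (((restr_doublySub _).mul hM).mul (((restr_doublySub _).mul hM).pow g)).mul (restr_doublySub _)

lemma inducedMatrix_nonneg (hM : DoublySub M) (ℓ : ℕ) (u v : V) :
    0 ≤ inducedMatrix M S ℓ u v := by
  rw [inducedMatrix, Matrix.sum_apply]
  exact Finset.sum_nonneg fun g _ => (inducedMatrix_summand_doublySub hM g).nonneg u v

/-- The time reversal of an excursion is an excursion of the same length and probability. -/
lemma inducedMatrix_symm (hM : ∀ u v, M u v = M v u) (ℓ : ℕ) (u v : V) :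
    inducedMatrix M S ℓ u v = inducedMatrix M S ℓ v u := by
  have hT : Mᵀ = M := by ext a b; exact hM b a
  have hcomm : ∀ g : ℕ, (M * restr ((S : Set V)ᶜ)) ^ g * M = M * (restr ((S : Set V)ᶜ) * M) ^ g := by
    intro g
    induction g with
    | zero => simp
    | succ g ih => rw [pow_succ', mul_assoc, ih, pow_succ']; simp only [mul_assoc]
  have : (inducedMatrix M S ℓ)ᵀ = inducedMatrix M S ℓ := by
    rw [inducedMatrix, Matrix.transpose_sum]
    refine Finset.sum_congr rfl fun g _ => ?_
    simp only [Matrix.transpose_mul, Matrix.transpose_pow, restr_transpose, hT]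
    rw [← mul_assoc _ M, hcomm]
    simp only [mul_assoc]
  conv_lhs => rw [← this, Matrix.transpose_apply]

lemma inducedMatrix_eq_zero (ℓ : ℕ) (u v : V) (hu : u ∉ S) : inducedMatrix M S ℓ u v = 0 := by
  rw [inducedMatrix, Matrix.sum_apply]
  refine Finset.sum_eq_zero fun g _ => ?_
  rw [mul_assoc, mul_assoc, restr_mul_apply]
  simp [hu]

lemma le_inducedMatrix (hM : DoublySub M) {ℓ : ℕ} (hℓ : 0 < ℓ) {u v : V} (hu : u ∈ S) (hv : v ∈ S) :
    M u v ≤ inducedMatrix M S ℓ u v := by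
  rw [inducedMatrix, Matrix.sum_apply]
  refine le_trans (le_of_eq ?_) (Finset.single_le_sum (fun g _ =>
    (inducedMatrix_summand_doublySub hM g).nonneg u v) (Finset.mem_range.2 hℓ))
  rw [pow_zero, mul_one, mul_restr_apply, restr_mul_apply]
  simp [hu, hv]

/-- A row collects the probabilities of disjoint events, the first return to `S` happening after `g
+ 1` steps. Columns follow by symmetry. -/
lemma inducedMatrix_doublySub (hM : DoublySub M) (hsymm : ∀ u v, M u v = M v u) (ℓ : ℕ) :
    DoublySub (inducedMatrix M S ℓ) := by
  have hrow : ∀ u, ∑ v, inducedMatrix M S ℓ u v ≤ 1 := by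
    intro u
    -- The probability that `S` is reached at a time below `L`, unfolded at the first step.
    have hy : ∀ (L : ℕ) (w : V), (∑ g ∈ Finset.range L, ((restr ((S : Set V)ᶜ) * M) ^ g *ᵥ
        (restr (S : Set V) *ᵥ fun _ => (1 : ℝ)))) w ≤ 1 := by
      intro L
      induction L with
      | zero => intro w; simp
      | succ L ih =>
        intro w
        rw [Finset.sum_range_succ']
        simp only [pow_succ', ← Matrix.mulVec_mulVec (M := restr ((S : Set V)ᶜ) * M)]
        rw [← Matrix.mulVec_sum, pow_zero, Matrix.one_mulVec, Pi.add_apply, restr_mulVec,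
          ← Matrix.mulVec_mulVec, restr_mulVec]
        have := hM.mulVec_le zero_le_one ih w
        by_cases hw : w ∈ S
        · simp [hw]
        · simpa [hw] using this
    have h1 : ∑ v, inducedMatrix M S ℓ u v = (inducedMatrix M S ℓ *ᵥ fun _ => (1 : ℝ)) u := by
      simp [Matrix.mulVec, dotProduct]
    have h2 : inducedMatrix M S ℓ *ᵥ (fun _ => (1 : ℝ)) = (restr (S : Set V) * M) *ᵥ
        ∑ g ∈ Finset.range ℓ, ((restr ((S : Set V)ᶜ) * M) ^ g *ᵥ
          (restr (S : Set V) *ᵥ fun _ => (1 : ℝ))) := by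
      rw [inducedMatrix, Matrix.sum_mulVec, Matrix.mulVec_sum]
      refine Finset.sum_congr rfl fun g _ => ?_
      simp only [Matrix.mulVec_mulVec, mul_assoc]
    rw [h1, h2]
    exact ((restr_doublySub _).mul hM).mulVec_le zero_le_one (hy ℓ) u
  refine ⟨inducedMatrix_nonneg hM ℓ, hrow, fun v => ?_⟩
  simp only [fun u => inducedMatrix_symm (S := S) hsymm ℓ u v]
  exact hrow v

lemma inducedMatrix_mulVec_sum_hits (ℓ k T : ℕ) (u : V) :
    (inducedMatrix M S ℓ *ᵥ ∑ t ∈ Finset.range T, hits M S x k t) u =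
      ∑ p ∈ Finset.range T ×ˢ Finset.range ℓ,
        ((restr (S : Set V) * M * (restr ((S : Set V)ᶜ) * M) ^ p.2 * restr (S : Set V)) *ᵥ
          hits M S x k p.1) u := by
  rw [Finset.sum_product, Matrix.mulVec_sum, Finset.sum_apply]
  refine Finset.sum_congr rfl fun t _ => ?_
  rw [inducedMatrix, Matrix.sum_mulVec, Finset.sum_apply]

lemma sum_hits_succ (hx : ∀ u, u ∉ S → x u = 0) (k T : ℕ) (u : V) :
    (∑ t ∈ Finset.range (T + 1), hits M S x (k + 1) t) u =
      ∑ t ∈ Finset.range T, ∑ p ∈ Finset.HasAntidiagonal.antidiagonal t,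
      ((restr (S : Set V) * M * (restr ((S : Set V)ᶜ) * M) ^ p.2 * restr (S : Set V)) *ᵥ
        hits M S x k p.1) u := by
  have h0 : hits M S x (k + 1) 0 u = 0 := by simp [hits, visits]
  rw [Finset.sum_apply, Finset.sum_range_succ', h0, add_zero]
  exact Finset.sum_congr rfl fun t _ => hits_succ_succ hx k t u

/-- Up to time `T ≤ ℓ` no excursion is longer than `ℓ`, so the truncation in `inducedMatrix` loses
nothing. -/
lemma hits_le_inducedMatrix_pow (hM : DoublySub M) (hx0 : ∀ u, 0 ≤ x u) (hx : ∀ u, u ∉ S → x u = 0)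
    (hsymm : ∀ u v, M u v = M v u) {ℓ T : ℕ} (hT : T ≤ ℓ) (k : ℕ) (u : V) :
    (∑ t ∈ Finset.range (T + 1), hits M S x k t) u ≤ (inducedMatrix M S ℓ ^ k *ᵥ x) u := by
  have hK := inducedMatrix_doublySub (S := S) hM hsymm ℓ
  induction k generalizing u with
  | zero =>
    rw [Finset.sum_apply, Finset.sum_range_succ']
    have : ∀ t, hits M S x 0 (t + 1) u = 0 := by
      intro t
      by_cases hu : u ∈ S <;> simp [hits, visits, hu]
    simp only [this, Finset.sum_const_zero, zero_add, pow_zero, Matrix.one_mulVec]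
    simp only [hits, visits]
    split_ifs
    · exact le_rfl
    · exact hx0 u
  | succ k ih =>
    rw [pow_succ', ← Matrix.mulVec_mulVec]
    refine le_trans ?_ (hK.mulVec_mono ih u)
    rw [sum_hits_succ hx, inducedMatrix_mulVec_sum_hits,
      sum_range_sum_antidiagonal _ T (X := Finset.range (T + 1) ×ˢ Finset.range ℓ)
        fun p hp => Finset.mem_product.2 ⟨Finset.mem_range.2 (by omega), Finset.mem_range.2 (by omega)⟩]
    refine Finset.sum_le_sum fun p _ => ?_
    split_ifs
    · exact le_rfl
    · exact (inducedMatrix_summand_doublySub hM _).mulVec_nonneg (hits_nonneg hM hx0 _ _) u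

/-- Conversely, `k` excursions of at most `ℓ` steps each are over by time `k * ℓ`. -/
lemma inducedMatrix_pow_le_sum_hits (hM : DoublySub M) (hx0 : ∀ u, 0 ≤ x u)
    (hx : ∀ u, u ∉ S → x u = 0) (hsymm : ∀ u v, M u v = M v u) (ℓ k : ℕ) (u : V) :
    (inducedMatrix M S ℓ ^ k *ᵥ x) u ≤ (∑ t ∈ Finset.range (k * ℓ + 1), hits M S x k t) u := by
  have hK := inducedMatrix_doublySub (S := S) hM hsymm ℓ
  induction k generalizing u with
  | zero =>
    simp only [pow_zero, Matrix.one_mulVec, zero_mul, zero_add, Finset.range_one,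
      Finset.sum_singleton, hits, visits]
    split_ifs with h
    · exact le_rfl
    · exact (hx u h).le
  | succ k ih =>
    rw [pow_succ', ← Matrix.mulVec_mulVec]
    refine (hK.mulVec_mono ih u).trans ?_
    rw [sum_hits_succ hx, inducedMatrix_mulVec_sum_hits,
      sum_range_sum_antidiagonal _ ((k + 1) * ℓ)
        (X := Finset.range ((k + 1) * ℓ) ×ˢ Finset.range ((k + 1) * ℓ))
        fun p hp => Finset.mem_product.2 ⟨Finset.mem_range.2 (by omega), Finset.mem_range.2 (by omega)⟩,
      ← Finset.sum_filter]
    refine Finset.sum_le_sum_of_subset_of_nonneg ?_ fun p _ _ =>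
      (inducedMatrix_summand_doublySub hM _).mulVec_nonneg (hits_nonneg hM hx0 _ _) u
    intro p hp
    simp only [Finset.mem_product, Finset.mem_range, Finset.mem_filter, add_mul, one_mul] at hp ⊢
    omega

end Visits

end MinorFinding

namespace MinorFinding

open scoped ENNReal Matrix

set_option linter.unusedSectionVars false

/-! ### Existence of pieces -/

section Piece

variable {n : ℕ} {G : SimpleGraph (Fin n)} [DecidableRel G.Adj] {d : ℕ} [NeZero d]

/-- Convexity of the norm: `A *ᵥ b` is a nonnegative combination of columns of squared norm at most
`B`. -/
lemma sum_mulVec_sq_le_of_col {V : Type*} [Fintype V] {A : Matrix V V ℝ} {b : V → ℝ} {B : ℝ}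
    (hb : ∀ w, 0 ≤ b w) (hA : ∀ w, ∑ v, A v w ^ 2 ≤ B) :
    ∑ v, (A *ᵥ b) v ^ 2 ≤ (∑ w, b w) ^ 2 * B := by
  have key : ∀ v, (A *ᵥ b) v ^ 2 ≤ (∑ w, b w) * ∑ w, b w * A v w ^ 2 := by
    intro v
    have := Finset.sum_mul_sq_le_sq_mul_sq Finset.univ (fun w => √(b w)) (fun w => √(b w) * A v w)
    have e1 : ∀ w, √(b w) * (√(b w) * A v w) = A v w * b w := fun w => by
      rw [← mul_assoc, Real.mul_self_sqrt (hb w), mul_comm]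
    have e2 : ∀ w, √(b w) ^ 2 = b w := fun w => Real.sq_sqrt (hb w)
    simp only [e1, mul_pow, e2] at this
    exact this
  have hsum : 0 ≤ ∑ w, b w := Finset.sum_nonneg fun w _ => hb w
  calc ∑ v, (A *ᵥ b) v ^ 2 ≤ ∑ v, (∑ w, b w) * ∑ w, b w * A v w ^ 2 :=
        Finset.sum_le_sum fun v _ => key v
    _ = (∑ w, b w) * ∑ w, b w * ∑ v, A v w ^ 2 := by
        rw [← Finset.mul_sum, Finset.sum_comm]
        simp only [Finset.mul_sum]
    _ ≤ (∑ w, b w) * ∑ w, b w * B :=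
        mul_le_mul_of_nonneg_left
          (Finset.sum_le_sum fun w _ => mul_le_mul_of_nonneg_left (hA w) (hb w)) hsum
    _ = _ := by rw [← Finset.sum_mul]; ring

/-- Every edge inside `S` is an excursion of one step, of probability `1 / (2d)`. So a sparse cut of
the induced chain is a sparse cut of the graph. -/
lemma card_interedges_le (hd : ∀ v, G.degree v ≤ d) {ℓ : ℕ} (hℓ : 0 < ℓ) {S P : Finset (Fin n)}
    (hPS : P ⊆ S) :
    ((G.interedges P (S \ P)).card : ℝ) ≤
      2 * d * ∑ u ∈ P, ∑ v ∈ S \ P, inducedMatrix (stepMatrix G d) S ℓ u v := by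
  have hM := stepMatrix_doublySub G d hd
  have hd0 : (0 : ℝ) < d := by exact_mod_cast Nat.pos_of_ne_zero (NeZero.ne d)
  rw [← Finset.sum_product' P (S \ P) fun u v => inducedMatrix (stepMatrix G d) S ℓ u v,
    Finset.mul_sum]
  have h1 : ((G.interedges P (S \ P)).card : ℝ) =
      ∑ p ∈ P ×ˢ (S \ P), if G.Adj p.1 p.2 then (1 : ℝ) else 0 := by
    rw [Finset.sum_boole]; rfl
  rw [h1]
  refine Finset.sum_le_sum fun p hp => ?_
  rw [Finset.mem_product, Finset.mem_sdiff] at hp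
  have hK := le_inducedMatrix hM hℓ (hPS hp.1) hp.2.1
  have hne : p.1 ≠ p.2 := fun h => hp.2.2 (h ▸ hp.1)
  rw [stepMatrix_of_ne G d hd hne] at hK
  have := mul_le_mul_of_nonneg_left hK (by positivity : (0 : ℝ) ≤ 2 * d)
  refine le_trans (le_of_eq ?_) this
  split_ifs
  · field_simp
  · simp

/-- The mass of `K ^ k` is spread over the possible times `0, …, k * ℓ` of the `k`-th visit; some
time carries an average share. -/
lemma exists_le_walkProb (hd : ∀ v, G.degree v ≤ d) {S : Finset (Fin n)} {s : Fin n} (hs : s ∈ S)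
    {ℓ k : ℕ} {θ : ℝ} {v : Fin n}
    (h : θ ≤ (inducedMatrix (stepMatrix G d) S ℓ ^ k) s v) :
    ∃ t ≤ k * ℓ, θ / (k * ℓ + 1) ≤ walkProb G d s t v := by
  have hM := stepMatrix_doublySub G d hd
  have hsymm := stepMatrix_isSymm G d hd
  have hx0 : ∀ u : Fin n, 0 ≤ (Pi.single s (1 : ℝ) : Fin n → ℝ) u := fun u => by
    rw [Pi.single_apply]; split_ifs <;> norm_num
  have hx : ∀ u, u ∉ S → (Pi.single s (1 : ℝ) : Fin n → ℝ) u = 0 := fun u hu => by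
    rw [Pi.single_apply, if_neg]; rintro rfl; exact hu hs
  have hpow : ∀ (A : Matrix (Fin n) (Fin n) ℝ) (hA : ∀ u v, A u v = A v u) (m : ℕ),
      (A ^ m *ᵥ Pi.single s 1) v = (A ^ m) s v := by
    intro A hA m
    have hT : Aᵀ = A := by ext a b; exact hA b a
    rw [Matrix.mulVec_single_one, Matrix.col_apply]
    conv_lhs => rw [← hT, ← Matrix.transpose_pow, Matrix.transpose_apply]
  have h1 := inducedMatrix_pow_le_sum_hits hM hx0 hx hsymm ℓ k v
  rw [hpow _ (inducedMatrix_symm hsymm ℓ)] at h1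
  have h2 : (∑ t ∈ Finset.range (k * ℓ + 1), hits (stepMatrix G d) S (Pi.single s 1) k t) v ≤
      ∑ t ∈ Finset.range (k * ℓ + 1), walkProb G d s t v := by
    rw [Finset.sum_apply]
    refine Finset.sum_le_sum fun t _ => ?_
    rw [walkProb_eq, ← hpow _ hsymm]
    refine le_trans ?_ (visits_le_pow_mulVec (S := S) hM hx0 k t v)
    unfold hits
    split_ifs
    · exact le_rfl
    · exact visits_nonneg hM hx0 _ _ _
  have h3 : ∑ t ∈ Finset.range (k * ℓ + 1), θ / (k * ℓ + 1) = θ := by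
    rw [Finset.sum_const, Finset.card_range, nsmul_eq_mul]
    push_cast
    field_simp
  obtain ⟨t, ht, hle⟩ := Finset.exists_le_of_sum_le (by simp) (h3.le.trans (h.trans (h1.trans h2)))
  exact ⟨t, Nat.lt_succ_iff.1 (Finset.mem_range.1 ht), hle⟩

/-- If the return vectors from many vertices of `S` are concentrated, one of them has a piece. -/
theorem exists_isPiece (hn : 0 < n) (hd : ∀ v, G.degree v ≤ d) {δ α θ B Γ : ℝ} {i k : ℕ}
    {S S' : Finset (Fin n)} (hS'S : S' ⊆ S) (hα : 0 < α) (hS' : α * n ≤ S'.card)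
    (hB : ∀ w ∈ S, returnNormSq G d δ S i w ≤ B) (hB0 : 0 ≤ B)
    (hΓ : ∀ s ∈ S', Γ ≤ returnNormSq G d δ S (i + 1) s)
    (hδ : 0 ≤ δ) (hθ : 0 ≤ θ)
    (htime : ((k + 1 : ℕ) * baseLength n δ : ℝ) ≤ 160 * (n : ℝ) ^ (δ * (i + 7)) / α)
    (hprob : α / (n : ℝ) ^ (δ * (2 * i + 14)) ≤ θ / ((k + 1 : ℕ) * baseLength n δ + 1))
    (hnum : 2 * (baseLength n δ * ((1 - ((n : ℝ) ^ (-δ / 4)) ^ 2 / 2) ^ (k + 1) + θ)) +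
      2 * (((k + 1) / (α * baseLength n δ)) ^ 2 * B) < Γ) :
    ∃ s ∈ S', ∃ P, IsPiece G d δ α i S s P := by
  by_contra! hno
  set ℓ := baseLength n δ with hℓdef
  have hℓ : 0 < ℓ := baseLength_pos hn δ
  have hℓ' : (0 : ℝ) < ℓ := by exact_mod_cast hℓ
  have hn' : (0 : ℝ) < n := by exact_mod_cast hn
  set M := stepMatrix G d with hMdef
  have hM : DoublySub M := stepMatrix_doublySub G d hd
  have hsymm : ∀ u v, M u v = M v u := stepMatrix_isSymm G d hd
  set φ := (n : ℝ) ^ (-δ / 4) with hφdef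
  have hφ0 : 0 ≤ φ := Real.rpow_nonneg hn'.le _
  have hφ1 : φ ≤ 1 := Real.rpow_le_one_of_one_le_of_nonpos (by exact_mod_cast hn) (by linarith)
  have hx0 : ∀ s u : Fin n, 0 ≤ (Pi.single s (1 : ℝ) : Fin n → ℝ) u := fun s u => by
    rw [Pi.single_apply]; split_ifs <;> norm_num
  -- The part of the law after `ℓ` steps that belongs to at most `k` visits to `S`.
  set bad : Fin n → Fin n → ℝ := fun s u =>
    ∑ j ∈ Finset.range (k + 1), visits M S (Pi.single s 1) ℓ j u with hbad
  have hbad0 : ∀ s u, 0 ≤ bad s u := fun s u =>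
    Finset.sum_nonneg fun j _ => visits_nonneg hM (hx0 s) _ _ _
  -- a vertex from which `S` is visited often
  have hcard : (0 : ℝ) < S'.card := (mul_pos hα hn').trans_le hS'
  obtain ⟨s, hsS', hsbad⟩ : ∃ s ∈ S', ∑ u, bad s u ≤ (k + 1) / (α * ℓ) := by
    have hKac := sum_sum_visits_single_le (S := S) hM k ℓ
    rw [Fintype.card_fin] at hKac
    have hsub : ∑ s ∈ S', (ℓ : ℝ) * ∑ u, bad s u ≤ ∑ s ∈ S', (k + 1) / α := by
      calc _ ≤ ∑ s ∈ S, (ℓ : ℝ) * ∑ u, bad s u :=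
            Finset.sum_le_sum_of_subset_of_nonneg hS'S fun s _ _ =>
              mul_nonneg hℓ'.le (Finset.sum_nonneg fun u _ => hbad0 s u)
        _ ≤ (k + 1) * n := hKac
        _ ≤ _ := by
            rw [Finset.sum_const, nsmul_eq_mul, mul_div_assoc', le_div_iff₀ hα]
            have : (0 : ℝ) ≤ k + 1 := by positivity
            nlinarith
    obtain ⟨s, hs, hle⟩ := Finset.exists_le_of_sum_le
      (Finset.card_pos.1 (by exact_mod_cast hcard)) hsub
    refine ⟨s, hs, ?_⟩
    rw [← div_div, le_div_iff₀ hℓ', mul_comm]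
    exact hle
  have hsS := hS'S hsS'
  have hx : ∀ u, u ∉ S → (Pi.single s (1 : ℝ) : Fin n → ℝ) u = 0 := fun u hu => by
    rw [Pi.single_apply, if_neg]; rintro rfl; exact hu hsS
  set K := inducedMatrix M S ℓ with hKdef
  have hK : DoublySub K := inducedMatrix_doublySub hM hsymm ℓ
  have hKsymm : ∀ u v, K u v = K v u := inducedMatrix_symm hsymm ℓ
  -- the induced chain mixes
  have hmix := sum_pow_mulVec_le hK hKsymm (inducedMatrix_eq_zero ℓ)
    (fun v hv => (half_le_stepMatrix_self G d v).trans (le_inducedMatrix hM hℓ hv hv))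
    hφ0 hφ1 hθ (s := s) (T := k + 1) (by
      intro t ht P hPS hP hPθ
      by_contra! hlt
      refine hno s hsS' P ⟨hP, hPS, ?_, fun v hv => ?_⟩
      · refine (card_interedges_le hd hℓ hPS).trans ?_
        have : (0 : ℝ) ≤ 2 * d := by positivity
        nlinarith
      · obtain ⟨t', ht', hle⟩ := exists_le_walkProb hd hsS (hPθ v hv)
        have hmul : ((t + 1 : ℕ) * ℓ : ℝ) ≤ (k + 1 : ℕ) * ℓ := by
          have : ((t + 1 : ℕ) : ℝ) ≤ (k + 1 : ℕ) := by exact_mod_cast ht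
          exact mul_le_mul_of_nonneg_right this hℓ'.le
        refine ⟨t', ?_, ?_⟩
        · refine le_trans ?_ (hmul.trans htime)
          exact_mod_cast ht'
        · refine hprob.trans (le_trans ?_ hle)
          exact div_le_div_of_nonneg_left hθ (by positivity) (by linarith))
  -- Bound for the position at visit `k + 1`: `hmix` for a single vertex, where the square root is
  -- one.
  set c := (1 - φ ^ 2 / 2) ^ (k + 1) + θ with hc
  have hc0 : 0 ≤ c := add_nonneg (pow_nonneg (by nlinarith) _) hθ
  have hKc : ∀ v, (K ^ (k + 1)) s v ≤ c := fun v => by simpa using hmix {v}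
  have hhits : ∀ t ≤ ℓ, ∀ u, hits M S (Pi.single s 1) (k + 1) t u ≤ c := by
    intro t ht u
    have h1 := hits_le_inducedMatrix_pow hM (hx0 s) hx hsymm ht (k + 1) u
    have hT : Kᵀ = K := by ext a b; exact hKsymm b a
    rw [← hKdef, Matrix.mulVec_single_one, Matrix.col_apply] at h1
    have h2 : (K ^ (k + 1)) u s = (K ^ (k + 1)) s u := by
      conv_lhs => rw [← hT, ← Matrix.transpose_pow, Matrix.transpose_apply]
    rw [h2, Finset.sum_apply] at h1
    exact (Finset.single_le_sum (f := fun t => hits M S (Pi.single s 1) (k + 1) t u)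
      (fun t _ => hits_nonneg hM (hx0 s) _ _ _) (Finset.self_mem_range_succ t)).trans
      (h1.trans (hKc u))
  -- The complementary part of the law, with more than `k` visits. It is flat: the hits feed at most
  -- `c` into a vertex in each of the `ℓ` steps.
  set g : Fin n → ℝ := fun u => (M ^ ℓ *ᵥ Pi.single s 1) u - bad s u with hg
  have hg0 : ∀ u, 0 ≤ g u := fun u =>
    sub_nonneg.2 (sum_visits_le_pow_mulVec hM (hx0 s) k ℓ u)
  have hgc : ∀ u, g u ≤ ℓ * c := fun u => by
    have := pow_mulVec_le_sum_visits hM hc0 hhits le_rfl u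
    simp only [hg, hbad]; linarith
  have hg1 : ∑ u, g u ≤ 1 := by
    calc ∑ u, g u ≤ ∑ u, (M ^ ℓ *ᵥ Pi.single s 1) u :=
          Finset.sum_le_sum fun u _ => by simp only [hg]; linarith [hbad0 s u]
      _ ≤ ∑ u, (Pi.single s 1 : Fin n → ℝ) u := (hM.pow ℓ).sum_mulVec_le (hx0 s)
      _ = 1 := by simp
  -- split the return vector
  set Q := returnMatrix G d ℓ S with hQdef
  have hQ : DoublySub Q := returnMatrix_doublySub hd ℓ S
  -- One block of `ℓ` steps is split into `g` and `bad s`; `2 ^ i` further blocks provide the norm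
  -- bound `B`, and the last `m` are only used as contractions.
  obtain ⟨m, hm⟩ : ∃ m, 2 ^ (i + 1) = 2 ^ i + m + 1 :=
    ⟨2 ^ i - 1, by have := Nat.one_le_two_pow (n := i); rw [pow_succ]; omega⟩
  have hsplit : ∀ u, (Q ^ 2 ^ (i + 1)) s u =
      (Q ^ (2 ^ i + m) *ᵥ g) u + (Q ^ (2 ^ i + m) *ᵥ bad s) u := by
    intro u
    have hadd : g + bad s = M ^ ℓ *ᵥ Pi.single s 1 := by funext w; simp [hg]
    rw [← Pi.add_apply, ← Matrix.mulVec_add, hadd, Matrix.mulVec_mulVec, Matrix.mulVec_single_one,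
      Matrix.col_apply, returnMatrix_pow_symm hd, hm, pow_succ]
    have hne : 2 ^ i + m ≠ 0 := by positivity
    have hQM : Q ^ (2 ^ i + m) * Q = Q ^ (2 ^ i + m) * M ^ ℓ * restr (S : Set (Fin n)) := by
      conv_lhs => enter [2]; rw [hQdef, returnMatrix]
      rw [← mul_assoc, ← mul_assoc, returnMatrix_pow_mul_restr ℓ S hne]
    rw [hQM, mul_restr_apply]
    simp [hsS]
  have hnorm : returnNormSq G d δ S (i + 1) s ≤ 2 * (ℓ * c) +
      2 * (((k + 1) / (α * ℓ)) ^ 2 * B) := by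
    rw [returnNormSq_eq hd hℓ (i + 1) hsS, ← sum_returnMatrix_pow_sq hd]
    -- Supremum times total mass.
    have h1 : ∑ u, (Q ^ (2 ^ i + m) *ᵥ g) u ^ 2 ≤ ℓ * c := by
      have hy0 := (hQ.pow (2 ^ i + m)).mulVec_nonneg hg0
      calc _ ≤ ∑ u, ℓ * c * (Q ^ (2 ^ i + m) *ᵥ g) u := by
            refine Finset.sum_le_sum fun u _ => ?_
            rw [sq]
            exact mul_le_mul_of_nonneg_right
              ((hQ.pow (2 ^ i + m)).mulVec_le (by positivity) hgc u) (hy0 u)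
        _ = ℓ * c * ∑ u, (Q ^ (2 ^ i + m) *ᵥ g) u := by rw [Finset.mul_sum]
        _ ≤ ℓ * c * 1 := by
            refine mul_le_mul_of_nonneg_left ?_ (by positivity)
            exact ((hQ.pow _).sum_mulVec_le hg0).trans hg1
        _ = _ := mul_one _
    have h2 : ∑ u, (Q ^ (2 ^ i + m) *ᵥ bad s) u ^ 2 ≤ ((k + 1) / (α * ℓ)) ^ 2 * B := by
      refine (sum_mulVec_sq_le_of_col (B := B) (hbad0 s) fun w => ?_).trans ?_
      · simp only [hQdef, returnMatrix_pow_symm hd ℓ S _ _ w]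
        rw [sum_returnMatrix_pow_sq hd]
        by_cases hw : w ∈ S
        · refine (returnMatrix_pow_mulVec_sq hd ℓ S (2 ^ i) m w).trans ?_
          rw [← returnNormSq_eq hd hℓ i hw]
          exact hB w hw
        · rw [returnMatrix_pow_eq_zero_left ℓ S (by positivity) hw]
          exact hB0
      · refine mul_le_mul_of_nonneg_right ?_ hB0
        exact pow_le_pow_left₀ (Finset.sum_nonneg fun u _ => hbad0 s u) hsbad 2
    calc _ ≤ ∑ u, (2 * (Q ^ (2 ^ i + m) *ᵥ g) u ^ 2 + 2 * (Q ^ (2 ^ i + m) *ᵥ bad s) u ^ 2) := by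
          refine Finset.sum_le_sum fun u _ => ?_
          rw [← hQdef, hsplit]
          nlinarith [sq_nonneg ((Q ^ (2 ^ i + m) *ᵥ g) u - (Q ^ (2 ^ i + m) *ᵥ bad s) u)]
      _ = 2 * ∑ u, (Q ^ (2 ^ i + m) *ᵥ g) u ^ 2 + 2 * ∑ u, (Q ^ (2 ^ i + m) *ᵥ bad s) u ^ 2 := by
          rw [Finset.sum_add_distrib, Finset.mul_sum, Finset.mul_sum]
      _ ≤ _ := by linarith
  exact absurd (hΓ s hsS') (not_le.2 (hnorm.trans_lt hnum))

end Piece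

end MinorFinding

namespace MinorFinding

set_option linter.unusedSectionVars false

/-! ### Minors from families of walks -/

section Model

/-- The step by which a path first leaves `p`. It will supply the edge between two branch sets. -/
lemma exists_rel_of_takeWhile {V : Type*} {R : V → V → Prop} {p : V → Bool} {L : List V} {a w : V}
    (hchain : L.IsChain R) (hhead : L.head? = some a) (ha : p a) (hw : w ∈ L) (hpw : ¬ p w) :
    ∃ u ∈ L.takeWhile p, ∃ v ∈ L, ¬ p v ∧ R u v := by
  induction L generalizing a with
  | nil => simp at hw
  | cons b L ih =>
    obtain rfl : b = a := by simpa using hhead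
    have hwL : w ∈ L := by
      rcases List.mem_cons.1 hw with rfl | h
      · exact absurd ha hpw
      · exact h
    rw [List.isChain_cons] at hchain
    rw [List.takeWhile_cons_of_pos ha]
    obtain ⟨c, L', rfl⟩ := List.exists_cons_of_ne_nil (List.ne_nil_of_mem hwL)
    have hbc := hchain.1 c (by simp)
    by_cases hc : p c
    · obtain ⟨u, hu, v, hv, hpv, huv⟩ := ih hchain.2 (by simp) hc hwL
      exact ⟨u, List.mem_cons_of_mem _ hu, v, List.mem_cons_of_mem _ hv, hpv, huv⟩
    · exact ⟨b, by simp, c, by simp, hc, hbc⟩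

variable {n r : ℕ} {G : SimpleGraph (Fin n)}

lemma reachable_of_isChain {F : G.Subgraph} {C : Set (Fin n)} {L : List (Fin n)}
    {a : Fin n} (hL : L.IsChain fun u v => u = v ∨ F.Adj u v) (hLC : ∀ v ∈ L, v ∈ C)
    (hhead : L.head? = some a) (ha : a ∈ C) {v : Fin n} (hv : v ∈ L) :
    (F.induce C).coe.Reachable ⟨a, ha⟩ ⟨v, hLC v hv⟩ := by
  induction L generalizing a with
  | nil => simp at hv
  | cons b L ih =>
    obtain rfl : b = a := by simpa using hhead
    rcases List.mem_cons.1 hv with rfl | h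
    · exact SimpleGraph.Reachable.refl _
    · rw [List.isChain_cons] at hL
      obtain ⟨c, L', rfl⟩ := List.exists_cons_of_ne_nil (List.ne_nil_of_mem h)
      have hcC : c ∈ C := hLC c (by simp)
      have := ih hL.2 (fun v hv => hLC v (List.mem_cons_of_mem _ hv)) (by simp) hcC h
      refine SimpleGraph.Reachable.trans ?_ this
      rcases hL.1 c (by simp) with heq | hadj
      · subst heq; exact SimpleGraph.Reachable.refl _
      · refine SimpleGraph.Adj.reachable ?_
        rw [SimpleGraph.Subgraph.coe_adj, SimpleGraph.Subgraph.induce_adj]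
        exact ⟨ha, hcC, hadj⟩

/-- A family of walks from `r` vertices, walks with different starts and different labels being
disjoint, contains every graph on `r` vertices as a minor. -/
theorem exists_isMinorModel {κ : Type*} (hr : 3 ≤ r) (H : SimpleGraph (Fin r)) {F : G.Subgraph}
    (a : Fin r → Fin n) (k : Fin r → Fin r → κ) (P : Fin r → κ → List (Fin n))
    (hk : ∀ x y z w, x ≠ z → y ≠ w → x ≠ y → k x z = k y w → z = y ∧ w = x)
    (hk' : ∀ x y z, x ≠ y → x ≠ z → k x y = k x z → y = z)
    (hksymm : ∀ x y, k x y = k y x)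
    (hhead : ∀ x j, (P x j).head? = some (a x))
    (hchain : ∀ x j, (P x j).IsChain fun u v => u = v ∨ F.Adj u v)
    (hverts : ∀ x j, ∀ v ∈ P x j, v ∈ F.verts)
    (hmeet : ∀ x y, x ≠ y → ∃ v ∈ P x (k x y), v ∈ P y (k x y))
    (hdisj : ∀ x y j j', x ≠ y → j ≠ j' → ∀ v ∈ P x j, v ∉ P y j') :
    ∃ B, IsMinorModel H F B := by
  classical
  -- The branch set of `x` consists of its paths with the labels `k x y`. The paths of `x` and `y`
  -- with the common label `k x y` meet, so the larger of the two indices stops just before touching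
  -- the path of the smaller one.
  let Tr : Fin r → Fin r → List (Fin n) := fun x y =>
    if x < y then P x (k x y) else (P x (k x y)).takeWhile fun v => v ∉ P y (k x y)
  have hTrsub : ∀ x y v, v ∈ Tr x y → v ∈ P x (k x y) := by
    intro x y v hv
    simp only [Tr] at hv
    split_ifs at hv
    · exact hv
    · exact (List.takeWhile_prefix _).subset hv
  have hthird : ∀ x y : Fin r, ∃ z, z ≠ x ∧ z ≠ y := by
    intro x y
    obtain ⟨z, hz⟩ := Finset.exists_mem_notMem_of_card_lt_card
      (s := {x, y}) (t := (Finset.univ : Finset (Fin r)))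
      (lt_of_le_of_lt Finset.card_le_two (by rw [Finset.card_univ, Fintype.card_fin]; omega))
    exact ⟨z, by simpa using hz⟩
  -- This needs a third index: `a x` also lies on a path of `x` with another label, which is
  -- disjoint from the path of `y`.
  have hanot : ∀ x y, x ≠ y → a x ∉ P y (k x y) := by
    intro x y hxy
    obtain ⟨z, hzx, hzy⟩ := hthird x y
    have h1 : a x ∈ P x (k x z) := List.mem_of_mem_head? (by rw [hhead]; rfl)
    refine hdisj x y _ _ hxy (fun h => hzy ?_) _ h1
    exact (hk' x y z hxy hzx.symm h.symm).symm
  have hTrhead : ∀ x y, x ≠ y → (Tr x y).head? = some (a x) := by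
    intro x y hxy
    simp only [Tr]
    split_ifs
    · exact hhead x _
    · obtain ⟨b, L, hL⟩ := List.exists_cons_of_ne_nil (l := P x (k x y)) (by
        intro h; simpa [h] using hhead x (k x y))
      have hb : b = a x := by simpa [hL] using hhead x (k x y)
      rw [hL, List.takeWhile_cons_of_pos]
      · simp [hb]
      · simpa [hb, ← hL] using hanot x y hxy
  have hTrchain : ∀ x y, (Tr x y).IsChain fun u v => u = v ∨ F.Adj u v := by
    intro x y
    simp only [Tr]
    split_ifs
    · exact hchain x _
    · exact (hchain x _).prefix (List.takeWhile_prefix _)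
  let B : Fin r → Finset (Fin n) := fun x =>
    (Finset.univ.filter fun y => y ≠ x).biUnion fun y => (Tr x y).toFinset
  have hmemB : ∀ x v, v ∈ B x ↔ ∃ y, y ≠ x ∧ v ∈ Tr x y := by
    intro x v; simp [B]
  have haB : ∀ x, a x ∈ B x := by
    intro x
    obtain ⟨y, hy, -⟩ := hthird x x
    exact (hmemB x _).2 ⟨y, hy, List.mem_of_mem_head? (by rw [hTrhead x y hy.symm]; rfl)⟩
  refine ⟨B, fun x => ⟨fun v hv => ?_, ?_⟩, fun x y hxy => ?_, fun x y hxy => ?_⟩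
  · obtain ⟨y, -, hv⟩ := (hmemB x v).1 hv
    exact hverts x _ v (hTrsub x y v hv)
  · rw [SimpleGraph.Subgraph.connected_iff]
    refine ⟨?_, ⟨a x, haB x⟩⟩
    have hreach : ∀ v (hv : v ∈ B x), (F.induce (B x : Set (Fin n))).coe.Reachable
        ⟨a x, haB x⟩ ⟨v, hv⟩ := by
      intro v hv
      obtain ⟨y, hy, hvy⟩ := (hmemB x v).1 hv
      exact reachable_of_isChain (hTrchain x y)
        (fun w hw => Finset.mem_coe.2 ((hmemB x w).2 ⟨y, hy, hw⟩)) (hTrhead x y hy.symm) _ hvy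
    constructor
    rintro ⟨u, hu⟩ ⟨v, hv⟩
    exact (hreach u hu).symm.trans (hreach v hv)
  · rw [Finset.disjoint_left]
    intro v hvx hvy
    obtain ⟨z, hz, hvz⟩ := (hmemB x v).1 hvx
    obtain ⟨w, hw, hvw⟩ := (hmemB y v).1 hvy
    -- Different labels are separated by `hdisj`. Equal labels can only come from the pair of `x`
    -- and `y` itself, and there the truncation separates.
    by_cases hkk : k x z = k y w
    · obtain ⟨rfl, rfl⟩ := hk x y z w hz.symm hw.symm hxy hkk
      rcases lt_or_gt_of_ne hxy with h | h
      · simp only [Tr, if_neg h.asymm] at hvw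
        have := List.mem_takeWhile_imp hvw
        rw [hksymm] at this
        simp only [decide_eq_true_eq] at this
        exact this (hTrsub _ _ _ hvz)
      · simp only [Tr, if_neg h.asymm] at hvz
        have := List.mem_takeWhile_imp hvz
        rw [hksymm] at this
        simp only [decide_eq_true_eq] at this
        exact this (hTrsub _ _ _ hvw)
    · exact hdisj x y _ _ hxy hkk v (hTrsub _ _ _ hvz) (hTrsub _ _ _ hvw)
  -- The path of `y` meets that of `x`, so its truncation is left through an edge that ends on the
  -- full path of `x`.
  · have hmain : ∀ x y, x < y → ∃ u ∈ B x, ∃ v ∈ B y, F.Adj u v := by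
      intro x y hlt
      obtain ⟨w, hwx, hwy⟩ := hmeet y x hlt.ne'
      obtain ⟨u, hu, v, hv, hpv, huv⟩ := exists_rel_of_takeWhile
        (p := fun v => decide (v ∉ P x (k y x))) (hchain y (k y x)) (hhead y (k y x))
        (by simpa using hanot y x hlt.ne') hwx (by simpa using hwy)
      have hvx : v ∈ P x (k y x) := by simpa using hpv
      have hux : u ∉ P x (k y x) := by simpa using List.mem_takeWhile_imp hu
      have huB : u ∈ B y := (hmemB y u).2 ⟨x, hlt.ne, by simpa [Tr, if_neg hlt.asymm] using hu⟩
      have hvB : v ∈ B x := (hmemB x v).2 ⟨y, hlt.ne', by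
        simp only [Tr, if_pos hlt]; rwa [hksymm]⟩
      refine ⟨v, hvB, u, huB, ?_⟩
      rcases huv with rfl | h
      · exact absurd hvx hux
      · exact h.symm
    rcases lt_or_gt_of_ne hxy.ne with h | h
    · exact hmain x y h
    · obtain ⟨u, hu, v, hv, huv⟩ := hmain y x h
      exact ⟨v, hv, u, hu, huv.symm⟩

lemma isChain_walksSubgraph {L : List (List (Fin n))} {W : List (Fin n)} (hW : W ∈ L)
    (hchain : W.IsChain fun u v => u = v ∨ G.Adj u v) :
    W.IsChain fun u v => u = v ∨ (walksSubgraph G L).Adj u v := by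
  rw [List.isChain_iff_forall_rel_of_append_cons_cons] at hchain ⊢
  intro u v l₁ l₂ h
  rcases hchain h with heq | hadj
  · exact Or.inl heq
  · refine Or.inr ⟨hadj, W, hW, Or.inl ⟨l₁, l₂, ?_⟩⟩
    simp [h]

end Model

end MinorFinding

namespace MinorFinding

open scoped ENNReal Matrix

set_option linter.unusedSectionVars false

/-! ### Collisions of independent samples -/

section Collisions

variable {β γ : Type}

/-- Second moment method without square roots: for `y = X / (2m)` one has `2y ≤ 1 + y²` where `X ≠
0`. Take expectations; `y` has mean `1/2` and second moment at most `1/2`. -/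
lemma half_le_expect_ne_zero {p : PMF β} {X : β → ℝ≥0∞} (h0 : expect p X ≠ 0)
    (htop : expect p X ≠ ⊤) (h2 : expect p (fun x => X x ^ 2) ≤ 2 * expect p X ^ 2) :
    1 / 2 ≤ expect p ({x | X x ≠ 0}.indicator 1) := by
  set m := expect p X with hm
  set c := (2 * m)⁻¹ with hc
  have hcm : c * m = 1 / 2 := by
    rw [hc, ENNReal.mul_inv (by simp) (by simp), mul_assoc, ENNReal.inv_mul_cancel h0 htop, mul_one,
      one_div]
  have hpt : ∀ x, 2 * c * X x ≤ {x | X x ≠ 0}.indicator 1 x + c ^ 2 * X x ^ 2 := by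
    intro x
    by_cases hx : X x = 0
    · simp [hx]
    · have : {x | X x ≠ 0}.indicator (1 : β → ℝ≥0∞) x = 1 := Set.indicator_of_mem hx _
      rw [this, ← mul_pow, mul_assoc]
      generalize c * X x = y
      induction y using ENNReal.recTopCoe with
      | top => simp
      | coe y =>
        have := two_mul_le_add_sq 1 y
        rw [mul_one, one_pow] at this
        exact_mod_cast this
  have h := expect_mono (p := p) hpt
  rw [expect_add, expect_const_mul, expect_const_mul, mul_assoc, ← hm, hcm] at h
  have h3 : c ^ 2 * expect p (fun x => X x ^ 2) ≤ 1 / 2 := by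
    calc _ ≤ c ^ 2 * (2 * m ^ 2) := by gcongr
      _ = 2 * (c * m) ^ 2 := by ring
      _ = 1 / 2 := by
          rw [hcm, sq, ← mul_assoc, one_div, ENNReal.mul_inv_cancel (by simp) (by simp), one_mul]
  have h4 : (1 : ℝ≥0∞) ≤ expect p ({x | X x ≠ 0}.indicator 1) + 1 / 2 := by
    calc (1 : ℝ≥0∞) = 2 * (1 / 2) := by
          rw [one_div, ENNReal.mul_inv_cancel (by simp) (by simp)]
      _ ≤ _ := h.trans (by gcongr)
  have h5 : (1 : ℝ≥0∞) = 1 / 2 + 1 / 2 := by simp [ENNReal.inv_two_add_inv_two]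
  exact (ENNReal.add_le_add_iff_right (by simp : (1 / 2 : ℝ≥0∞) ≠ ⊤)).1 (h5.symm.le.trans h4)

lemma sum_map_filter_product (l : List β) (l' : List γ) (q : β × γ → Bool) (f : β × γ → ℝ≥0∞) :
    (((l ×ˢ l').filter q).map f).sum =
      (l.map fun a => (l'.map fun b => if q (a, b) then f (a, b) else 0).sum).sum := by
  induction l with
  | nil => simp
  | cons a l ih =>
    rw [List.product_cons, List.filter_append, List.map_append, List.sum_append, ih, List.map_cons,
      List.sum_cons]
    congr 1
    clear ih
    induction l' with
    | nil => simp
    | cons b l' ih' =>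
      by_cases h : q (a, b) <;> simp_all

lemma expect_double_sum (k : ℕ) (p : PMF β) (q : PMF γ) (c : β → γ → ℝ≥0∞) :
    expect (independent (List.replicate k p)) (fun l =>
      expect (independent (List.replicate k q)) fun l' =>
        (l.map fun a => (l'.map fun b => c a b).sum).sum) =
      k ^ 2 * expect p fun a => expect q fun b => c a b := by
  have hsum : ∀ l : List β, expect (independent (List.replicate k q)) (fun l' =>
      (l.map fun a => (l'.map fun b => c a b).sum).sum) =
      (l.map fun a => k * expect q fun b => c a b).sum := by
    intro l
    induction l with
    | nil => simp [expect_const]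
    | cons a l ih =>
      simp only [List.map_cons, List.sum_cons, expect_add, ih, expect_independent_replicate_sum]
  simp only [hsum, expect_independent_replicate_sum, expect_const_mul]
  ring

/-- In the expanded square, two pairs of samples agree in both entries (`k²` terms), in one (`2k³`,
whence `μ`) or in none (`k⁴`). Technically this is `expect_independent_replicate_sum_sq_le` for one
list after the other. -/
lemma expect_double_sum_sq_le (k : ℕ) (p : PMF β) (q : PMF γ) (c : β → γ → ℝ≥0∞)
    (hc : ∀ a b, c a b ^ 2 = c a b) (μ : ℝ≥0∞)
    (hp : ∀ a ∈ p.support, expect q (fun b => c a b) ≤ μ)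
    (hq : ∀ b ∈ q.support, expect p (fun a => c a b) ≤ μ) :
    expect (independent (List.replicate k p)) (fun l =>
      expect (independent (List.replicate k q)) fun l' =>
        (l.map fun a => (l'.map fun b => c a b).sum).sum ^ 2) ≤
      (k ^ 2 + 2 * k ^ 3 * μ) * (expect p fun a => expect q fun b => c a b) +
        k ^ 4 * (expect p fun a => expect q fun b => c a b) ^ 2 := by
  have hswap : ∀ (l : List β) (l' : List γ), (l.map fun a => (l'.map fun b => c a b).sum).sum =
      (l'.map fun b => (l.map fun a => c a b).sum).sum := by
    intro l l'
    induction l with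
    | nil => simp
    | cons a l ih => simp [ih, List.sum_map_add]
  have hlin : ∀ l : List β, expect q (fun b => (l.map fun a => c a b).sum) =
      (l.map fun a => expect q fun b => c a b).sum := by
    intro l
    induction l with
    | nil => simp [expect_const]
    | cons a l ih => simp only [List.map_cons, List.sum_cons, expect_add, ih]
  set P := expect p fun a => expect q fun b => c a b with hP
  have hP' : expect q (fun b => expect p fun a => c a b) = P := by rw [hP, expect_comm]
  have hsqp : expect p (fun a => expect q (fun b => c a b) ^ 2) ≤ μ * P := by
    rw [hP, ← expect_const_mul]
    refine expect_mono_support fun a ha => ?_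
    rw [sq]
    gcongr
    exact hp a ha
  have hsqq : expect q (fun b => expect p (fun a => c a b) ^ 2) ≤ μ * P := by
    rw [← hP', ← expect_const_mul]
    refine expect_mono_support fun b hb => ?_
    rw [sq]
    gcongr
    exact hq b hb
  calc _ ≤ expect (independent (List.replicate k p)) (fun l =>
        k * expect q (fun b => (l.map fun a => c a b).sum ^ 2) +
          k ^ 2 * (l.map fun a => expect q fun b => c a b).sum ^ 2) := by
        refine expect_mono fun l => ?_
        simp only [hswap l]
        refine (expect_independent_replicate_sum_sq_le k q _).trans ?_
        rw [hlin]
    _ = k * expect q (fun b => expect (independent (List.replicate k p)) fun l =>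
          (l.map fun a => c a b).sum ^ 2) +
        k ^ 2 * expect (independent (List.replicate k p)) (fun l =>
          (l.map fun a => expect q fun b => c a b).sum ^ 2) := by
        rw [expect_add, expect_const_mul, expect_const_mul, expect_comm]
    _ ≤ k * expect q (fun b => k * expect p (fun a => c a b) +
          k ^ 2 * expect p (fun a => c a b) ^ 2) +
        k ^ 2 * (k * expect p (fun a => expect q (fun b => c a b) ^ 2) + k ^ 2 * P ^ 2) := by
        gcongr
        · refine expect_mono fun b => ?_
          refine (expect_independent_replicate_sum_sq_le k p _).trans ?_
          simp only [hc, le_refl]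
        · exact expect_independent_replicate_sum_sq_le k p _
    _ ≤ k * (k * P + k ^ 2 * (μ * P)) + k ^ 2 * (k * (μ * P) + k ^ 2 * P ^ 2) := by
        rw [expect_add, expect_const_mul, expect_const_mul, hP']
        gcongr
    _ = _ := by ring

end Collisions

/-! ### Moments of the number of pairs found by FindPath -/

section FindPath

variable {n : ℕ} {G : SimpleGraph (Fin n)} [DecidableRel G.Adj] {d : ℕ} [NeZero d]

lemma expect_findPath_sum (δ : ℝ) (u v : Fin n) (k i : ℕ)
    (f : List (Fin n) × List (Fin n) → ℝ≥0∞) :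
    expect (findPath G d δ u v k i) (fun l => (l.map f).sum) =
      k ^ 2 * expect (walk G d u (2 ^ i * baseLength n δ)) fun W =>
        expect (walk G d v (2 ^ i * baseLength n δ)) fun W' =>
          if W.getLast? = W'.getLast? then f (W, W') else 0 := by
  simp only [findPath, expect_bind, expect_map, sum_map_filter_product, decide_eq_true_eq]
  exact expect_double_sum k _ _ fun W W' => if W.getLast? = W'.getLast? then f (W, W') else 0

lemma expect_findPath_sum_sq_le (δ : ℝ) (u v : Fin n) (k i : ℕ)
    (f : List (Fin n) × List (Fin n) → ℝ≥0∞) (hf : ∀ π, f π ^ 2 = f π) (μ : ℝ≥0∞)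
    (hu : ∀ W ∈ (walk G d u (2 ^ i * baseLength n δ)).support,
      expect (walk G d v (2 ^ i * baseLength n δ)) (fun W' =>
        if W.getLast? = W'.getLast? then f (W, W') else 0) ≤ μ)
    (hv : ∀ W' ∈ (walk G d v (2 ^ i * baseLength n δ)).support,
      expect (walk G d u (2 ^ i * baseLength n δ)) (fun W =>
        if W.getLast? = W'.getLast? then f (W, W') else 0) ≤ μ) (P : ℝ≥0∞)
    (hP : (expect (walk G d u (2 ^ i * baseLength n δ)) fun W =>
        expect (walk G d v (2 ^ i * baseLength n δ)) fun W' =>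
          if W.getLast? = W'.getLast? then f (W, W') else 0) = P) :
    expect (findPath G d δ u v k i) (fun l => (l.map f).sum ^ 2) ≤
      (k ^ 2 + 2 * k ^ 3 * μ) * P + k ^ 4 * P ^ 2 := by
  have hc : ∀ W W' : List (Fin n), (if W.getLast? = W'.getLast? then f (W, W') else 0) ^ 2 =
      if W.getLast? = W'.getLast? then f (W, W') else 0 := by
    intro W W'
    split_ifs
    · exact hf _
    · simp
  have h := expect_double_sum_sq_le k (walk G d u (2 ^ i * baseLength n δ))
    (walk G d v (2 ^ i * baseLength n δ)) _ hc μ hu hv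
  rw [hP] at h
  simp only [findPath, expect_bind, expect_map, sum_map_filter_product, decide_eq_true_eq]
  exact h

lemma mem_findPath_support {δ : ℝ} {u v : Fin n} {k i : ℕ}
    {l : List (List (Fin n) × List (Fin n))} (hl : l ∈ (findPath G d δ u v k i).support)
    {π : List (Fin n) × List (Fin n)} (hπ : π ∈ l) :
    π.1 ∈ (walk G d u (2 ^ i * baseLength n δ)).support ∧
    π.2 ∈ (walk G d v (2 ^ i * baseLength n δ)).support ∧ π.1.getLast? = π.2.getLast? := by
  simp only [findPath, PMF.mem_support_bind_iff, PMF.mem_support_map_iff] at hl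
  obtain ⟨Wu, hWu, Wv, hWv, rfl⟩ := hl
  rw [List.mem_filter, List.mem_product, decide_eq_true_eq] at hπ
  exact ⟨mem_support_of_mem_independent_replicate hWu hπ.1.1,
    mem_support_of_mem_independent_replicate hWv hπ.1.2, hπ.2⟩

/-! ### Returning walks -/

lemma pathMatrix_mono {Φ Φ' : ℕ → Set (Fin n)} {T : ℕ} (h : ∀ t, Φ t ⊆ Φ' t) (u v : Fin n) :
    pathMatrix G d Φ T u v ≤ pathMatrix G d Φ' T u v := by
  have hi : ∀ t w, (Φ t).indicator (1 : Fin n → ℝ) w ≤ (Φ' t).indicator 1 w := fun t w =>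
    Set.indicator_le_indicator_of_subset (h t) (fun _ => zero_le_one) w
  have h0 : ∀ (R : Set (Fin n)) w, 0 ≤ R.indicator (1 : Fin n → ℝ) w :=
    fun R w => Set.indicator_nonneg (fun _ _ => zero_le_one) w
  induction T generalizing v with
  | zero =>
    simp only [pathMatrix, restr_apply]
    split_ifs
    · exact hi 0 u
    · exact le_rfl
  | succ T ih =>
    simp only [pathMatrix, mul_restr_apply]
    simp only [Matrix.mul_apply]
    refine mul_le_mul (Finset.sum_le_sum fun w _ => ?_) (hi _ v) (h0 _ v) ?_
    · exact mul_le_mul_of_nonneg_right (ih w) (stepMatrix_nonneg G d _ _)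
    · exact Finset.sum_nonneg fun w _ =>
        mul_nonneg (pathMatrix_nonneg G d _ _ _ _) (stepMatrix_nonneg G d _ _)

open Classical in
/-- The mass of the constrained walks that pass through `v` at time `t`. -/
lemma expect_walk_obeys_through_le (Φ : ℕ → Set (Fin n)) {t T : ℕ} (ht : t ≤ T) (s v : Fin n)
    (g : Fin n → ℝ) (hg : ∀ u, 0 ≤ g u) :
    expect (walk G d s T) (fun W => (if Obeys Φ W ∧ W[t]? = some v then 1 else 0) *
      ENNReal.ofReal (g (W.getLastD s))) ≤
      ENNReal.ofReal (pathMatrix G d Φ t s v *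
        (pathMatrix G d (fun τ => Φ (t + τ)) (T - t) *ᵥ g) v) := by
  -- Passing through `v` is one more constraint, at the single time `t`; it makes the path matrix
  -- factor through `v`.
  set Φ' : ℕ → Set (Fin n) := fun τ => if τ = t then Φ t ∩ {v} else Φ τ with hΦ'
  have hle : ∀ τ, Φ' τ ⊆ Φ τ := by
    intro τ
    simp only [hΦ']
    split_ifs with h
    · exact h ▸ Set.inter_subset_left
    · exact subset_rfl
  have hobeys : ∀ W : List (Fin n), Obeys Φ W ∧ W[t]? = some v → Obeys Φ' W := by
    rintro W ⟨h1, h2⟩ τ w hw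
    simp only [hΦ']
    split_ifs with h
    · subst h
      rw [h2] at hw
      exact ⟨h1 _ _ (by rw [h2, hw]), (Option.some.inj hw).symm⟩
    · exact h1 τ w hw
  have hfirst : pathMatrix G d Φ' t = pathMatrix G d Φ t * restr {v} := by
    cases t with
    | zero => simp [pathMatrix, hΦ', restr_mul_restr]
    | succ t =>
      have h1 : pathMatrix G d Φ' t = pathMatrix G d Φ t := pathMatrix_congr G d fun τ hτ => by
        simp [hΦ', (Nat.lt_succ_of_le hτ).ne]
      rw [pathMatrix, pathMatrix, h1, mul_assoc _ (restr _), restr_mul_restr]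
      simp [hΦ']
  calc _ ≤ expect (walk G d s T) (fun W => {W | Obeys Φ' W}.indicator 1 W *
        ENNReal.ofReal (g (W.getLastD s))) := by
        refine expect_mono fun W => ?_
        gcongr
        split_ifs with h
        · rw [Set.indicator_of_mem (hobeys W h)]; rfl
        · exact zero_le
    _ = ENNReal.ofReal ((pathMatrix G d Φ' T *ᵥ g) s) := expect_walk_obeys G d Φ' T s g hg
    _ ≤ _ := by
        refine ENNReal.ofReal_le_ofReal ?_
        obtain ⟨T', rfl⟩ := Nat.exists_eq_add_of_le ht
        rw [pathMatrix_add, hfirst, ← Matrix.mulVec_mulVec, ← Matrix.mulVec_mulVec,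
          Nat.add_sub_cancel_left]
        have : (pathMatrix G d Φ t *ᵥ (restr {v} *ᵥ (pathMatrix G d (fun τ => Φ' (t + τ)) T' *ᵥ g))) s =
            pathMatrix G d Φ t s v * (pathMatrix G d (fun τ => Φ' (t + τ)) T' *ᵥ g) v := by
          rw [Matrix.mulVec, dotProduct, Finset.sum_eq_single v]
          · rw [restr_mulVec]; simp
          · intro w _ hw
            rw [restr_mulVec]; simp [hw]
          · simp
        rw [this]
        refine mul_le_mul_of_nonneg_left ?_ (pathMatrix_nonneg G d _ _ _ _)
        simp only [Matrix.mulVec, dotProduct]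
        exact Finset.sum_le_sum fun w _ => mul_le_mul_of_nonneg_right
          (pathMatrix_mono (fun τ => hle (t + τ)) v w) (hg w)

end FindPath

end MinorFinding

namespace MinorFinding

open scoped ENNReal Matrix

set_option linter.unusedSectionVars false

/-! ### Pairs of returning walks and their passages -/

section ReturningPairs

variable {n : ℕ} {G : SimpleGraph (Fin n)} [DecidableRel G.Adj] {d : ℕ} [NeZero d]

/-- Both walks of the pair are in `R` at all times divisible by `ℓ`. -/
def ReturningPair (ℓ : ℕ) (R : Finset (Fin n)) (π : List (Fin n) × List (Fin n)) : Prop :=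
  Obeys (returnConstraint ℓ R) π.1 ∧ Obeys (returnConstraint ℓ R) π.2

lemma returningPair_swap (ℓ : ℕ) (R : Finset (Fin n)) (W W' : List (Fin n)) :
    ReturningPair ℓ R (W, W') ↔ ReturningPair ℓ R (W', W) := and_comm

lemma getLast?_of_mem_support_walk {s : Fin n} {T : ℕ} {W : List (Fin n)}
    (hW : W ∈ (walk G d s T).support) : W.getLast? = some (W.getLastD s) := by
  have hne : W ≠ [] := by
    intro h0; simpa [h0] using length_of_mem_support_walk G d hW
  rw [List.getLastD_eq_getLast?, List.getLast?_eq_some_getLast hne]; rfl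

open Classical in
/-- The probability that a walk from `v` returns and meets the end of a given walk. -/
lemma expect_walk_collide {δ : ℝ} (hℓ : 0 < baseLength n δ) (R : Finset (Fin n)) (i : ℕ)
    {u : Fin n} (v : Fin n) {T : ℕ} {W : List (Fin n)} (hW : W ∈ (walk G d u T).support)
    (q : Prop) [Decidable q] (p : List (Fin n) → Prop) [DecidablePred p]
    (hp : ∀ W', p W' ↔ q ∧ Obeys (returnConstraint (baseLength n δ) R) W') :
    expect (walk G d v (2 ^ i * baseLength n δ)) (fun W' => if W.getLast? = W'.getLast? then
        (if p W' then 1 else 0) else 0) =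
      (if q then 1 else 0) * ENNReal.ofReal
        ((returnMatrix G d (baseLength n δ) R ^ 2 ^ i) v (W.getLastD u)) := by
  rw [← pathMatrix_returnConstraint hℓ R (by positivity), ← expect_walk_obeys_last,
    toOuterMeasure_eq_expect, ← expect_const_mul]
  refine expect_congr_support fun W' hW' => ?_
  rw [getLast?_of_mem_support_walk hW, Set.indicator_apply]
  simp only [Set.mem_ofPred_eq, eq_comm (a := some (W.getLastD u)), hp]
  by_cases h1 : W'.getLast? = some (W.getLastD u) <;> by_cases h2 : q <;>
    by_cases h3 : Obeys (returnConstraint (baseLength n δ) R) W' <;> simp [h1, h2, h3]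

-- The common end `w` has probability `Q^{2^i}(u,w) Q^{2^i}(v,w)`; by symmetry the sum over `w` is a
-- matrix product.
open Classical in
lemma expect_collide {δ : ℝ} (hℓ : 0 < baseLength n δ) (hd : ∀ v, G.degree v ≤ d)
    (R : Finset (Fin n)) (i : ℕ) (u v : Fin n) :
    expect (walk G d u (2 ^ i * baseLength n δ)) (fun W =>
      expect (walk G d v (2 ^ i * baseLength n δ)) fun W' => if W.getLast? = W'.getLast? then
        (if ReturningPair (baseLength n δ) R (W, W') then 1 else 0) else 0) =
      ENNReal.ofReal ((returnMatrix G d (baseLength n δ) R ^ (2 * 2 ^ i)) u v) := by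
  have hnn := ((returnMatrix_doublySub (d := d) hd (baseLength n δ) R).pow (2 ^ i)).nonneg
  have h1 : (returnMatrix G d (baseLength n δ) R ^ (2 * 2 ^ i)) u v =
      (returnMatrix G d (baseLength n δ) R ^ 2 ^ i *ᵥ
        fun w => (returnMatrix G d (baseLength n δ) R ^ 2 ^ i) v w) u := by
    rw [two_mul, pow_add, Matrix.mul_apply]
    simp only [fun w => returnMatrix_pow_symm hd (baseLength n δ) R (2 ^ i) w v]
    rfl
  have h2 := expect_walk_obeys G d (returnConstraint (baseLength n δ) R)
    (2 ^ i * baseLength n δ) u (fun w => (returnMatrix G d (baseLength n δ) R ^ 2 ^ i) v w) (hnn v)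
  rw [pathMatrix_returnConstraint hℓ R (by positivity)] at h2
  rw [h1, ← h2]
  refine expect_congr_support fun W hW => ?_
  rw [expect_walk_collide hℓ R i v hW (Obeys (returnConstraint (baseLength n δ) R) W)
    (fun W' => ReturningPair (baseLength n δ) R (W, W')) fun _ => Iff.rfl, Set.indicator_apply]
  rfl

open Classical in
/-- `findPath` finds a pair of returning walks with probability at least one half. -/
lemma half_le_expect_findPath {δ : ℝ} (hℓ : 0 < baseLength n δ) (hd : ∀ v, G.degree v ≤ d)
    (R : Finset (Fin n)) (i k : ℕ) (u v : Fin n) {μ η : ℝ}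
    (hμ : ∀ a b, (returnMatrix G d (baseLength n δ) R ^ 2 ^ i) a b ≤ μ) (hη : 0 < η)
    (huv : η ≤ (returnMatrix G d (baseLength n δ) R ^ (2 * 2 ^ i)) u v)
    (hk : 1 + 2 * k * μ ≤ k ^ 2 * η) :
    1 / 2 ≤ expect (findPath G d δ u v k i)
      ({l | ∃ π ∈ l, ReturningPair (baseLength n δ) R π}.indicator 1) := by
  set A := returnMatrix G d (baseLength n δ) R with hA
  have hnn := ((returnMatrix_doublySub (d := d) hd (baseLength n δ) R).pow (2 ^ i)).nonneg
  have hμ0 : 0 ≤ μ := (hnn u u).trans (hμ u u)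
  have hk0 : (0 : ℝ) < k := by
    rcases Nat.eq_zero_or_pos k with rfl | h
    · norm_num at hk
    · exact_mod_cast h
  set f : List (Fin n) × List (Fin n) → ℝ≥0∞ := fun π =>
    if ReturningPair (baseLength n δ) R π then 1 else 0 with hf
  have hf1 : ∀ π, f π ^ 2 = f π := fun π => by simp only [hf]; split_ifs <;> simp
  set P := (A ^ (2 * 2 ^ i)) u v with hP
  have hPpos : 0 < P := hη.trans_le huv
  have hcol := expect_collide hℓ hd R i u v
  have hbound : ∀ (u v : Fin n), ∀ W ∈ (walk G d u (2 ^ i * baseLength n δ)).support,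
      expect (walk G d v (2 ^ i * baseLength n δ)) (fun W' =>
        if W.getLast? = W'.getLast? then f (W, W') else 0) ≤ ENNReal.ofReal μ := by
    intro u v W hW
    simp only [hf]
    rw [expect_walk_collide hℓ R i v hW (Obeys (returnConstraint (baseLength n δ) R) W)
      (fun W' => ReturningPair (baseLength n δ) R (W, W')) fun _ => Iff.rfl]
    calc _ ≤ 1 * ENNReal.ofReal μ := by
          gcongr
          · split_ifs <;> simp
          · exact hμ _ _
      _ = _ := one_mul _
  have hmean : expect (findPath G d δ u v k i) (fun l => (l.map f).sum) =
      ENNReal.ofReal (k ^ 2 * P) := by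
    rw [expect_findPath_sum, hcol, ENNReal.ofReal_mul (by positivity), ENNReal.ofReal_pow hk0.le,
      ENNReal.ofReal_natCast]
  have hsq := expect_findPath_sum_sq_le (G := G) (d := d) δ u v k i f hf1 (ENNReal.ofReal μ)
    (hbound u v) (fun W' hW' => by
      have := hbound v u W' hW'
      simp only [eq_comm (a := W'.getLast?)] at this
      refine le_trans (le_of_eq ?_) this
      congr 1
      funext W
      simp only [hf, returningPair_swap _ _ W W']) _ hcol
  -- The second moment is at most `(k² + 2k³μ) P + k⁴P²`, and by `hk` and `η ≤ P` the first summand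
  -- is at most `k⁴P²`.
  have hhalf := half_le_expect_ne_zero (p := findPath G d δ u v k i) (X := fun l => (l.map f).sum)
    (by rw [hmean]; simp only [ne_eq, ENNReal.ofReal_eq_zero, not_le]; positivity)
    (by rw [hmean]; exact ENNReal.ofReal_ne_top)
    (by
      refine hsq.trans ?_
      rw [hmean]
      have e1 : ((k : ℝ≥0∞) ^ 2 + 2 * k ^ 3 * ENNReal.ofReal μ) * ENNReal.ofReal P +
          k ^ 4 * ENNReal.ofReal P ^ 2 =
          ENNReal.ofReal ((k ^ 2 + 2 * k ^ 3 * μ) * P + k ^ 4 * P ^ 2) := by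
        rw [ENNReal.ofReal_add (by positivity) (by positivity), ENNReal.ofReal_mul (by positivity),
          ENNReal.ofReal_add (by positivity) (by positivity), ENNReal.ofReal_mul (by positivity),
          ENNReal.ofReal_mul (by positivity), ENNReal.ofReal_mul (by positivity),
          ENNReal.ofReal_pow hPpos.le, ENNReal.ofReal_pow hk0.le, ENNReal.ofReal_pow hk0.le,
          ENNReal.ofReal_pow hk0.le, ENNReal.ofReal_natCast]
        simp
      have e2 : (2 : ℝ≥0∞) * ENNReal.ofReal (k ^ 2 * P) ^ 2 =
          ENNReal.ofReal (2 * (k ^ 2 * P) ^ 2) := by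
        rw [← ENNReal.ofReal_pow (by positivity), ENNReal.ofReal_mul zero_le_two,
          ENNReal.ofReal_ofNat]
      rw [← hP, e1, e2]
      refine ENNReal.ofReal_le_ofReal ?_
      have : (k ^ 2 * P) * (1 + 2 * k * μ) ≤ (k ^ 2 * P) * (k ^ 2 * P) :=
        mul_le_mul_of_nonneg_left (hk.trans (by gcongr)) (by positivity)
      nlinarith)
  refine hhalf.trans (expect_mono fun l => ?_)
  refine Set.indicator_le_indicator_of_subset (fun l hl => ?_) (fun _ => zero_le_one) l
  by_contra hno
  refine hl (List.sum_eq_zero fun x hx => ?_)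
  obtain ⟨π, hπ, rfl⟩ := List.mem_map.1 hx
  simp only [hf, ite_eq_right_iff, one_ne_zero, imp_false]
  exact fun h => hno ⟨π, hπ, h⟩

open Classical in
/-- The number of times at which the walks of a pair are at `z`, or `0` if one does not return. -/
noncomputable def passages (ℓ : ℕ) (R : Finset (Fin n)) (L : ℕ) (z : Fin n)
    (π : List (Fin n) × List (Fin n)) : ℝ≥0∞ :=
  ∑ t ∈ Finset.range (L + 1),
    ((if ReturningPair ℓ R π ∧ π.1[t]? = some z then 1 else 0) +
      if ReturningPair ℓ R π ∧ π.2[t]? = some z then 1 else 0)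

/-- The probability that two returning walks of length `2 ^ i ℓ` from `u` and `v` end at the same
vertex and that the former is at `z` at time `t`. -/
noncomputable def throughProb (G : SimpleGraph (Fin n)) [DecidableRel G.Adj] (d : ℕ) [NeZero d]
    (ℓ : ℕ) (R : Finset (Fin n)) (i t : ℕ) (z u v : Fin n) : ℝ :=
  pathMatrix G d (returnConstraint ℓ R) t u z *
    (pathMatrix G d (fun τ => returnConstraint ℓ R (t + τ)) (2 ^ i * ℓ - t) *ᵥ
      fun w => (returnMatrix G d ℓ R ^ 2 ^ i) v w) z

lemma throughProb_nonneg (hd : ∀ v, G.degree v ≤ d) (ℓ : ℕ) (R : Finset (Fin n)) (i t : ℕ)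
    (z u v : Fin n) : 0 ≤ throughProb G d ℓ R i t z u v :=
  mul_nonneg (pathMatrix_nonneg G d _ _ _ _) ((pathMatrix_doublySub G d hd _ _).mulVec_nonneg
    (fun w => ((returnMatrix_doublySub (d := d) hd ℓ R).pow (2 ^ i)).nonneg v w) z)

open Classical in
lemma expect_collide_through_le {δ : ℝ} (hℓ : 0 < baseLength n δ) (hd : ∀ v, G.degree v ≤ d)
    (R : Finset (Fin n)) (i : ℕ) {t : ℕ} (ht : t ≤ 2 ^ i * baseLength n δ) (z u v : Fin n) :
    expect (walk G d u (2 ^ i * baseLength n δ)) (fun W =>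
      expect (walk G d v (2 ^ i * baseLength n δ)) fun W' => if W.getLast? = W'.getLast? then
        (if ReturningPair (baseLength n δ) R (W, W') ∧ W[t]? = some z then 1 else 0) else 0) ≤
      ENNReal.ofReal (throughProb G d (baseLength n δ) R i t z u v) := by
  have hnn := ((returnMatrix_doublySub (d := d) hd (baseLength n δ) R).pow (2 ^ i)).nonneg
  refine le_trans ?_ (expect_walk_obeys_through_le (returnConstraint (baseLength n δ) R) ht u z
    (fun w => (returnMatrix G d (baseLength n δ) R ^ 2 ^ i) v w) (hnn v))
  refine expect_mono_support fun W hW => ?_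
  have := expect_walk_collide (G := G) (d := d) hℓ R i v hW
    (Obeys (returnConstraint (baseLength n δ) R) W ∧ W[t]? = some z)
    (fun W' => ReturningPair (baseLength n δ) R (W, W') ∧ W[t]? = some z) fun _ => and_right_comm
  exact this.le

open Classical in
lemma expect_passages_le {δ : ℝ} (hℓ : 0 < baseLength n δ) (hd : ∀ v, G.degree v ≤ d)
    (R : Finset (Fin n)) (i k : ℕ) (z u v : Fin n) :
    expect (findPath G d δ u v k i)
      (fun l => (l.map (passages (baseLength n δ) R (2 ^ i * baseLength n δ) z)).sum) ≤
      ENNReal.ofReal (k ^ 2 * ∑ t ∈ Finset.range (2 ^ i * baseLength n δ + 1),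
        (throughProb G d (baseLength n δ) R i t z u v +
          throughProb G d (baseLength n δ) R i t z v u)) := by
  have hk : ENNReal.ofReal ((k : ℝ) ^ 2) = (k : ℝ≥0∞) ^ 2 := by
    rw [ENNReal.ofReal_pow (by positivity), ENNReal.ofReal_natCast]
  rw [expect_findPath_sum, ENNReal.ofReal_mul (by positivity), hk]
  gcongr
  have hsplit : ∀ W W' : List (Fin n), (if W.getLast? = W'.getLast? then
      passages (baseLength n δ) R (2 ^ i * baseLength n δ) z (W, W') else 0) =
      ∑ t ∈ Finset.range (2 ^ i * baseLength n δ + 1),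
        ((if W.getLast? = W'.getLast? then
          (if ReturningPair (baseLength n δ) R (W, W') ∧ W[t]? = some z then 1 else 0) else 0) +
        if W.getLast? = W'.getLast? then
          (if ReturningPair (baseLength n δ) R (W, W') ∧ W'[t]? = some z then 1 else 0) else 0) := by
    intro W W'
    by_cases h : W.getLast? = W'.getLast? <;> simp [h, passages]
  simp only [hsplit, expect_sum, expect_add]
  rw [ENNReal.ofReal_sum_of_nonneg fun t _ =>
    add_nonneg (throughProb_nonneg hd _ _ _ _ _ _ _) (throughProb_nonneg hd _ _ _ _ _ _ _)]
  refine Finset.sum_le_sum fun t ht => ?_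
  have ht' : t ≤ 2 ^ i * baseLength n δ := Nat.lt_succ_iff.1 (Finset.mem_range.1 ht)
  rw [ENNReal.ofReal_add (throughProb_nonneg hd _ _ _ _ _ _ _)
    (throughProb_nonneg hd _ _ _ _ _ _ _)]
  gcongr
  · exact expect_collide_through_le hℓ hd R i ht' z u v
  · rw [expect_comm]
    refine le_trans (le_of_eq ?_) (expect_collide_through_le hℓ hd R i ht' z v u)
    congr 1
    funext W
    congr 1
    funext W'
    simp only [returningPair_swap _ _ W W', eq_comm]

/-- Wherever the first walk ends, the second one ends there with probability at most `μ`, also after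
averaging over its start. What is left is the law of the first walk at time `t`. -/
lemma sum_sum_throughProb_le (hd : ∀ v, G.degree v ≤ d) (ℓ : ℕ) (R : Finset (Fin n)) (i t : ℕ)
    (z : Fin n) {D : Fin n → ℝ} (hD : ∀ u, 0 ≤ D u) (hD1 : ∑ u, D u ≤ 1) {μ : ℝ}
    (hμ : ∀ a b, (returnMatrix G d ℓ R ^ 2 ^ i) a b ≤ μ) :
    ∑ u, ∑ v, D u * D v * throughProb G d ℓ R i t z u v ≤
      μ * ((pathMatrix G d (returnConstraint ℓ R) t)ᵀ *ᵥ D) z := by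
  set A := returnMatrix G d ℓ R ^ 2 ^ i with hA
  have hnn : ∀ a b, 0 ≤ A a b := ((returnMatrix_doublySub (d := d) hd ℓ R).pow (2 ^ i)).nonneg
  have hμ0 : 0 ≤ μ := (hnn z z).trans (hμ z z)
  set B := pathMatrix G d (fun τ => returnConstraint ℓ R (t + τ)) (2 ^ i * ℓ - t) with hB
  set C := pathMatrix G d (returnConstraint ℓ R) t with hC
  have hBsub : DoublySub B := pathMatrix_doublySub G d hd _ _
  have hCsub : DoublySub C := pathMatrix_doublySub G d hd _ _
  have h1 : ∑ v, D v * (B *ᵥ fun w => A v w) z ≤ μ := by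
    have : ∑ v, D v * (B *ᵥ fun w => A v w) z = (B *ᵥ fun w => ∑ v, D v * A v w) z := by
      simp only [Matrix.mulVec, dotProduct, Finset.mul_sum]
      rw [Finset.sum_comm]
      exact Finset.sum_congr rfl fun w _ => Finset.sum_congr rfl fun v _ => by ring
    rw [this]
    refine hBsub.mulVec_le hμ0 (fun w => ?_) z
    calc ∑ v, D v * A v w ≤ ∑ v, D v * μ :=
          Finset.sum_le_sum fun v _ => mul_le_mul_of_nonneg_left (hμ v w) (hD v)
      _ ≤ 1 * μ := by rw [← Finset.sum_mul]; exact mul_le_mul_of_nonneg_right hD1 hμ0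
      _ = μ := one_mul μ
  calc _ = (Cᵀ *ᵥ D) z * ∑ v, D v * (B *ᵥ fun w => A v w) z := by
        simp only [throughProb]
        rw [Matrix.mulVec, dotProduct, Finset.sum_mul]
        refine Finset.sum_congr rfl fun u _ => ?_
        rw [Finset.mul_sum]
        refine Finset.sum_congr rfl fun v _ => ?_
        rw [Matrix.transpose_apply]; ring
    _ ≤ (Cᵀ *ᵥ D) z * μ :=
        mul_le_mul_of_nonneg_left h1 (hCsub.transpose.mulVec_nonneg hD z)
    _ = _ := mul_comm _ _

/-- The expected number of crossings between the returning pairs of two independent runs. -/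
lemma sum_sq_sum_throughProb_le (hd : ∀ v, G.degree v ≤ d) (ℓ : ℕ) (R : Finset (Fin n)) (i : ℕ)
    {D : Fin n → ℝ} (hD : ∀ u, 0 ≤ D u) (hD1 : ∑ u, D u ≤ 1) {μ : ℝ}
    (hμ : ∀ a b, (returnMatrix G d ℓ R ^ 2 ^ i) a b ≤ μ) (L : ℕ) :
    ∑ z, (∑ u, ∑ v, D u * D v * ∑ t ∈ Finset.range (L + 1),
      (throughProb G d ℓ R i t z u v + throughProb G d ℓ R i t z v u)) ^ 2 ≤
      4 * μ ^ 2 * (L + 1) ^ 2 * ∑ u, D u ^ 2 := by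
  set σ : ℕ → Fin n → ℝ := fun t z => ((pathMatrix G d (returnConstraint ℓ R) t)ᵀ *ᵥ D) z with hσ
  have hsub : ∀ t, DoublySub (pathMatrix G d (returnConstraint ℓ R) t)ᵀ := fun t =>
    (pathMatrix_doublySub G d hd _ _).transpose
  have h1 : ∀ z, (∑ u, ∑ v, D u * D v * ∑ t ∈ Finset.range (L + 1),
      (throughProb G d ℓ R i t z u v + throughProb G d ℓ R i t z v u)) ≤
      2 * μ * ∑ t ∈ Finset.range (L + 1), σ t z := by
    intro z
    have e1 : (∑ u, ∑ v, D u * D v * ∑ t ∈ Finset.range (L + 1),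
        (throughProb G d ℓ R i t z u v + throughProb G d ℓ R i t z v u)) =
        ∑ t ∈ Finset.range (L + 1), (∑ u, ∑ v, D u * D v * throughProb G d ℓ R i t z u v +
          ∑ u, ∑ v, D u * D v * throughProb G d ℓ R i t z u v) := by
      have e2 : ∀ t, ∑ u, ∑ v, D u * D v * throughProb G d ℓ R i t z u v =
          ∑ u, ∑ v, D u * D v * throughProb G d ℓ R i t z v u := by
        intro t
        rw [Finset.sum_comm]
        exact Finset.sum_congr rfl fun v _ => Finset.sum_congr rfl fun u _ => by ring
      conv_rhs => enter [2, t, 2]; rw [e2]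
      simp only [← Finset.sum_add_distrib, Finset.mul_sum]
      simp only [Finset.sum_comm (t := Finset.range (L + 1))]
      exact Finset.sum_congr rfl fun t _ => Finset.sum_congr rfl fun v _ =>
        Finset.sum_congr rfl fun u _ => by ring
    rw [e1, Finset.mul_sum]
    refine Finset.sum_le_sum fun t _ => ?_
    have := sum_sum_throughProb_le hd ℓ R i t z hD hD1 hμ
    simp only [hσ]
    linarith
  have h0 : ∀ z, 0 ≤ ∑ u, ∑ v, D u * D v * ∑ t ∈ Finset.range (L + 1),
      (throughProb G d ℓ R i t z u v + throughProb G d ℓ R i t z v u) := fun z =>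
    Finset.sum_nonneg fun u _ => Finset.sum_nonneg fun v _ => mul_nonneg
      (mul_nonneg (hD u) (hD v)) (Finset.sum_nonneg fun t _ => add_nonneg
        (throughProb_nonneg hd _ _ _ _ _ _ _) (throughProb_nonneg hd _ _ _ _ _ _ _))
  -- Cauchy–Schwarz over the times; at each time the constrained walk, being a contraction, keeps
  -- the squared norm below that of `D`.
  calc _ ≤ ∑ z, (2 * μ * ∑ t ∈ Finset.range (L + 1), σ t z) ^ 2 :=
        Finset.sum_le_sum fun z _ => pow_le_pow_left₀ (h0 z) (h1 z) 2
    _ ≤ ∑ z, 4 * μ ^ 2 * ((L + 1) * ∑ t ∈ Finset.range (L + 1), σ t z ^ 2) := by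
        refine Finset.sum_le_sum fun z _ => ?_
        rw [mul_pow, mul_pow]
        have := sq_sum_le_card_mul_sum_sq (s := Finset.range (L + 1)) (f := fun t => σ t z)
        rw [Finset.card_range] at this
        push_cast at this
        have h4 : (0 : ℝ) ≤ 4 * μ ^ 2 := by positivity
        calc _ = 4 * μ ^ 2 * (∑ t ∈ Finset.range (L + 1), σ t z) ^ 2 := by ring
          _ ≤ _ := mul_le_mul_of_nonneg_left this h4
    _ = 4 * μ ^ 2 * ((L + 1) * ∑ t ∈ Finset.range (L + 1), ∑ z, σ t z ^ 2) := by
        rw [← Finset.mul_sum, ← Finset.mul_sum, Finset.sum_comm]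
    _ ≤ 4 * μ ^ 2 * ((L + 1) * ∑ t ∈ Finset.range (L + 1), ∑ u, D u ^ 2) := by
        refine mul_le_mul_of_nonneg_left (mul_le_mul_of_nonneg_left
          (Finset.sum_le_sum fun t _ => (hsub t).sum_mulVec_sq_le D) ?_) ?_ <;> positivity
    _ = _ := by
        rw [Finset.sum_const, Finset.card_range, nsmul_eq_mul]
        push_cast
        ring

end ReturningPairs

end MinorFinding

namespace MinorFinding

open scoped ENNReal Matrix

set_option linter.unusedSectionVars false

/-! ### Counting bicliques -/

section Bicliques

variable {V : Type*} [Fintype V]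

/-- Jensen's inequality; the added point `none` takes the mass missing from `w`, with value zero. -/
lemma pow_sum_mul_le_sum_mul_pow {w f : V → ℝ} (hw : ∀ v, 0 ≤ w v) (hw1 : ∑ v, w v ≤ 1)
    (hf : ∀ v, 0 ≤ f v) {N : ℕ} (hN : N ≠ 0) :
    (∑ v, w v * f v) ^ N ≤ ∑ v, w v * f v ^ N := by
  have h := Real.pow_arith_mean_le_arith_mean_pow (Finset.univ : Finset (Option V))
    (fun o => o.elim (1 - ∑ v, w v) w) (fun o => o.elim 0 f)
    (by rintro (_ | v) -; exacts [sub_nonneg.2 hw1, hw v])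
    (by simp [Fintype.sum_option])
    (by rintro (_ | v) -; exacts [le_rfl, hf v]) N
  simpa [Fintype.sum_option, hN] using h

/-- Complete bipartite graphs are at least as frequent as in a random graph of the same density. -/
theorem pow_le_sum_biclique {D : V → ℝ} (hD : ∀ v, 0 ≤ D v) (hD1 : ∑ v, D v ≤ 1) {e : V → V → ℝ}
    (he : ∀ a b, 0 ≤ e a b) {p : ℝ} (hp : 0 ≤ p) (hpe : p ≤ ∑ a, ∑ b, D a * D b * e a b)
    {N : ℕ} (hN : N ≠ 0) :
    p ^ (N * N) ≤ ∑ a : Fin N → V, ∑ b : Fin N → V, (∏ x, D (a x)) * (∏ y, D (b y)) *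
      ∏ y, ∏ x, e (a x) (b y) := by
  have h1 : ∀ a : Fin N → V, ∑ b : Fin N → V, (∏ x, D (a x)) * (∏ y, D (b y)) *
      ∏ y, ∏ x, e (a x) (b y) = (∏ x, D (a x)) * (∑ b, D b * ∏ x, e (a x) b) ^ N := by
    intro a
    rw [Fintype.sum_pow, Finset.mul_sum]
    refine Finset.sum_congr rfl fun b _ => ?_
    rw [Finset.prod_mul_distrib, mul_assoc]
  have h2 : ∑ a : Fin N → V, (∏ x, D (a x)) * (∑ b, D b * ∏ x, e (a x) b) =
      ∑ b, D b * (∑ a, D a * e a b) ^ N := by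
    simp only [Fintype.sum_pow, Finset.mul_sum]
    rw [Finset.sum_comm]
    refine Finset.sum_congr rfl fun b _ => Finset.sum_congr rfl fun a _ => ?_
    rw [Finset.prod_mul_distrib]; ring
  have hsum1 : ∑ a : Fin N → V, ∏ x, D (a x) ≤ 1 := by
    rw [← Fintype.sum_pow]
    exact pow_le_one₀ (Finset.sum_nonneg fun v _ => hD v) hD1
  have h3 : ∑ a, ∑ b, D a * D b * e a b = ∑ b, D b * ∑ a, D a * e a b := by
    rw [Finset.sum_comm]
    refine Finset.sum_congr rfl fun b _ => ?_
    rw [Finset.mul_sum]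
    exact Finset.sum_congr rfl fun a _ => by ring
  simp only [h1]
  -- Jensen twice: over a single vertex `b`, and, after exchanging the sums, over the tuples `a`.
  calc p ^ (N * N) ≤ ((∑ b, D b * ∑ a, D a * e a b) ^ N) ^ N := by
        rw [← pow_mul]
        exact pow_le_pow_left₀ hp (hpe.trans h3.le) _
    _ ≤ (∑ b, D b * (∑ a, D a * e a b) ^ N) ^ N := by
        refine pow_le_pow_left₀ (pow_nonneg (hp.trans (hpe.trans h3.le)) _) ?_ _
        exact pow_sum_mul_le_sum_mul_pow hD hD1
          (fun b => Finset.sum_nonneg fun a _ => mul_nonneg (hD a) (he a b)) hN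
    _ = (∑ a : Fin N → V, (∏ x, D (a x)) * (∑ b, D b * ∏ x, e (a x) b)) ^ N := by rw [h2]
    _ ≤ _ := pow_sum_mul_le_sum_mul_pow (fun a => Finset.prod_nonneg fun x _ => hD _) hsum1
          (fun a => Finset.sum_nonneg fun b _ => mul_nonneg (hD b)
            (Finset.prod_nonneg fun x _ => he _ _)) hN

lemma sum_prod_mul_le {ι : Type*} [Fintype ι] [DecidableEq ι] {D : V → ℝ≥0∞} (hD : ∑ v, D v ≤ 1)
    (x : ι) (f : V → ℝ≥0∞) :
    ∑ a : ι → V, (∏ j, D (a j)) * f (a x) ≤ ∑ c, D c * f c := by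
  have hone : ∑ b : {j // j ≠ x} → V, ∏ j, D (b j) ≤ 1 := by
    have := Finset.prod_univ_sum (fun _ : {j // j ≠ x} => (Finset.univ : Finset V)) fun _ v => D v
    rw [Fintype.piFinset_univ] at this
    rw [← this]
    exact Finset.prod_le_one' fun _ _ => hD
  rw [← (Equiv.funSplitAt x V).symm.sum_comp, Fintype.sum_prod_type]
  refine Finset.sum_le_sum fun c _ => ?_
  calc _ = ∑ b : {j // j ≠ x} → V, (∏ j, D (b j)) * (D c * f c) := by
        refine Finset.sum_congr rfl fun b _ => ?_
        rw [Fintype.prod_eq_mul_prod_subtype_ne _ x]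
        have h1 : (Equiv.funSplitAt x V).symm (c, b) x = c := by simp
        have h2 : ∀ j : {j // j ≠ x}, (Equiv.funSplitAt x V).symm (c, b) j = b j := fun j => by
          simp [j.2]
        simp only [h1, h2]
        ring
    _ = (∑ b : {j // j ≠ x} → V, ∏ j, D (b j)) * (D c * f c) := by rw [Finset.sum_mul]
    _ ≤ 1 * (D c * f c) := by gcongr
    _ = _ := one_mul _

lemma sum_prod_mul_le₂ {ι : Type*} [Fintype ι] [DecidableEq ι] {D : V → ℝ≥0∞} (hD : ∑ v, D v ≤ 1)
    {x x' : ι} (hx : x' ≠ x) (f : V → V → ℝ≥0∞) :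
    ∑ a : ι → V, (∏ j, D (a j)) * f (a x) (a x') ≤ ∑ c, ∑ c', D c * D c' * f c c' := by
  rw [← (Equiv.funSplitAt x V).symm.sum_comp, Fintype.sum_prod_type]
  refine Finset.sum_le_sum fun c _ => ?_
  calc _ = ∑ b : {j // j ≠ x} → V, (∏ j, D (b j)) * (D c * f c (b ⟨x', hx⟩)) := by
        refine Finset.sum_congr rfl fun b _ => ?_
        rw [Fintype.prod_eq_mul_prod_subtype_ne _ x]
        have h1 : (Equiv.funSplitAt x V).symm (c, b) x = c := by simp
        have h2 : ∀ j : {j // j ≠ x}, (Equiv.funSplitAt x V).symm (c, b) j = b j := fun j => by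
          simp [j.2]
        have h3 := h2 ⟨x', hx⟩
        simp only [h1, h2] at h3 ⊢
        rw [h3]
        ring
    _ ≤ ∑ c', D c' * (D c * f c c') :=
        sum_prod_mul_le hD (⟨x', hx⟩ : {j // j ≠ x}) fun c' => D c * f c c'
    _ = _ := Finset.sum_congr rfl fun c' _ => by ring

/-- The two edges have no common end, so they are sampled independently and the expectation is at
most a square. Hence only crossings of paths without a common end are controlled, and the minor is
built to tolerate the others. -/
lemma sum_prod_prod_mul_le {ι : Type*} [Fintype ι] [DecidableEq ι] {D : V → ℝ≥0∞}
    (hD : ∑ v, D v ≤ 1) {x x' y y' : ι} (hx : x' ≠ x) (hy : y' ≠ y) (f : V → V → ℝ≥0∞) :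
    ∑ a : ι → V, ∑ b : ι → V, (∏ j, D (a j)) * (∏ j, D (b j)) *
      (f (a x) (b y) * f (a x') (b y')) ≤ (∑ u, ∑ v, D u * D v * f u v) ^ 2 := by
  calc _ = ∑ a : ι → V, (∏ j, D (a j)) * ∑ b : ι → V, (∏ j, D (b j)) *
        (f (a x) (b y) * f (a x') (b y')) := by
        simp only [Finset.mul_sum, mul_assoc]
    _ ≤ ∑ a : ι → V, (∏ j, D (a j)) * ∑ c, ∑ c', D c * D c' * (f (a x) c * f (a x') c') := by
        gcongr with a _
        exact sum_prod_mul_le₂ hD hy fun c c' => f (a x) c * f (a x') c'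
    _ ≤ ∑ u, ∑ u', D u * D u' * ∑ c, ∑ c', D c * D c' * (f u c * f u' c') :=
        sum_prod_mul_le₂ hD hx fun u u' => ∑ c, ∑ c', D c * D c' * (f u c * f u' c')
    _ = _ := by
        rw [sq, Finset.sum_mul_sum]
        refine Finset.sum_congr rfl fun u _ => Finset.sum_congr rfl fun u' _ => ?_
        rw [Finset.sum_mul_sum, Finset.mul_sum]
        refine Finset.sum_congr rfl fun c _ => ?_
        rw [Finset.mul_sum]
        exact Finset.sum_congr rfl fun c' _ => by ring

end Bicliques

/-! ### Minors found by `FindBiclique` -/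

section BicliqueMinor

variable {n r : ℕ} {G : SimpleGraph (Fin n)} [DecidableRel G.Adj] {d : ℕ} [NeZero d]

lemma exactMinor_isSome {H : SimpleGraph (Fin r)} {F : G.Subgraph} (h : ∃ B, IsMinorModel H F B) :
    (exactMinor H F).isSome := by
  rw [exactMinor, dif_pos h]; rfl

/-- The first `r` vertices of `a` are the centres, and the vertices of `b` label unordered pairs of
centres, for which `r ^ 2` of them suffice. A path is the first walk followed by the reversed second
one; the meeting vertex is repeated, which the relation "equal or adjacent" permits. -/
lemma exactMinor_isSome_of_walks (hr : 3 ≤ r) (H : SimpleGraph (Fin r)) {T : ℕ}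
    {a b : Fin (r ^ 2) → Fin n} {π : Fin (r ^ 2) → Fin (r ^ 2) → List (Fin n) × List (Fin n)}
    {L : List (List (Fin n))}
    (h₁ : ∀ x y, (π x y).1 ∈ (walk G d (a x) T).support)
    (h₂ : ∀ x y, (π x y).2 ∈ (walk G d (b y) T).support)
    (hend : ∀ x y, (π x y).1.getLast? = (π x y).2.getLast?)
    (hL₁ : ∀ x y, (π x y).1 ∈ L) (hL₂ : ∀ x y, (π x y).2 ∈ L)
    (hdisj : ∀ x x' y y', x ≠ x' → y ≠ y' → ∀ v, v ∈ (π x y).1 ∨ v ∈ (π x y).2 →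
      ¬ (v ∈ (π x' y').1 ∨ v ∈ (π x' y').2)) :
    (exactMinor H (walksSubgraph G L)).isSome := by
  have hle : r ≤ r ^ 2 := Nat.le_self_pow (by norm_num) r
  let emb : Fin r → Fin (r ^ 2) := Fin.castLE hle
  have hemb : ∀ x y, x ≠ y → emb x ≠ emb y := fun x y h h' => h (Fin.castLE_injective hle h')
  let k : Fin r → Fin r → Fin (r ^ 2) := fun x y =>
    Fin.cast (sq r).symm (finProdFinEquiv (min x y, max x y))
  have hkinj : ∀ x y z w, k x y = k z w → min x y = min z w ∧ max x y = max z w := by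
    intro x y z w h
    have := finProdFinEquiv.injective (Fin.cast_injective _ h)
    exact Prod.mk.inj this
  have hne₁ : ∀ x y, (π x y).1 ≠ [] := fun x y h => by
    simpa [h] using length_of_mem_support_walk G d (h₁ x y)
  have hrel : Std.Symm (fun u v => u = v ∨ (walksSubgraph G L).Adj u v) :=
    ⟨fun u v h => h.elim (fun h => Or.inl h.symm) fun h => Or.inr h.symm⟩
  have hc₁ : ∀ x y, (π x y).1.IsChain fun u v => u = v ∨ (walksSubgraph G L).Adj u v :=
    fun x y => isChain_walksSubgraph (hL₁ x y) (isChain_of_mem_support_walk G d (h₁ x y))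
  have hc₂ : ∀ x y, (π x y).2.IsChain fun u v => u = v ∨ (walksSubgraph G L).Adj u v :=
    fun x y => isChain_walksSubgraph (hL₂ x y) (isChain_of_mem_support_walk G d (h₂ x y))
  refine exactMinor_isSome (exists_isMinorModel hr H (fun x => a (emb x)) k
    (fun x j => (π (emb x) j).1 ++ (π (emb x) j).2.reverse) ?_ ?_ ?_ ?_ ?_ ?_ ?_ ?_)
  · intro x y z w hxz hyw hxy h
    obtain ⟨h1, h2⟩ := hkinj _ _ _ _ h
    simp only [Fin.ext_iff, Fin.coe_min, Fin.coe_max, ne_eq] at *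
    omega
  · intro x y z hxy hxz h
    obtain ⟨h1, h2⟩ := hkinj _ _ _ _ h
    simp only [Fin.ext_iff, Fin.coe_min, Fin.coe_max, ne_eq] at *
    omega
  · intro x y
    simp only [k, min_comm x y, max_comm x y]
  · intro x j
    rw [List.head?_append_of_ne_nil _ (hne₁ _ _)]
    exact head?_of_mem_support_walk G d (h₁ _ _)
  · intro x j
    rw [List.isChain_append]
    refine ⟨hc₁ _ _, ?_, ?_⟩
    · rw [List.isChain_reverse]
      exact (hc₂ _ _).imp fun u v h => hrel.symm _ _ h
    · intro u hu v hv
      rw [List.head?_reverse, ← hend] at hv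
      exact Or.inl (Option.mem_unique hu hv)
  · intro x j v hv
    rw [List.mem_append, List.mem_reverse] at hv
    rcases hv with hv | hv
    · exact ⟨_, hL₁ _ _, hv⟩
    · exact ⟨_, hL₂ _ _, hv⟩
  · intro x y _
    refine ⟨b (k x y), ?_, ?_⟩ <;>
    · rw [List.mem_append, List.mem_reverse]
      exact Or.inr (List.mem_of_mem_head? (by rw [head?_of_mem_support_walk G d (h₂ _ _)]; rfl))
  · intro x y j j' hxy hjj v hv hv'
    rw [List.mem_append, List.mem_reverse] at hv hv'
    exact hdisj _ _ _ _ (hemb _ _ hxy) hjj v hv hv'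

end BicliqueMinor

end MinorFinding

namespace MinorFinding

open scoped ENNReal Matrix

set_option linter.unusedSectionVars false

/-! ### The success probability of one iteration of `FindBiclique` -/

lemma map_product_map {α β γ κ : Type*} (f : α → γ) (g : β → κ) (l : List α) (l' : List β) :
    l.map f ×ˢ l'.map g = (l ×ˢ l').map (Prod.map f g) := by
  induction l with
  | nil => rfl
  | cons a l ih =>
    rw [List.map_cons, List.product_cons, List.product_cons, ih, List.map_append, List.map_map,
      List.map_map]
    rfl

/-- Independent samples that are all good either give `1 ≤ F`, or two of them collide. -/
theorem pow_le_expect_independent_add {ι β Z : Type} [DecidableEq ι] [Fintype Z] [Inhabited β]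
    (idx : List ι) (p : ι → PMF β) (good : Set β) {c : ℝ≥0∞}
    (hc : ∀ j ∈ idx, c ≤ expect (p j) (good.indicator 1)) (Q : Finset (ι × ι))
    (hQ : ∀ q ∈ Q, q.1 ∈ idx ∧ q.2 ∈ idx ∧ q.1 ≠ q.2) (u : Z → β → ℝ≥0∞) (F : List β → ℝ≥0∞)
    (hF : ∀ (l : List β) (g : ι → β), (∀ x ∈ l, x ∈ good) →
      (∀ j ∈ idx, g j ∈ (p j).support ∧ g j ∈ l) →
      (∀ q ∈ Q, ∀ z, u z (g q.1) < 1 ∨ u z (g q.2) < 1) → 1 ≤ F l) :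
    c ^ idx.length ≤ expect (independent (idx.map p)) F +
      ∑ q ∈ Q, ∑ z, expect (p q.1) (u z) * expect (p q.2) (u z) := by
  have hget : ∀ j ∈ idx, (idx.map p)[idx.idxOf j]? = some (p j) := fun j hj => by
    rw [List.getElem?_map, List.getElem?_idxOf hj]; rfl
  have h1 : c ^ idx.length ≤
      expect (independent (idx.map p)) ({l | ∀ x ∈ l, x ∈ good}.indicator 1) := by
    have := pow_le_expect_independent_forall (idx.map p) good c (by simpa using hc)
    rwa [List.length_map] at this
  -- A missing position counts as zero. A collision at `z` makes the product at its two positions at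
  -- least one, so the error sum dominates the indicator of a collision.
  set U : Z → Option β → ℝ≥0∞ := fun z o => o.elim 0 (u z) with hU
  have h2 : ∀ l ∈ (independent (idx.map p)).support,
      ({l | ∀ x ∈ l, x ∈ good}.indicator 1 : List β → ℝ≥0∞) l ≤
        F l + ∑ q ∈ Q, ∑ z, U z l[idx.idxOf q.1]? * U z l[idx.idxOf q.2]? := by
    intro l hl
    by_cases hg : ∀ x ∈ l, x ∈ good
    swap
    · rw [Set.indicator_of_notMem (by exact hg)]; exact zero_le
    rw [Set.indicator_of_mem (by exact hg), Pi.one_apply]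
    set g : ι → β := fun j => (l[idx.idxOf j]?).getD default with hgdef
    have hlen : l.length = idx.length := by
      rw [length_of_mem_support_independent hl, List.length_map]
    have hsome : ∀ j ∈ idx, l[idx.idxOf j]? = some (g j) := fun j hj => by
      have : idx.idxOf j < l.length := hlen ▸ List.idxOf_lt_length_of_mem hj
      simp [hgdef, this]
    by_cases hcol : ∀ q ∈ Q, ∀ z, u z (g q.1) < 1 ∨ u z (g q.2) < 1
    · refine (hF l g hg (fun j hj => ⟨?_, List.mem_of_getElem? (hsome j hj)⟩) hcol).trans
        le_self_add
      exact getElem_mem_support_of_independent hl _ (hget j hj) (hsome j hj)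
    · push Not at hcol
      obtain ⟨q, hq, z, h₁, h₂⟩ := hcol
      obtain ⟨hq1, hq2, -⟩ := hQ q hq
      calc (1 : ℝ≥0∞) = 1 * 1 := (one_mul 1).symm
        _ ≤ U z l[idx.idxOf q.1]? * U z l[idx.idxOf q.2]? := by
            rw [hsome _ hq1, hsome _ hq2]; exact mul_le_mul' h₁ h₂
        _ ≤ ∑ z, U z l[idx.idxOf q.1]? * U z l[idx.idxOf q.2]? :=
            Finset.single_le_sum (f := fun z => U z l[idx.idxOf q.1]? * U z l[idx.idxOf q.2]?)
              (fun _ _ => zero_le) (Finset.mem_univ z)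
        _ ≤ ∑ q ∈ Q, ∑ z, U z l[idx.idxOf q.1]? * U z l[idx.idxOf q.2]? :=
            Finset.single_le_sum
              (f := fun q : ι × ι => ∑ z, U z l[idx.idxOf q.1]? * U z l[idx.idxOf q.2]?)
              (fun _ _ => zero_le) hq
        _ ≤ _ := le_add_self
  refine h1.trans ((expect_mono_support h2).trans ?_)
  rw [expect_add, expect_sum]
  gcongr with q hq
  rw [expect_sum]
  refine Finset.sum_le_sum fun z _ => ?_
  obtain ⟨hq1, hq2, hne⟩ := hQ q hq
  have hj : idx.idxOf q.1 ≠ idx.idxOf q.2 := fun h => hne ((List.idxOf_inj hq1).1 h)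
  have := expect_independent_getElem₂ (idx.map p) hj (hget _ hq1) (hget _ hq2)
    fun o o' => U z o * U z o'
  rw [this]
  simp only [hU, Option.elim_some]
  simp only [expect_const_mul, expect_mul_const]
  exact le_rfl

variable {n r : ℕ} {G : SimpleGraph (Fin n)} [DecidableRel G.Adj] {d : ℕ} [NeZero d]

open Classical in
lemma one_le_passages {ℓ : ℕ} {R : Finset (Fin n)} {L : ℕ} {π : List (Fin n) × List (Fin n)}
    (hπ : ReturningPair ℓ R π) (h₁ : π.1.length = L + 1) (h₂ : π.2.length = L + 1) {z : Fin n}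
    (hz : z ∈ π.1 ∨ z ∈ π.2) : 1 ≤ passages ℓ R L z π := by
  rw [passages]
  rcases hz with hz | hz
  · obtain ⟨t, ht, rfl⟩ := List.mem_iff_getElem.1 hz
    refine le_trans ?_ (Finset.single_le_sum (fun _ _ => zero_le)
      (Finset.mem_range.2 (h₁ ▸ ht)))
    simp [hπ, ht]
  · obtain ⟨t, ht, rfl⟩ := List.mem_iff_getElem.1 hz
    refine le_trans ?_ (Finset.single_le_sum (fun _ _ => zero_le)
      (Finset.mem_range.2 (h₂ ▸ ht)))
    simp [hπ, ht]

lemma one_le_sum_passages {ℓ : ℕ} {R : Finset (Fin n)} {L : ℕ}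
    {l : List (List (Fin n) × List (Fin n))} {π : List (Fin n) × List (Fin n)} (hl : π ∈ l)
    (hπ : ReturningPair ℓ R π) (h₁ : π.1.length = L + 1) (h₂ : π.2.length = L + 1) {z : Fin n}
    (hz : z ∈ π.1 ∨ z ∈ π.2) : 1 ≤ (l.map (passages ℓ R L z)).sum :=
  (one_le_passages hπ h₁ h₂ hz).trans (List.single_le_sum (fun _ _ => zero_le) _
    (List.mem_map_of_mem hl))

end MinorFinding

namespace MinorFinding

open scoped ENNReal Matrix

set_option linter.unusedSectionVars false

/-! ### FindBiclique: bicliques against crossings -/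

section FindBiclique

variable {n r : ℕ} {G : SimpleGraph (Fin n)} [DecidableRel G.Adj] {d : ℕ} [NeZero d]

/-- The expected number of passages through `z` of the paths between `u` and `v`. -/
noncomputable def expectedPassages (G : SimpleGraph (Fin n)) [DecidableRel G.Adj] (d : ℕ) [NeZero d]
    (δ : ℝ) (R : Finset (Fin n)) (k i : ℕ) (z u v : Fin n) : ℝ≥0∞ :=
  expect (findPath G d δ u v k i)
    fun l => (l.map (passages (baseLength n δ) R (2 ^ i * baseLength n δ) z)).sum

/-- The pairs of edges of a complete bipartite graph that share no vertex. -/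
def disjointPairs (N : ℕ) : Finset ((Fin N × Fin N) × (Fin N × Fin N)) :=
  Finset.univ.filter fun q => q.1.1 ≠ q.2.1 ∧ q.1.2 ≠ q.2.2

open Classical in
/-- What `FindBiclique` does with the sequences `A`, `B` of end vertices. -/
noncomputable def connectPairs (G : SimpleGraph (Fin n)) [DecidableRel G.Adj] (d : ℕ) [NeZero d]
    (H : SimpleGraph (Fin r)) (δ : ℝ) (k i : ℕ) (A B : List (Fin n)) :
    PMF (Option (Fin r → Finset (Fin n))) :=
  (independent ((A ×ˢ B).map fun ab => findPath G d δ ab.1 ab.2 k i)).map fun found =>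
    if ∀ paths ∈ found, paths ≠ [] then
      exactMinor H (walksSubgraph G (found.flatten.flatMap fun p => [p.1, p.2]))
    else none

/-- If two chosen returning paths cross at `z`, both passage counts are at least one, so crossings
are paid for by products of expected passages. Otherwise `exactMinor_isSome_of_walks` applies. -/
lemma pow_le_expect_connectPairs (hr : 3 ≤ r) (H : SimpleGraph (Fin r)) (δ : ℝ)
    (R : Finset (Fin n)) (k i : ℕ) (a b : Fin (r ^ 2) → Fin n) {c : ℝ≥0∞}
    (hc : ∀ x y, c ≤ expect (findPath G d δ (a x) (b y) k i)
      ({l | ∃ π ∈ l, ReturningPair (baseLength n δ) R π}.indicator 1)) :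
    c ^ (r ^ 2 * r ^ 2) ≤
      expect (connectPairs G d H δ k i (List.ofFn a) (List.ofFn b))
        ({o | o.isSome}.indicator 1) +
      ∑ q ∈ disjointPairs (r ^ 2), ∑ z, expectedPassages G d δ R k i z (a q.1.1) (b q.1.2) *
        expectedPassages G d δ R k i z (a q.2.1) (b q.2.2) := by
  classical
  set idx := List.finRange (r ^ 2) ×ˢ List.finRange (r ^ 2) with hidx
  have hmem : ∀ j, j ∈ idx := fun j => List.mem_product.2 ⟨List.mem_finRange _, List.mem_finRange _⟩
  set p : Fin (r ^ 2) × Fin (r ^ 2) → PMF (List (List (Fin n) × List (Fin n))) := fun j =>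
    findPath G d δ (a j.1) (b j.2) k i with hp
  have hlist : (List.ofFn a ×ˢ List.ofFn b).map (fun ab => findPath G d δ ab.1 ab.2 k i) =
      idx.map p := by
    rw [List.ofFn_eq_map, List.ofFn_eq_map, map_product_map, List.map_map]
    rfl
  have hlen : idx.length = r ^ 2 * r ^ 2 := by
    rw [hidx, List.length_product, List.length_finRange]
  rw [connectPairs, expect_map, hlist, ← hlen]
  refine pow_le_expect_independent_add idx p _ (fun j _ => hc j.1 j.2) (disjointPairs (r ^ 2))
    (fun q hq => ⟨hmem _, hmem _, fun h => ?_⟩)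
    (fun z l => (l.map (passages (baseLength n δ) R (2 ^ i * baseLength n δ) z)).sum) _
    fun l g hgood hg hcol => ?_
  · exact (Finset.mem_filter.1 hq).2.1 (congrArg Prod.fst h)
  · have hne : ∀ paths ∈ l, paths ≠ [] := by
      intro paths hpaths h0
      obtain ⟨π, hπ, -⟩ := hgood _ hpaths
      simp [h0] at hπ
    rw [Set.indicator_of_mem]
    · rfl
    rw [Set.mem_ofPred_eq, if_pos hne]
    choose π hπ hret using fun x y => hgood _ (hg (x, y) (hmem _)).2
    have hwalk := fun x y => mem_findPath_support (hg (x, y) (hmem _)).1 (hπ x y)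
    have hin : ∀ x y W, W ∈ [(π x y).1, (π x y).2] →
        W ∈ l.flatten.flatMap fun p => [p.1, p.2] := fun x y W hW =>
      List.mem_flatMap.2 ⟨π x y, List.mem_flatten.2 ⟨_, (hg (x, y) (hmem _)).2, hπ x y⟩, hW⟩
    refine exactMinor_isSome_of_walks hr H (a := a) (b := b) (π := π)
      (fun x y => (hwalk x y).1) (fun x y => (hwalk x y).2.1) (fun x y => (hwalk x y).2.2)
      (fun x y => hin x y _ (by simp)) (fun x y => hin x y _ (by simp)) ?_
    intro x x' y y' hx hy v hv hv'
    have hlen₁ := fun x y => length_of_mem_support_walk G d (hwalk x y).1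
    have hlen₂ := fun x y => length_of_mem_support_walk G d (hwalk x y).2.1
    have h1 := one_le_sum_passages (hπ x y) (hret x y) (hlen₁ x y) (hlen₂ x y) hv
    have h2 := one_le_sum_passages (hπ x' y') (hret x' y') (hlen₁ x' y') (hlen₂ x' y') hv'
    rcases hcol ((x, y), (x', y')) (Finset.mem_filter.2 ⟨Finset.mem_univ _, hx, hy⟩) v with h | h
    · exact absurd h (not_lt.2 h1)
    · exact absurd h (not_lt.2 h2)

lemma findBicliqueIter_eq (H : SimpleGraph (Fin r)) (δ : ℝ) (s : Fin n) (i : ℕ) :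
    expect (findBicliqueIter G d H δ s i) ({o | o.isSome}.indicator 1) =
      ∑ a : Fin (r ^ 2) → Fin n, ∑ b : Fin (r ^ 2) → Fin n,
        (∏ x, dest G d s (2 ^ (i + 1) * baseLength n δ) (a x)) *
        (∏ x, dest G d s (2 ^ (i + 1) * baseLength n δ) (b x)) *
        expect (connectPairs G d H δ ⌈(n : ℝ) ^ (δ * (i + 18) / 2)⌉₊ i (List.ofFn a) (List.ofFn b))
          ({o | o.isSome}.indicator 1) := by
  simp only [findBicliqueIter, expect_bind, expect_independent_replicate_ofFn, Finset.mul_sum,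
    ← mul_assoc]
  rfl

-- Weight the estimate of `pow_le_expect_connectPairs` by `D` and drop samples with a bad pair. Then
-- `D` is enlarged to the true law in the success term only, while the crossing terms keep the
-- weights `D`.
open Classical in
lemma pow_mul_pow_le_expect_findBicliqueIter (hr : 3 ≤ r) (H : SimpleGraph (Fin r)) {δ : ℝ}
    {s : Fin n} {i k : ℕ} (hk : k = ⌈(n : ℝ) ^ (δ * (i + 18) / 2)⌉₊) (R : Finset (Fin n))
    {D : Fin n → ℝ≥0∞} (hD : ∀ v, D v ≤ dest G d s (2 ^ (i + 1) * baseLength n δ) v)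
    (c : ℝ≥0∞) (e : Fin n → Fin n → Prop)
    (he : ∀ u v, e u v → c ≤ expect (findPath G d δ u v k i)
      ({l | ∃ π ∈ l, ReturningPair (baseLength n δ) R π}.indicator 1)) :
    c ^ (r ^ 2 * r ^ 2) * ∑ a : Fin (r ^ 2) → Fin n, ∑ b : Fin (r ^ 2) → Fin n,
        (∏ x, D (a x)) * (∏ y, D (b y)) * ∏ y, ∏ x, (if e (a x) (b y) then 1 else 0) ≤
      expect (findBicliqueIter G d H δ s i) ({o | o.isSome}.indicator 1) +
        ∑ _q ∈ disjointPairs (r ^ 2), ∑ z,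
          (∑ u, ∑ v, D u * D v * expectedPassages G d δ R k i z u v) ^ 2 := by
  have hD1 : ∑ v, D v ≤ 1 := by
    refine (Finset.sum_le_sum fun v _ => hD v).trans ?_
    rw [← tsum_fintype (L := .unconditional _), PMF.tsum_coe]
  set S : (Fin (r ^ 2) → Fin n) → (Fin (r ^ 2) → Fin n) → ℝ≥0∞ := fun a b =>
    expect (connectPairs G d H δ k i (List.ofFn a) (List.ofFn b)) ({o | o.isSome}.indicator 1)
    with hS
  have hpt : ∀ a b : Fin (r ^ 2) → Fin n, c ^ (r ^ 2 * r ^ 2) * ((∏ x, D (a x)) * (∏ y, D (b y)) *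
      ∏ y, ∏ x, (if e (a x) (b y) then 1 else 0)) ≤ (∏ x, D (a x)) * (∏ y, D (b y)) * S a b +
      ∑ q ∈ disjointPairs (r ^ 2), ∑ z, (∏ x, D (a x)) * (∏ y, D (b y)) *
        (expectedPassages G d δ R k i z (a q.1.1) (b q.1.2) *
        expectedPassages G d δ R k i z (a q.2.1) (b q.2.2)) := by
    intro a b
    by_cases hall : ∀ x y, e (a x) (b y)
    · simp only [hall, if_true, Finset.prod_const_one, mul_one]
      rw [mul_comm]
      simp only [← Finset.mul_sum, ← mul_add]
      gcongr
      exact pow_le_expect_connectPairs hr H δ R k i a b fun x y => he _ _ (hall x y)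
    · push Not at hall
      obtain ⟨x, y, hxy⟩ := hall
      have h0 : ∏ y, ∏ x, (if e (a x) (b y) then (1 : ℝ≥0∞) else 0) = 0 :=
        Finset.prod_eq_zero (Finset.mem_univ y)
          (Finset.prod_eq_zero (Finset.mem_univ x) (if_neg hxy))
      rw [h0]
      simp
  simp only [Finset.mul_sum]
  refine (Finset.sum_le_sum fun a _ => Finset.sum_le_sum fun b _ => hpt a b).trans ?_
  simp only [Finset.sum_add_distrib]
  rw [findBicliqueIter_eq, ← hk]
  gcongr with a _ b _
  · exact hD _
  · exact hD _
  · have hswap : ∀ f : (Fin (r ^ 2) → Fin n) → (Fin (r ^ 2) → Fin n) →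
        ((Fin (r ^ 2) × Fin (r ^ 2)) × (Fin (r ^ 2) × Fin (r ^ 2))) → Fin n → ℝ≥0∞,
        ∑ a, ∑ b, ∑ q ∈ disjointPairs (r ^ 2), ∑ z, f a b q z =
        ∑ q ∈ disjointPairs (r ^ 2), ∑ z, ∑ a, ∑ b, f a b q z := by
      intro f
      simp only [Finset.sum_comm (s := (Finset.univ : Finset (Fin (r ^ 2) → Fin n)))
        (t := disjointPairs (r ^ 2))]
      refine Finset.sum_congr rfl fun q _ => ?_
      simp only [Finset.sum_comm (s := (Finset.univ : Finset (Fin (r ^ 2) → Fin n)))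
        (t := (Finset.univ : Finset (Fin n)))]
    rw [hswap]
    refine Finset.sum_le_sum fun q hq => Finset.sum_le_sum fun z _ => ?_
    obtain ⟨-, hx, hy⟩ := Finset.mem_filter.1 hq
    exact sum_prod_prod_mul_le hD1 hx.symm hy.symm _

end FindBiclique

end MinorFinding

namespace MinorFinding

open scoped ENNReal Matrix

set_option linter.unusedSectionVars false

section FindBiclique

variable {n r : ℕ} {G : SimpleGraph (Fin n)} [DecidableRel G.Adj] {d : ℕ} [NeZero d]

lemma returnMatrix_pow_le_walk (hd : ∀ v, G.degree v ≤ d) (ℓ : ℕ) (R : Finset (Fin n)) (m : ℕ)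
    (s u : Fin n) : (returnMatrix G d ℓ R ^ m) s u ≤ (stepMatrix G d ^ (m * ℓ)) s u := by
  have h := returnMatrix_pow_mono (d := d) hd ℓ (Finset.subset_univ R) m s u
  have hu : returnMatrix G d ℓ Finset.univ = stepMatrix G d ^ ℓ := by
    rw [returnMatrix, Finset.coe_univ, restr_univ, one_mul, mul_one]
  rwa [hu, ← pow_mul, mul_comm ℓ] at h

lemma ofReal_returnMatrix_pow_le_dest (hd : ∀ v, G.degree v ≤ d) (ℓ : ℕ) (R : Finset (Fin n))
    (m : ℕ) (s u : Fin n) :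
    ENNReal.ofReal ((returnMatrix G d ℓ R ^ m) s u) ≤ dest G d s (m * ℓ) u := by
  rw [← ENNReal.ofReal_toReal ((dest G d s (m * ℓ)).apply_ne_top u)]
  refine ENNReal.ofReal_le_ofReal ((returnMatrix_pow_le_walk hd ℓ R m s u).trans_eq ?_)
  exact (walkProb_eq G d s u _).symm

lemma sum_expectedPassages_le {δ : ℝ} (hℓ : 0 < baseLength n δ) (hd : ∀ v, G.degree v ≤ d)
    (R : Finset (Fin n)) (i k : ℕ) {D : Fin n → ℝ} (hD : ∀ u, 0 ≤ D u) (hD1 : ∑ u, D u ≤ 1)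
    {μ : ℝ} (hμ : ∀ a b, (returnMatrix G d (baseLength n δ) R ^ 2 ^ i) a b ≤ μ) :
    ∑ z, (∑ u, ∑ v, ENNReal.ofReal (D u) * ENNReal.ofReal (D v) *
        expectedPassages G d δ R k i z u v) ^ 2 ≤
      ENNReal.ofReal (k ^ 4 *
        (4 * μ ^ 2 * ((2 ^ i * baseLength n δ : ℕ) + 1) ^ 2 * ∑ u, D u ^ 2)) := by
  set L := 2 ^ i * baseLength n δ with hL
  set T : Fin n → Fin n → Fin n → ℝ := fun z u v => ∑ t ∈ Finset.range (L + 1),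
    (throughProb G d (baseLength n δ) R i t z u v + throughProb G d (baseLength n δ) R i t z v u)
    with hT
  have hT0 : ∀ z u v, 0 ≤ T z u v := fun z u v => Finset.sum_nonneg fun t _ =>
    add_nonneg (throughProb_nonneg hd _ R i t z u v) (throughProb_nonneg hd _ R i t z v u)
  have h1 : ∀ z, (∑ u, ∑ v, ENNReal.ofReal (D u) * ENNReal.ofReal (D v) *
      expectedPassages G d δ R k i z u v) ≤
      ENNReal.ofReal (k ^ 2 * ∑ u, ∑ v, D u * D v * T z u v) := by
    intro z
    calc _ ≤ ∑ u, ∑ v, ENNReal.ofReal (D u) * ENNReal.ofReal (D v) *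
          ENNReal.ofReal (k ^ 2 * T z u v) := by
          gcongr with u _ v _
          exact expect_passages_le hℓ hd R i k z u v
      _ = ∑ u, ∑ v, ENNReal.ofReal (k ^ 2 * (D u * D v * T z u v)) := by
          refine Finset.sum_congr rfl fun u _ => Finset.sum_congr rfl fun v _ => ?_
          rw [← ENNReal.ofReal_mul (hD u), ← ENNReal.ofReal_mul (mul_nonneg (hD u) (hD v))]
          congr 1; ring
      _ = _ := by
          have h0 : ∀ u v, 0 ≤ (k : ℝ) ^ 2 * (D u * D v * T z u v) := fun u v =>
            mul_nonneg (by positivity) (mul_nonneg (mul_nonneg (hD u) (hD v)) (hT0 z u v))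
          rw [Finset.mul_sum, ENNReal.ofReal_sum_of_nonneg fun u _ => by
            rw [Finset.mul_sum]; exact Finset.sum_nonneg fun v _ => h0 u v]
          refine Finset.sum_congr rfl fun u _ => ?_
          rw [Finset.mul_sum, ENNReal.ofReal_sum_of_nonneg fun v _ => h0 u v]
  have h0 : ∀ z, 0 ≤ (k : ℝ) ^ 2 * ∑ u, ∑ v, D u * D v * T z u v := fun z =>
    mul_nonneg (by positivity) (Finset.sum_nonneg fun u _ => Finset.sum_nonneg fun v _ =>
      mul_nonneg (mul_nonneg (hD u) (hD v)) (hT0 z u v))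
  calc _ ≤ ∑ z, ENNReal.ofReal (k ^ 2 * ∑ u, ∑ v, D u * D v * T z u v) ^ 2 := by
        gcongr with z _; exact h1 z
    _ = ENNReal.ofReal (∑ z, (k ^ 2 * ∑ u, ∑ v, D u * D v * T z u v) ^ 2) := by
        rw [ENNReal.ofReal_sum_of_nonneg fun z _ => sq_nonneg _]
        exact Finset.sum_congr rfl fun z _ => (ENNReal.ofReal_pow (h0 z) 2).symm
    _ ≤ _ := by
        refine ENNReal.ofReal_le_ofReal ?_
        simp only [mul_pow (_ ^ 2 : ℝ), ← Finset.mul_sum]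
        rw [← pow_mul]
        gcongr
        exact sum_sq_sum_throughProb_le hd (baseLength n δ) R i hD hD1 hμ L

open Classical in
/-- The success probability of one iteration of `FindBiclique` in terms of the return matrix. -/
theorem le_expect_findBicliqueIter (hr : 3 ≤ r) (H : SimpleGraph (Fin r)) {δ : ℝ}
    (hℓ : 0 < baseLength n δ) (hd : ∀ v, G.degree v ≤ d) (R : Finset (Fin n)) (s : Fin n)
    {i k : ℕ} (hk : k = ⌈(n : ℝ) ^ (δ * (i + 18) / 2)⌉₊) {μ η p τ : ℝ}
    (hμ : ∀ a b, (returnMatrix G d (baseLength n δ) R ^ 2 ^ i) a b ≤ μ) (hη : 0 < η)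
    (hkη : 1 + 2 * k * μ ≤ k ^ 2 * η) (hp : 0 ≤ p)
    (hpe : p ≤ ∑ u, ∑ v, (returnMatrix G d (baseLength n δ) R ^ 2 ^ (i + 1)) s u *
      (returnMatrix G d (baseLength n δ) R ^ 2 ^ (i + 1)) s v *
      if η ≤ (returnMatrix G d (baseLength n δ) R ^ (2 * 2 ^ i)) u v then 1 else 0)
    (hτ : ∑ u, (returnMatrix G d (baseLength n δ) R ^ 2 ^ (i + 1)) s u ^ 2 ≤ τ) :
    ENNReal.ofReal ((p / 2) ^ (r ^ 2 * r ^ 2) - (r ^ 2 * r ^ 2) ^ 2 * (k ^ 4 *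
        (4 * μ ^ 2 * ((2 ^ i * baseLength n δ : ℕ) + 1) ^ 2 * τ))) ≤
      expect (findBicliqueIter G d H δ s i) ({o | o.isSome}.indicator 1) := by
  set Q := returnMatrix G d (baseLength n δ) R with hQ
  set D : Fin n → ℝ := fun u => (Q ^ 2 ^ (i + 1)) s u with hDdef
  have hDS := (returnMatrix_doublySub (d := d) hd (baseLength n δ) R).pow (2 ^ (i + 1))
  have hD : ∀ u, 0 ≤ D u := fun u => hDS.nonneg s u
  have hD1 : ∑ u, D u ≤ 1 := hDS.row s
  have hr0 : r ^ 2 ≠ 0 := by positivity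
  have hmain := pow_mul_pow_le_expect_findBicliqueIter hr H (s := s) hk R
    (D := fun u => ENNReal.ofReal (D u))
    (fun v => ofReal_returnMatrix_pow_le_dest hd (baseLength n δ) R (2 ^ (i + 1)) s v) (1 / 2)
    (fun u v => η ≤ (Q ^ (2 * 2 ^ i)) u v)
    fun u v huv => half_le_expect_findPath hℓ hd R i k u v hμ hη huv hkη
  have hbic := pow_le_sum_biclique hD hD1
    (e := fun u v => if η ≤ (Q ^ (2 * 2 ^ i)) u v then 1 else 0)
    (fun a b => by split_ifs <;> norm_num) hp hpe hr0
  have hconv : ENNReal.ofReal (p ^ (r ^ 2 * r ^ 2)) ≤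
      ∑ a : Fin (r ^ 2) → Fin n, ∑ b : Fin (r ^ 2) → Fin n,
        (∏ x, ENNReal.ofReal (D (a x))) * (∏ y, ENNReal.ofReal (D (b y))) *
        ∏ y, ∏ x, (if η ≤ (Q ^ (2 * 2 ^ i)) (a x) (b y) then 1 else 0) := by
    have h0 : ∀ a b : Fin (r ^ 2) → Fin n, 0 ≤ (∏ x, D (a x)) * (∏ y, D (b y)) *
        ∏ y, ∏ x, (if η ≤ (Q ^ (2 * 2 ^ i)) (a x) (b y) then (1 : ℝ) else 0) := fun a b =>
      mul_nonneg (mul_nonneg (Finset.prod_nonneg fun x _ => hD _)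
        (Finset.prod_nonneg fun y _ => hD _)) (Finset.prod_nonneg fun y _ =>
        Finset.prod_nonneg fun x _ => by split_ifs <;> norm_num)
    refine (ENNReal.ofReal_le_ofReal hbic).trans_eq ?_
    rw [ENNReal.ofReal_sum_of_nonneg fun a _ => Finset.sum_nonneg fun b _ => h0 a b]
    refine Finset.sum_congr rfl fun a _ => ?_
    rw [ENNReal.ofReal_sum_of_nonneg fun b _ => h0 a b]
    refine Finset.sum_congr rfl fun b _ => ?_
    rw [ENNReal.ofReal_mul (mul_nonneg (Finset.prod_nonneg fun x _ => hD _)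
        (Finset.prod_nonneg fun y _ => hD _)),
      ENNReal.ofReal_mul (Finset.prod_nonneg fun x _ => hD _),
      ENNReal.ofReal_prod_of_nonneg fun x _ => hD _, ENNReal.ofReal_prod_of_nonneg fun x _ => hD _,
      ENNReal.ofReal_prod_of_nonneg fun y _ =>
        Finset.prod_nonneg fun x _ => by split_ifs <;> norm_num]
    congr 1
    refine Finset.prod_congr rfl fun y _ => ?_
    rw [ENNReal.ofReal_prod_of_nonneg fun x _ => by split_ifs <;> norm_num]
    refine Finset.prod_congr rfl fun x _ => ?_
    split_ifs <;> simp
  have hμ0 : 0 ≤ μ := (((returnMatrix_doublySub (d := d) hd (baseLength n δ) R).pow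
    (2 ^ i)).nonneg s s).trans (hμ s s)
  have hτ0 : 0 ≤ τ := (Finset.sum_nonneg fun u _ => sq_nonneg _).trans hτ
  rw [ENNReal.ofReal_sub _ (by positivity), tsub_le_iff_right]
  calc ENNReal.ofReal ((p / 2) ^ (r ^ 2 * r ^ 2))
      = (1 / 2) ^ (r ^ 2 * r ^ 2) * ENNReal.ofReal (p ^ (r ^ 2 * r ^ 2)) := by
        rw [div_eq_mul_one_div, mul_pow, ENNReal.ofReal_mul (by positivity), mul_comm,
          ENNReal.ofReal_pow (by norm_num), ENNReal.ofReal_div_of_pos (by norm_num)]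
        simp
    _ ≤ _ := by gcongr
    _ ≤ _ := hmain
    _ ≤ _ := by
        gcongr
        have hcard : (disjointPairs (r ^ 2)).card ≤ (r ^ 2 * r ^ 2) ^ 2 := by
          refine (Finset.card_le_univ _).trans_eq ?_
          simp [Fintype.card_prod, sq]
        have hQ' := sum_expectedPassages_le hℓ hd R i k hD hD1 hμ
        rw [Finset.sum_const, nsmul_eq_mul, ENNReal.ofReal_mul (by positivity)]
        refine mul_le_mul' ?_ (hQ'.trans (ENNReal.ofReal_le_ofReal (by gcongr)))
        rw [show ((r : ℝ) ^ 2 * r ^ 2) ^ 2 = (((r ^ 2 * r ^ 2) ^ 2 : ℕ) : ℝ) by push_cast; ring,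
          ENNReal.ofReal_natCast]
        exact_mod_cast hcard

end FindBiclique

end MinorFinding

namespace MinorFinding

open scoped ENNReal Matrix

set_option linter.unusedSectionVars false

/-! ### Density of good pairs of end vertices -/

section Density

variable {n : ℕ} {G : SimpleGraph (Fin n)} [DecidableRel G.Adj] {d : ℕ} [NeZero d]

lemma returnMatrix_pow_diag_le (hd : ∀ v, G.degree v ≤ d) {δ : ℝ} (hℓ : 0 < baseLength n δ)
    {R : Finset (Fin n)} {i : ℕ} {β : ℝ} (hβ0 : 0 ≤ β)
    (hβ : ∀ u ∈ R, returnNormSq G d δ R i u ≤ β) (u : Fin n) :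
    (returnMatrix G d (baseLength n δ) R ^ (2 * 2 ^ i)) u u ≤ β := by
  by_cases hu : u ∈ R
  · rw [← returnNormSq_eq hd hℓ i hu]; exact hβ u hu
  · rw [returnMatrix_pow_eq_zero_left (hm := by positivity) (hu := hu)]; exact hβ0

lemma returnMatrix_pow_le (hd : ∀ v, G.degree v ≤ d) {δ : ℝ} (hℓ : 0 < baseLength n δ)
    {R : Finset (Fin n)} {i : ℕ} {β : ℝ} (hβ0 : 0 ≤ β)
    (hβ : ∀ u ∈ R, returnNormSq G d δ R i u ≤ β) (u v : Fin n) :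
    (returnMatrix G d (baseLength n δ) R ^ (2 * 2 ^ i)) u v ≤ β := by
  have h := returnMatrix_pow_apply_sq_le (d := d) hd (baseLength n δ) R (2 ^ i) u v
  have hnn := ((returnMatrix_doublySub (d := d) hd (baseLength n δ) R).pow (2 * 2 ^ i)).nonneg
  refine abs_le_of_sq_le_sq' (h.trans ?_) hβ0 |>.2
  rw [sq]
  exact mul_le_mul (returnMatrix_pow_diag_le hd hℓ hβ0 hβ u)
    (returnMatrix_pow_diag_le hd hℓ hβ0 hβ v) (hnn v v) hβ0

/-- If walks from `s` of length `2 ^ (i + 1) ℓ` often return together, then so do the walks of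
length `2 ^ i ℓ` from their end vertices. -/
lemma sq_div_le_sum_returnMatrix_pow (hd : ∀ v, G.degree v ≤ d) (ℓ : ℕ) (R : Finset (Fin n))
    (i : ℕ) (s : Fin n) {β γ : ℝ} (hβ0 : 0 < β) (hγ : 0 ≤ γ)
    (hβ : (returnMatrix G d ℓ R ^ (2 * 2 ^ i)) s s ≤ β)
    (hs : γ ≤ (returnMatrix G d ℓ R ^ (2 * 2 ^ (i + 1))) s s) :
    γ ^ 2 / β ≤ ∑ u, ∑ v, (returnMatrix G d ℓ R ^ 2 ^ (i + 1)) s u *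
      (returnMatrix G d ℓ R ^ 2 ^ (i + 1)) s v * (returnMatrix G d ℓ R ^ (2 * 2 ^ i)) u v := by
  set Q := returnMatrix G d ℓ R with hQ
  have hsymm : ∀ m u v, (Q ^ m) u v = (Q ^ m) v u := returnMatrix_pow_symm hd ℓ R
  -- Put `D = Q^{2^{i+1}} e_s`. In units of `2 ^ i` the exponents `2 + 2 + 2` make the quadratic
  -- form equal to `‖Q^{3·2^i} e_s‖²`. By `h4` the hypothesis on `γ` concerns the inner product of
  -- that vector with `Q^{2^i} e_s`, of squared norm at most `β`; Cauchy–Schwarz concludes.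
  have h3 : ∑ u, ∑ v, (Q ^ 2 ^ (i + 1)) s u * (Q ^ 2 ^ (i + 1)) s v * (Q ^ (2 * 2 ^ i)) u v =
      ∑ w, (Q ^ (3 * 2 ^ i)) s w ^ 2 := by
    rw [sum_returnMatrix_pow_sq hd ℓ R, show 2 * (3 * 2 ^ i) = 2 ^ (i + 1) + 2 * 2 ^ i + 2 ^ (i + 1)
      by ring, ← hQ, pow_add Q _ (2 ^ (i + 1)), pow_add Q, Matrix.mul_apply, Finset.sum_comm]
    refine Finset.sum_congr rfl fun v _ => ?_
    rw [Matrix.mul_apply, Finset.sum_mul]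
    refine Finset.sum_congr rfl fun u _ => ?_
    rw [hsymm (2 ^ (i + 1)) v s]; ring
  have h4 : (Q ^ (2 * 2 ^ (i + 1))) s s = ∑ w, (Q ^ (3 * 2 ^ i)) s w * (Q ^ 2 ^ i) s w := by
    rw [show 2 * 2 ^ (i + 1) = 3 * 2 ^ i + 2 ^ i by ring, pow_add, Matrix.mul_apply]
    exact Finset.sum_congr rfl fun w _ => by rw [hsymm (2 ^ i) w s]
  rw [h3, div_le_iff₀ hβ0]
  calc γ ^ 2 ≤ (∑ w, (Q ^ (3 * 2 ^ i)) s w * (Q ^ 2 ^ i) s w) ^ 2 := by rw [← h4]; gcongr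
    _ ≤ (∑ w, (Q ^ (3 * 2 ^ i)) s w ^ 2) * ∑ w, (Q ^ 2 ^ i) s w ^ 2 :=
        Finset.sum_mul_sq_le_sq_mul_sq _ _ _
    _ ≤ _ := by
        gcongr
        rw [sum_returnMatrix_pow_sq hd ℓ R]; exact hβ

-- Split at the threshold: the pairs below it contribute at most `η` in all, every other pair at
-- most `β` times its weight.
open Classical in
lemma div_le_sum_indicator {V : Type*} [Fintype V] {D : V → ℝ} (hD : ∀ v, 0 ≤ D v)
    (hD1 : ∑ v, D v ≤ 1) {A : V → V → ℝ} {β η κ : ℝ} (hβ : 0 < β) (hη : 0 ≤ η)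
    (hA : ∀ u v, A u v ≤ β) (hκ : κ ≤ ∑ u, ∑ v, D u * D v * A u v) :
    (κ - η) / β ≤ ∑ u, ∑ v, D u * D v * if η ≤ A u v then 1 else 0 := by
  have hsum : ∑ u, ∑ v, D u * D v ≤ 1 := by
    rw [← Finset.sum_mul_sum]
    exact mul_le_one₀ hD1 (Finset.sum_nonneg fun v _ => hD v) hD1
  rw [div_le_iff₀ hβ, sub_le_iff_le_add]
  calc κ ≤ _ := hκ
    _ ≤ ∑ u, ∑ v, ((D u * D v * if η ≤ A u v then 1 else 0) * β + D u * D v * η) := by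
        gcongr with u _ v _
        have h0 := mul_nonneg (hD u) (hD v)
        split_ifs with h
        · nlinarith [hA u v, mul_nonneg h0 hη, mul_le_mul_of_nonneg_left (hA u v) h0]
        · nlinarith [mul_le_mul_of_nonneg_left (not_le.1 h).le h0]
    _ = (∑ u, ∑ v, D u * D v * if η ≤ A u v then 1 else 0) * β + (∑ u, ∑ v, D u * D v) * η := by
        simp only [Finset.sum_add_distrib, Finset.sum_mul]
    _ ≤ _ := by nlinarith

end Density

end MinorFinding

namespace MinorFinding

open scoped ENNReal Matrix

set_option linter.unusedSectionVars false

/-- Count powers of `x`: the error has order `49 - m`, namely `2m + 40` from `K²`, `10` from `L²`,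
and `-2m` and `-(m + 1)` from the inverses. The main term has order `-2N`. As `m ≥ 5N - 1` and `N ≥
81`, the error is smaller by at least a factor `x`, up to constants. This is what starting
FindBiclique at `5r^4` is for. -/
lemma collision_error_le {x K L : ℝ} {N r m : ℕ} (hN : N = r ^ 2 * r ^ 2) (hr : 3 ≤ r)
    (hx : 4 ^ N * (64 * N ^ 2 * 4 ^ (m + 4) + 1) ≤ x) (hK0 : 0 ≤ K) (hK : K ≤ 4 * x ^ (m + 20))
    (hL0 : 0 ≤ L) (hL : L ≤ 2 ^ (m + 4) * x ^ 5) (hm : 5 * N ≤ m + 1) :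
    (x ^ (3 * N))⁻¹ ≤ ((x ^ 2)⁻¹ / 4) ^ N -
      (N : ℝ) ^ 2 * (K ^ 2 * (4 * (x ^ m)⁻¹ ^ 2 * L ^ 2 * (x ^ (m + 1))⁻¹)) := by
  have hN81 : 81 ≤ N := by
    have : 3 ^ 2 ≤ r ^ 2 := Nat.pow_le_pow_left hr 2
    rw [hN]; exact Nat.mul_le_mul this this
  set C : ℝ := 64 * N ^ 2 * 4 ^ (m + 4) with hC
  have hC0 : 0 ≤ C := by positivity
  have hx1 : 1 ≤ x := by
    refine le_trans ?_ hx
    have : (1 : ℝ) ≤ 4 ^ N := one_le_pow₀ (by norm_num)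
    nlinarith
  have hx0 : 0 < x := by linarith
  have herr : (N : ℝ) ^ 2 * (K ^ 2 * (4 * (x ^ m)⁻¹ ^ 2 * L ^ 2 * (x ^ (m + 1))⁻¹)) ≤
      C * (x ^ (2 * N + 1))⁻¹ := by
    calc _ ≤ (N : ℝ) ^ 2 * ((4 * x ^ (m + 20)) ^ 2 *
          (4 * (x ^ m)⁻¹ ^ 2 * (2 ^ (m + 4) * x ^ 5) ^ 2 * (x ^ (m + 1))⁻¹)) := by gcongr
      _ = C * (x ^ 49 * (x ^ m)⁻¹) := by
          have h4 : (4 : ℝ) ^ (m + 4) = (2 ^ (m + 4)) ^ 2 := by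
            rw [← pow_mul, mul_comm, pow_mul]; norm_num
          rw [hC, h4]
          have e1 : x ^ (m + 20) = x ^ m * x ^ 20 := pow_add _ _ _
          have e2 : x ^ (m + 1) = x ^ m * x := pow_succ _ _
          rw [e1, e2]
          have : x ^ m ≠ 0 := by positivity
          field_simp
          ring
      _ ≤ _ := by
          gcongr
          rw [← div_eq_mul_inv, div_le_iff₀ (by positivity), ← div_eq_inv_mul,
            le_div_iff₀ (by positivity), ← pow_add]
          exact pow_le_pow_right₀ hx1 (by omega)
  have h1 : ((x ^ 2)⁻¹ / 4) ^ N = (x ^ (2 * N))⁻¹ * (4 ^ N)⁻¹ := by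
    rw [div_eq_mul_inv, mul_pow, inv_pow, inv_pow, ← pow_mul]
  rw [h1]
  refine le_sub_iff_add_le.2 ((add_le_add_right herr _).trans ?_)
  have h2 : (x ^ (3 * N))⁻¹ ≤ (x ^ (2 * N + 1))⁻¹ := by
    gcongr
    omega
  calc _ ≤ (x ^ (2 * N + 1))⁻¹ + C * (x ^ (2 * N + 1))⁻¹ := by gcongr
    _ = (x ^ (2 * N))⁻¹ * ((C + 1) * x⁻¹) := by rw [pow_succ, mul_inv]; ring
    _ ≤ _ := by
        gcongr
        rw [← div_eq_mul_inv, div_le_iff₀ hx0, ← div_eq_inv_mul, le_div_iff₀ (by positivity)]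
        linarith

variable {n r : ℕ} {G : SimpleGraph (Fin n)} [DecidableRel G.Adj] {d : ℕ} [NeZero d]

/-- `FindBiclique` succeeds from a vertex whose walks return much more often after `2 ^ i ℓ` steps
than the walks from any vertex of `R` do after somewhat fewer steps. -/
theorem le_expect_findBicliqueIter_of_returnNormSq (hr : 3 ≤ r) (H : SimpleGraph (Fin r)) {δ : ℝ}
    (hn : 0 < n) (hd : ∀ v, G.degree v ≤ d) {R : Finset (Fin n)} {s : Fin n} (hs : s ∈ R) {m : ℕ}
    (hm : 5 * (r ^ 2 * r ^ 2) ≤ m + 1) {x : ℝ} (hxn : x = (n : ℝ) ^ δ)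
    (hx : 4 ^ (r ^ 2 * r ^ 2) * (64 * ((r ^ 2 * r ^ 2 : ℕ) : ℝ) ^ 2 * 4 ^ (m + 4) + 1) ≤ x)
    (h₁ : ∀ u ∈ R, returnNormSq G d δ R (m + 1) u ≤ (x ^ m)⁻¹)
    (h₂ : ∀ u ∈ R, returnNormSq G d δ R (m + 2) u ≤ (x ^ (m + 1))⁻¹)
    (h₃ : (x ^ (m + 2))⁻¹ ≤ returnNormSq G d δ R (m + 3) s) :
    ENNReal.ofReal (x ^ (3 * (r ^ 2 * r ^ 2)))⁻¹ ≤
      expect (findBicliqueIter G d H δ s (m + 2)) ({o | o.isSome}.indicator 1) := by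
  classical
  have hℓ := baseLength_pos hn δ
  have hx2 : 2 ≤ x := by
    refine le_trans ?_ hx
    have h1 : (4 : ℝ) ≤ 4 ^ (r ^ 2 * r ^ 2) := le_self_pow₀ (by norm_num) (by positivity)
    have h2 : (0 : ℝ) ≤ 64 * ((r ^ 2 * r ^ 2 : ℕ) : ℝ) ^ 2 * 4 ^ (m + 4) := by positivity
    nlinarith
  have hx0 : 0 < x := by linarith
  have hx1 : 1 ≤ x := by linarith
  set k := ⌈(n : ℝ) ^ (δ * ((m + 2 : ℕ) + 18) / 2)⌉₊ with hk
  set y := (n : ℝ) ^ (δ * ((m + 2 : ℕ) + 18) / 2) with hy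
  have hysq : y ^ 2 = x ^ (m + 20) := by
    rw [hy, hxn, ← Real.rpow_natCast, ← Real.rpow_natCast, ← Real.rpow_mul (by positivity),
      ← Real.rpow_mul (by positivity)]
    congr 1; push_cast; ring
  have hy0 : 0 ≤ y := by positivity
  have hy1 : 1 ≤ y := by
    by_contra hlt
    push Not at hlt
    have h1 : y ^ 2 < 1 := by nlinarith
    rw [hysq] at h1
    exact absurd (one_le_pow₀ hx1) (not_le.2 h1)
  have hky : y ≤ k := Nat.le_ceil _
  have hky' : (k : ℝ) ≤ 2 * y := by
    have := (Nat.ceil_lt_add_one hy0).le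
    linarith
  have hK : (k : ℝ) ^ 2 ≤ 4 * x ^ (m + 20) := by rw [← hysq]; nlinarith
  have hK' : x ^ (m + 20) ≤ (k : ℝ) ^ 2 := by rw [← hysq]; gcongr
  have hx5 : (n : ℝ) ^ (5 * δ) = x ^ 5 := by
    rw [hxn, ← Real.rpow_natCast, ← Real.rpow_mul (by positivity)]
    congr 1; push_cast; ring
  have hℓx : (baseLength n δ : ℝ) ≤ 2 * x ^ 5 := by
    have h1 := (Nat.ceil_lt_add_one (show (0 : ℝ) ≤ (n : ℝ) ^ (5 * δ) by positivity)).le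
    have h2 : 1 ≤ x ^ 5 := one_le_pow₀ hx1
    rw [baseLength]
    linarith
  set Q := returnMatrix G d (baseLength n δ) R with hQ
  have hμ : ∀ a b, (Q ^ 2 ^ (m + 2)) a b ≤ (x ^ m)⁻¹ := fun a b => by
    rw [show 2 ^ (m + 2) = 2 * 2 ^ (m + 1) by ring]
    exact returnMatrix_pow_le hd hℓ (by positivity) h₁ a b
  have hβ : ∀ a b, (Q ^ (2 * 2 ^ (m + 2))) a b ≤ (x ^ (m + 1))⁻¹ :=
    returnMatrix_pow_le hd hℓ (by positivity) h₂
  have hγ : (x ^ (m + 2))⁻¹ ≤ (Q ^ (2 * 2 ^ (m + 2 + 1))) s s := by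
    rw [← returnNormSq_eq hd hℓ _ hs]; exact h₃
  have hκ := sq_div_le_sum_returnMatrix_pow hd (baseLength n δ) R (m + 2) s
    (by positivity) (by positivity) (hβ s s) hγ
  have hDS := (returnMatrix_doublySub (d := d) hd (baseLength n δ) R).pow (2 ^ (m + 2 + 1))
  have hpe := div_le_sum_indicator (fun u => hDS.nonneg s u) (hDS.row s)
    (by positivity) (η := (x ^ (m + 4))⁻¹) (by positivity) hβ hκ
  -- Here `γ² / β = x^{-(m+3)}`; the threshold `x^{-(m+4)}` costs only a fraction `1/x` of it.
  have hp : (x ^ 2)⁻¹ / 2 ≤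
      ((x ^ (m + 2))⁻¹ ^ 2 / (x ^ (m + 1))⁻¹ - (x ^ (m + 4))⁻¹) / (x ^ (m + 1))⁻¹ := by
    have e : ((x ^ (m + 2))⁻¹ ^ 2 / (x ^ (m + 1))⁻¹ - (x ^ (m + 4))⁻¹) / (x ^ (m + 1))⁻¹ =
        (x ^ 2)⁻¹ * (1 - x⁻¹) := by
      have : x ^ m ≠ 0 := by positivity
      simp only [pow_add]
      field_simp
    rw [e, div_eq_mul_inv]
    gcongr
    have : x⁻¹ ≤ 2⁻¹ := by gcongr
    linarith
  have hτ : ∑ u, (Q ^ 2 ^ (m + 2 + 1)) s u ^ 2 ≤ (x ^ (m + 1))⁻¹ := by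
    rw [sum_returnMatrix_pow_sq hd]
    refine le_trans ?_ (hβ s s)
    rw [show 2 * 2 ^ (m + 2 + 1) = 2 * (2 ^ (m + 2) + 2 ^ (m + 2)) by ring]
    exact returnMatrix_pow_mulVec_sq hd _ R _ _ s
  -- `k² η` is at least `x^16`, and half of it covers `2 k μ` because `k ≥ 4 x^4`.
  have hkη : 1 + 2 * (k : ℝ) * (x ^ m)⁻¹ ≤ k ^ 2 * (x ^ (m + 4))⁻¹ := by
    have hx4 : (16 : ℝ) ≤ x ^ 4 := by
      calc (16 : ℝ) = 2 ^ 4 := by norm_num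
        _ ≤ x ^ 4 := by gcongr
    have hxm : 1 ≤ x ^ m := one_le_pow₀ hx1
    have hk4 : 4 * x ^ 4 ≤ k := by
      refine abs_le_of_sq_le_sq' ?_ (by positivity) |>.2
      refine le_trans ?_ hK'
      calc (4 * x ^ 4) ^ 2 = 16 * x ^ 8 := by ring
        _ ≤ x ^ 4 * x ^ 8 := by gcongr
        _ = x ^ 12 := by ring
        _ ≤ _ := pow_le_pow_right₀ hx1 (by omega)
    have hone : (2 : ℝ) ≤ k ^ 2 * (x ^ (m + 4))⁻¹ := by
      rw [← div_eq_mul_inv, le_div_iff₀ (by positivity)]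
      refine le_trans ?_ hK'
      calc 2 * x ^ (m + 4) ≤ x ^ 16 * x ^ (m + 4) := by
            gcongr
            calc (2 : ℝ) ≤ 2 ^ 16 := by norm_num
              _ ≤ _ := by gcongr
        _ = _ := by rw [← pow_add]; congr 1; omega
    have htwo : 4 * (k : ℝ) * (x ^ m)⁻¹ ≤ k ^ 2 * (x ^ (m + 4))⁻¹ := by
      rw [pow_add, mul_inv, sq]
      have : (k : ℝ) * k * ((x ^ m)⁻¹ * (x ^ 4)⁻¹) = (k * (x ^ 4)⁻¹) * k * (x ^ m)⁻¹ := by ring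
      rw [this]
      gcongr
      rwa [← div_eq_mul_inv, le_div_iff₀ (by positivity)]
    linarith
  have hmain := le_expect_findBicliqueIter hr H hℓ hd R s hk hμ
    (by positivity : (0 : ℝ) < (x ^ (m + 4))⁻¹) hkη (by positivity) (hp.trans hpe) hτ
  refine le_trans (ENNReal.ofReal_le_ofReal ?_) hmain
  have hL : ((2 ^ (m + 2) * baseLength n δ : ℕ) : ℝ) + 1 ≤ 2 ^ (m + 4) * x ^ 5 := by
    push_cast
    have h2 : 1 ≤ x ^ 5 := one_le_pow₀ hx1
    have h3 : (1 : ℝ) ≤ 2 ^ (m + 2) := one_le_pow₀ (by norm_num)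
    calc (2 : ℝ) ^ (m + 2) * baseLength n δ + 1 ≤ 2 ^ (m + 2) * (2 * x ^ 5) + 1 * 1 := by
          rw [one_mul]; gcongr
      _ ≤ 2 ^ (m + 2) * (2 * x ^ 5) + 2 ^ (m + 2) * x ^ 5 := by gcongr
      _ ≤ 2 ^ (m + 2) * (4 * x ^ 5) := by nlinarith [mul_pos (show (0:ℝ) < 2 ^ (m + 2) by positivity) (show 0 < x ^ 5 by positivity)]
      _ = _ := by ring
  have := collision_error_le rfl hr hx (by positivity) hK (by positivity) hL hm
  refine this.trans_eq ?_
  push_cast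
  ring

end MinorFinding

namespace MinorFinding

open scoped ENNReal Matrix

set_option linter.unusedSectionVars false

/-! ### Lower bounds for return norms -/

section Moments

variable {n : ℕ} {G : SimpleGraph (Fin n)} [DecidableRel G.Adj] {d : ℕ} [NeZero d]

/-- A lazy symmetric walk is positive semidefinite. -/
lemma sum_stepMatrix_mul_nonneg (hd : ∀ v, G.degree v ≤ d) (w : Fin n → ℝ) :
    0 ≤ ∑ u, ∑ v, stepMatrix G d u v * (w u * w v) := by
  have h1 : ∑ u, ∑ v, stepMatrix G d u v * (w u + w v) ^ 2 =
      2 * ∑ u, w u ^ 2 + 2 * ∑ u, ∑ v, stepMatrix G d u v * (w u * w v) := by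
    have e1 : ∑ u, ∑ v, stepMatrix G d u v * w u ^ 2 = ∑ u, w u ^ 2 := by
      simp only [← Finset.sum_mul, stepMatrix_row_sum, one_mul]
    have e2 : ∑ u, ∑ v, stepMatrix G d u v * w v ^ 2 = ∑ u, w u ^ 2 := by
      rw [Finset.sum_comm, ← e1]
      exact Finset.sum_congr rfl fun u _ => Finset.sum_congr rfl fun v _ => by
        rw [stepMatrix_isSymm G d hd]
    rw [two_mul]
    nth_rewrite 1 [← e1]
    rw [← e2]
    simp only [Finset.mul_sum, ← Finset.sum_add_distrib]
    exact Finset.sum_congr rfl fun u _ => Finset.sum_congr rfl fun v _ => by ring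
  have h2 : 2 * ∑ u, w u ^ 2 ≤ ∑ u, ∑ v, stepMatrix G d u v * (w u + w v) ^ 2 := by
    rw [Finset.mul_sum]
    refine Finset.sum_le_sum fun u _ => ?_
    refine le_trans ?_ (Finset.single_le_sum (f := fun v => stepMatrix G d u v * (w u + w v) ^ 2)
      (fun v _ => mul_nonneg (stepMatrix_nonneg G d u v) (sq_nonneg _)) (Finset.mem_univ u))
    nlinarith [half_le_stepMatrix_self G d u, sq_nonneg (w u),
      mul_le_mul_of_nonneg_right (half_le_stepMatrix_self G d u) (sq_nonneg (w u))]
  linarith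

/-- Positive semidefiniteness applied to `y` minus its mean; constants are fixed by the walk, so the
cross terms are explicit. -/
lemma sq_sum_div_le_sum_stepMatrix (hn : 0 < n) (hd : ∀ v, G.degree v ≤ d) (y : Fin n → ℝ) :
    (∑ v, y v) ^ 2 / n ≤ y ⬝ᵥ stepMatrix G d *ᵥ y := by
  have hn' : (0 : ℝ) < n := by exact_mod_cast hn
  set c := (∑ v, y v) / n with hc
  have h := sum_stepMatrix_mul_nonneg hd fun u => y u - c
  have e : ∑ u, ∑ v, stepMatrix G d u v * ((y u - c) * (y v - c)) =
      (y ⬝ᵥ stepMatrix G d *ᵥ y) - c * ∑ v, y v - c * ∑ v, y v + c ^ 2 * n := by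
    have e1 : y ⬝ᵥ stepMatrix G d *ᵥ y = ∑ u, ∑ v, stepMatrix G d u v * (y u * y v) := by
      simp only [dotProduct, Matrix.mulVec, Finset.mul_sum]
      exact Finset.sum_congr rfl fun u _ => Finset.sum_congr rfl fun v _ => by ring
    have e2 : ∑ u, ∑ v, stepMatrix G d u v * y u = ∑ v, y v := by
      simp only [← Finset.sum_mul, stepMatrix_row_sum, one_mul]
    have e3 : ∑ u, ∑ v, stepMatrix G d u v * y v = ∑ v, y v := by
      rw [Finset.sum_comm, ← e2]
      exact Finset.sum_congr rfl fun u _ => Finset.sum_congr rfl fun v _ => by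
        rw [stepMatrix_isSymm G d hd]
    have e4 : ∑ u : Fin n, ∑ v, stepMatrix G d u v = n := by simp [stepMatrix_row_sum]
    rw [e1, ← e4]
    nth_rewrite 1 [← e2]
    rw [← e3]
    simp only [Finset.mul_sum, ← Finset.sum_add_distrib, ← Finset.sum_sub_distrib]
    exact Finset.sum_congr rfl fun u _ => Finset.sum_congr rfl fun v _ => by ring
  rw [e] at h
  have e5 : c * ∑ v, y v = (∑ v, y v) ^ 2 / n := by rw [hc]; ring
  have e6 : c ^ 2 * n = (∑ v, y v) ^ 2 / n := by rw [hc]; field_simp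
  linarith

lemma sum_stepMatrix_pow_mulVec (hd : ∀ v, G.degree v ≤ d) (m : ℕ) (y : Fin n → ℝ) :
    ∑ v, (stepMatrix G d ^ m *ᵥ y) v = ∑ v, y v := by
  induction m with
  | zero => simp
  | succ m ih =>
    rw [pow_succ', ← Matrix.mulVec_mulVec, ← ih]
    simp only [Matrix.mulVec_eq_sum (stepMatrix G d ^ m *ᵥ y), Finset.sum_apply]
    rw [Finset.sum_comm]
    refine Finset.sum_congr rfl fun v _ => ?_
    simp only [Pi.smul_apply, MulOpposite.smul_eq_mul_unop, MulOpposite.unop_op, ← Finset.sum_mul,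
      stepMatrix_transpose G d hd, stepMatrix_row_sum, one_mul]

lemma dotProduct_stepMatrix_pow (hd : ∀ v, G.degree v ≤ d) (m m' : ℕ) (y : Fin n → ℝ) :
    y ⬝ᵥ stepMatrix G d ^ (m + m' + m) *ᵥ y =
      (stepMatrix G d ^ m *ᵥ y) ⬝ᵥ stepMatrix G d ^ m' *ᵥ (stepMatrix G d ^ m *ᵥ y) := by
  rw [pow_add, pow_add, ← Matrix.mulVec_mulVec, ← Matrix.mulVec_mulVec, Matrix.dotProduct_mulVec]
  congr 1
  rw [← Matrix.mulVec_transpose, Matrix.transpose_pow, stepMatrix_transpose G d hd]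

/-- An even power gives the squared norm of a vector with the same total as `y`. An odd power leaves
one factor `M` over, for which laziness is needed. -/
lemma sq_sum_div_le_dotProduct_pow (hn : 0 < n) (hd : ∀ v, G.degree v ≤ d) (ℓ : ℕ)
    (y : Fin n → ℝ) : (∑ v, y v) ^ 2 / n ≤ y ⬝ᵥ stepMatrix G d ^ ℓ *ᵥ y := by
  have hn' : (0 : ℝ) < n := by exact_mod_cast hn
  rcases Nat.even_or_odd' ℓ with ⟨m, rfl | rfl⟩
  · have h := dotProduct_stepMatrix_pow hd m 0 y
    rw [show 2 * m = m + 0 + m by ring, h, ← sum_stepMatrix_pow_mulVec hd m y, pow_zero,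
      Matrix.one_mulVec, div_le_iff₀ hn']
    have := sq_sum_le_card_mul_sum_sq (s := Finset.univ) (f := stepMatrix G d ^ m *ᵥ y)
    simp only [Finset.card_univ, Fintype.card_fin, dotProduct, ← sq] at this ⊢
    linarith
  · have h := dotProduct_stepMatrix_pow hd m 1 y
    rw [show 2 * m + 1 = m + 1 + m by ring, h, ← sum_stepMatrix_pow_mulVec hd m y, pow_one]
    exact sq_sum_div_le_sum_stepMatrix hn hd _

lemma sum_returnMatrix_ge (hn : 0 < n) (hd : ∀ v, G.degree v ≤ d) (ℓ : ℕ) (R : Finset (Fin n)) :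
    (R.card : ℝ) ^ 2 / n ≤ ∑ u ∈ R, ∑ v ∈ R, returnMatrix G d ℓ R u v := by
  classical
  have h := sq_sum_div_le_dotProduct_pow hn hd ℓ fun u => if u ∈ R then 1 else 0
  have e : ∑ u ∈ R, ∑ v ∈ R, returnMatrix G d ℓ R u v =
      (fun u => if u ∈ R then (1 : ℝ) else 0) ⬝ᵥ
        stepMatrix G d ^ ℓ *ᵥ fun u => if u ∈ R then 1 else 0 := by
    simp only [dotProduct, Matrix.mulVec, ite_mul, one_mul, zero_mul, mul_ite, mul_one, mul_zero,
      Finset.sum_ite_mem, Finset.univ_inter]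
    refine Finset.sum_congr rfl fun u hu => Finset.sum_congr rfl fun v hv => ?_
    rw [returnMatrix, mul_restr_apply, restr_mul_apply]
    simp [hu, hv]
  rw [e]
  simpa using h

/-- Powers of the return matrix keep much of the mass on `R`. -/
theorem card_mul_pow_le_sum_returnMatrix (hn : 0 < n) (hd : ∀ v, G.degree v ≤ d) (ℓ : ℕ)
    {R : Finset (Fin n)} (hR : R.Nonempty) (j : ℕ) :
    (R.card : ℝ) * (R.card / n) ^ 2 ^ j ≤
      ∑ u ∈ R, ∑ v ∈ R, (returnMatrix G d ℓ R ^ 2 ^ j) u v := by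
  have hR' : (0 : ℝ) < R.card := by exact_mod_cast hR.card_pos
  induction j with
  | zero =>
    refine le_trans (le_of_eq ?_) ((sum_returnMatrix_ge hn hd ℓ R).trans_eq ?_)
    · ring
    · simp
  | succ j ih =>
    set Q := returnMatrix G d ℓ R with hQ
    have hm : 2 ^ j ≠ 0 := by positivity
    -- Doubling the exponent turns the total mass into a sum of squared column sums, which
    -- Cauchy–Schwarz over the `|R|` columns bounds from below.
    have e : ∑ u ∈ R, ∑ v ∈ R, (Q ^ 2 ^ (j + 1)) u v =
        ∑ w ∈ R, (∑ u ∈ R, (Q ^ 2 ^ j) u w) ^ 2 := by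
      have h1 : ∀ u v, (Q ^ 2 ^ (j + 1)) u v = ∑ w ∈ R, (Q ^ 2 ^ j) u w * (Q ^ 2 ^ j) v w := by
        intro u v
        rw [pow_succ, mul_two, pow_add, Matrix.mul_apply]
        symm
        refine (Finset.sum_subset (Finset.subset_univ R) fun w _ hw => ?_).trans
          (Finset.sum_congr rfl fun w _ => ?_)
        · rw [hQ, returnMatrix_pow_eq_zero_right ℓ R hm _ hw, zero_mul]
        · rw [hQ, returnMatrix_pow_symm hd ℓ R _ v w]
      simp only [h1, sq, Finset.sum_mul_sum]
      exact (Finset.sum_congr rfl fun u _ => Finset.sum_comm).trans Finset.sum_comm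
    rw [e]
    have hcs := sq_sum_le_card_mul_sum_sq (s := R) (f := fun w => ∑ u ∈ R, (Q ^ 2 ^ j) u w)
    have ih' := ih.trans_eq Finset.sum_comm
    have h2 : (R.card * (R.card / n : ℝ) ^ 2 ^ j) ^ 2 ≤ (∑ w ∈ R, ∑ u ∈ R, (Q ^ 2 ^ j) u w) ^ 2 := by
      gcongr
    refine le_of_mul_le_mul_left ?_ hR'
    calc (R.card : ℝ) * (R.card * (R.card / n) ^ 2 ^ (j + 1))
        = (R.card * (R.card / n : ℝ) ^ 2 ^ j) ^ 2 := by ring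
      _ ≤ _ := h2.trans hcs

/-- Cauchy–Schwarz twice, from the total mass to row sums and from row sums to row norms, and then
an average over `R`. -/
theorem exists_returnNormSq_ge (hn : 0 < n) (hd : ∀ v, G.degree v ≤ d) (δ : ℝ)
    {R : Finset (Fin n)} (hR : R.Nonempty) (i : ℕ) :
    ∃ s ∈ R, (R.card / n : ℝ) ^ 2 ^ (i + 1) / n ≤ returnNormSq G d δ R i s := by
  have hℓ := baseLength_pos hn δ
  have hn' : (0 : ℝ) < n := by exact_mod_cast hn
  have hR' : (0 : ℝ) < R.card := by exact_mod_cast hR.card_pos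
  have hRn : (R.card : ℝ) ≤ n := by
    have := Finset.card_le_univ R
    rw [Fintype.card_fin] at this
    exact_mod_cast this
  set Q := returnMatrix G d (baseLength n δ) R with hQ
  refine Finset.exists_le_of_sum_le (s := R) hR ?_
  have h1 : ∀ s ∈ R, (∑ v ∈ R, (Q ^ 2 ^ i) s v) ^ 2 ≤ R.card * returnNormSq G d δ R i s := by
    intro s hs
    rw [returnNormSq_eq hd hℓ i hs, ← sum_returnMatrix_pow_sq hd]
    refine sq_sum_le_card_mul_sum_sq.trans ?_
    gcongr
    exact Finset.subset_univ R
  have h2 := card_mul_pow_le_sum_returnMatrix hn hd (baseLength n δ) hR i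
  have h3 := sq_sum_le_card_mul_sum_sq (s := R) (f := fun s => ∑ v ∈ R, (Q ^ 2 ^ i) s v)
  have h4 : (R.card * (R.card / n : ℝ) ^ 2 ^ i) ^ 2 ≤
      R.card * (R.card * ∑ s ∈ R, returnNormSq G d δ R i s) := by
    refine le_trans (by gcongr) (h3.trans ?_)
    gcongr
    rw [Finset.mul_sum]
    exact Finset.sum_le_sum h1
  rw [Finset.sum_const, nsmul_eq_mul]
  have h5 : (R.card / n : ℝ) ^ 2 ^ (i + 1) ≤ ∑ s ∈ R, returnNormSq G d δ R i s := by
    refine le_of_mul_le_mul_left ?_ (show (0 : ℝ) < R.card * R.card by positivity)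
    calc (R.card : ℝ) * R.card * (R.card / n) ^ 2 ^ (i + 1)
        = (R.card * (R.card / n : ℝ) ^ 2 ^ i) ^ 2 := by ring
      _ ≤ _ := h4.trans_eq (by ring)
  refine le_trans ?_ h5
  rw [mul_div_assoc', div_le_iff₀ hn', mul_comm]
  gcongr

end Moments

end MinorFinding

namespace MinorFinding

open scoped ENNReal Matrix

set_option linter.unusedSectionVars false

/-! ### Removing trapped vertices beyond the last phase -/

section Strata

variable {n : ℕ} {G : SimpleGraph (Fin n)} [DecidableRel G.Adj] {d : ℕ} [NeZero d]

lemma mem_trapped {δ : ℝ} {i : ℕ} {S : Finset (Fin n)} {s : Fin n} :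
    s ∈ trapped G d δ i S ↔ s ∈ S ∧ 1 / (n : ℝ) ^ (δ * i) ≤ returnNormSq G d δ S (i + 1) s := by
  simp [trapped]

lemma trapped_subset (δ : ℝ) (i : ℕ) (S : Finset (Fin n)) : trapped G d δ i S ⊆ S :=
  fun _ hs => (mem_trapped.1 hs).1

/-- In phases `1, …, i` nothing is left to do. -/
def IsFree (G : SimpleGraph (Fin n)) [DecidableRel G.Adj] (d : ℕ) [NeZero d] (δ : ℝ) (i : ℕ)
    (S : Finset (Fin n)) : Prop :=
  ∀ j, 1 ≤ j → j ≤ i → ∀ s ∈ S, returnNormSq G d δ S (j + 1) s < 1 / (n : ℝ) ^ (δ * j)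

lemma IsFree.mono (hd : ∀ v, G.degree v ≤ d) (hn : 0 < n) {δ : ℝ} {i : ℕ}
    {S S' : Finset (Fin n)} (h : IsFree G d δ i S) (hS : S' ⊆ S) : IsFree G d δ i S' :=
  fun j hj hji s hs => (returnNormSq_mono hd (baseLength_pos hn δ) hS (j + 1) hs).trans_lt
    (h j hj hji s (hS hs))

lemma IsFree.sdiff_trapped (hd : ∀ v, G.degree v ≤ d) (hn : 0 < n) {δ : ℝ} {i : ℕ}
    {S : Finset (Fin n)} (h : IsFree G d δ i S) :
    IsFree G d δ (i + 1) (S \ trapped G d δ (i + 1) S) := by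
  intro j hj hji s hs
  rcases Nat.lt_or_ge i j with hij | hij
  · obtain rfl : j = i + 1 := by omega
    refine (returnNormSq_mono hd (baseLength_pos hn δ) Finset.sdiff_subset _ hs).trans_lt ?_
    rw [Finset.mem_sdiff, mem_trapped, not_and, not_le] at hs
    exact hs.2 hs.1
  · exact h.mono hd hn Finset.sdiff_subset j hj hij s hs

/-- Successively remove the trapped vertices of the phases after phase `i`. -/
noncomputable def stratum (G : SimpleGraph (Fin n)) [DecidableRel G.Adj] (d : ℕ) [NeZero d] (δ : ℝ)
    (i : ℕ) (S : Finset (Fin n)) : ℕ → Finset (Fin n)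
  | 0 => S
  | j + 1 => stratum G d δ i S j \ trapped G d δ (i + j + 1) (stratum G d δ i S j)

lemma isFree_stratum (hd : ∀ v, G.degree v ≤ d) (hn : 0 < n) {δ : ℝ} {i : ℕ}
    {S : Finset (Fin n)} (h : IsFree G d δ i S) (j : ℕ) :
    IsFree G d δ (i + j) (stratum G d δ i S j) := by
  induction j with
  | zero => exact h
  | succ j ih => exact ih.sdiff_trapped hd hn

lemma card_stratum_add (δ : ℝ) (i : ℕ) (S : Finset (Fin n)) (J : ℕ) :
    (stratum G d δ i S J).card + ∑ j ∈ Finset.range J,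
      (trapped G d δ (i + j + 1) (stratum G d δ i S j)).card = S.card := by
  induction J with
  | zero => simp [stratum]
  | succ J ih =>
    rw [Finset.sum_range_succ, ← ih, stratum,
      ← Finset.card_sdiff_add_card_eq_card (trapped_subset (G := G) (d := d) δ (i + J + 1)
        (stratum G d δ i S J))]
    omega

/-- The norm that density forces on some vertex must stay below the bound of phase `i`. -/
lemma IsFree.pow_card_div_lt (hd : ∀ v, G.degree v ≤ d) (hn : 0 < n) {δ : ℝ} {i : ℕ} (hi : 1 ≤ i)
    {S : Finset (Fin n)} (h : IsFree G d δ i S) (hS : S.Nonempty) :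
    (S.card / n : ℝ) ^ 2 ^ (i + 2) < n / (n : ℝ) ^ (δ * i) := by
  have hn' : (0 : ℝ) < n := by exact_mod_cast hn
  obtain ⟨s, hs, hs'⟩ := exists_returnNormSq_ge hn hd δ hS (i + 1)
  have := hs'.trans_lt (h i hi le_rfl s hs)
  rw [div_lt_iff₀ hn', one_div_mul_eq_div] at this
  exact this

/-- If the last stratum is small, then many vertices are removed in some phase. -/
lemma exists_card_trapped_ge {δ : ℝ} {i : ℕ} {S : Finset (Fin n)} {J : ℕ} {a : ℝ}
    (hJ : 0 < J) (hS : a < S.card) (hlast : ((stratum G d δ i S J).card : ℝ) ≤ a / 2) :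
    ∃ j < J, a / (2 * J) ≤ (trapped G d δ (i + j + 1) (stratum G d δ i S j)).card := by
  have h := card_stratum_add (G := G) (d := d) δ i S J
  have hJ' : (0 : ℝ) < J := by exact_mod_cast hJ
  have h' : ((stratum G d δ i S J).card : ℝ) + ∑ j ∈ Finset.range J,
      ((trapped G d δ (i + j + 1) (stratum G d δ i S j)).card : ℝ) = S.card := by exact_mod_cast h
  obtain ⟨j, hj, hj'⟩ := Finset.exists_le_of_sum_le (s := Finset.range J)
    (f := fun _ => a / (2 * J))
    (g := fun j => ((trapped G d δ (i + j + 1) (stratum G d δ i S j)).card : ℝ))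
    ⟨0, Finset.mem_range.2 hJ⟩ (by
      rw [Finset.sum_const, Finset.card_range, nsmul_eq_mul]
      have : (J : ℝ) * (a / (2 * J)) = a / 2 := by field_simp
      linarith)
  exact ⟨j, Finset.mem_range.1 hj, hj'⟩

end Strata

/-! ### Repetitions -/

/-- If `s` is the success and `f = 1 - s` the failure probability of one run, then `f^K (1 + s)^K ≤
1`, while `(1 + s)^K ≥ 1 + K s ≥ 3` by Bernoulli. -/
lemma two_thirds_le_firstOutput_replicate {β : Type} (p : PMF (Option β)) (K : ℕ) {q : ℝ}
    (hq : ENNReal.ofReal q ≤ expect p ({o | o.isSome}.indicator 1)) (hqK : 2 ≤ q * K) :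
    2 / 3 ≤ ((firstOutput (List.replicate K p)).toOuterMeasure {o | o.isSome}).toReal := by
  have key : ∀ p : PMF (Option β), (expect p ({o | o.isNone}.indicator 1)).toReal +
      (expect p ({o | o.isSome}.indicator 1)).toReal = 1 := fun p => by
    have h := expect_isNone_add_isSome p
    have h1 : expect p ({o | o.isNone}.indicator 1) ≠ ⊤ :=
      ne_top_of_le_ne_top ENNReal.one_ne_top (h ▸ le_self_add)
    have h2 : expect p ({o | o.isSome}.indicator 1) ≠ ⊤ :=
      ne_top_of_le_ne_top ENNReal.one_ne_top (h ▸ le_add_self)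
    rw [← ENNReal.toReal_add h1 h2, h, ENNReal.toReal_one]
  have h1 := key p
  have h2 := key (firstOutput (List.replicate K p))
  rw [expect_firstOutput_isNone, List.map_replicate, List.prod_replicate, ENNReal.toReal_pow] at h2
  rw [toOuterMeasure_eq_expect]
  set f := (expect p ({o | o.isNone}.indicator 1)).toReal with hf
  set s := (expect p ({o | o.isSome}.indicator 1)).toReal with hs
  have hf0 : 0 ≤ f := ENNReal.toReal_nonneg
  have hs0 : 0 ≤ s := ENNReal.toReal_nonneg
  have hqs : q ≤ s := by
    have htop : expect p ({o | o.isSome}.indicator 1) ≠ ⊤ :=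
      ne_top_of_le_ne_top ENNReal.one_ne_top (expect_isNone_add_isSome p ▸ le_add_self)
    exact (ENNReal.ofReal_le_iff_le_toReal htop).1 hq
  have h3 : 1 + K * s ≤ (1 + s) ^ K := one_add_mul_le_pow (by linarith) K
  have h4 : f ^ K * (1 + s) ^ K ≤ 1 := by
    rw [← mul_pow]
    exact pow_le_one₀ (by positivity) (by nlinarith)
  have h5 : f ^ K * 3 ≤ 1 := by
    refine le_trans ?_ h4
    gcongr
    have : q * K ≤ s * K := by gcongr
    linarith
  linarith

/-! ### From one iteration to FindMinor -/

section FindMinor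

variable {n r : ℕ} [NeZero n] {G : SimpleGraph (Fin n)} [DecidableRel G.Adj] {d : ℕ} [NeZero d]

/-- `FindMinor` succeeds if an iteration of `FindBiclique` does so for many starting vertices. -/
theorem two_thirds_le_findMinorSuccess (H : SimpleGraph (Fin r)) {δ ε : ℝ}
    (hε : cutoff n δ < ε) {i : ℕ} (hi : 5 * r ^ 4 ≤ i) (hi' : i ≤ ⌈1 / δ⌉₊ + 4)
    (T : Finset (Fin n)) {q : ℝ} (hq : 0 ≤ q)
    (hT : ∀ s ∈ T, ENNReal.ofReal q ≤
      expect (findBicliqueIter G d H δ s i) ({o | o.isSome}.indicator 1))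
    (hmany : 2 ≤ T.card / n * q * ((ε ^ 2)⁻¹ * (n : ℝ) ^ (35 * δ * r ^ 4))) :
    2 / 3 ≤ findMinorSuccess G d H δ ε := by
  have hn : (0 : ℝ) < n := by exact_mod_cast Nat.pos_of_ne_zero (NeZero.ne n)
  rw [findMinorSuccess, findMinor, if_neg (not_lt.2 hε.le)]
  refine two_thirds_le_firstOutput_replicate _ _ (q := T.card / n * q) ?_
    (hmany.trans (by gcongr; exact Nat.le_ceil _))
  have h1 : ∀ s, expect (findBicliqueIter G d H δ s i) ({o | o.isSome}.indicator 1) ≤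
      expect (firstOutput [localSearch G d H δ ε s, findBiclique G d H δ s])
        ({o | o.isSome}.indicator 1) := fun s => by
    refine le_trans ?_ (expect_isSome_le_firstOutput (p := findBiclique G d H δ s) (by simp))
    rw [findBiclique]
    exact expect_isSome_le_firstOutput (List.mem_map_of_mem (List.Ico.mem.2 ⟨hi, by omega⟩))
  rw [expect_bind, expect_fintype]
  calc ENNReal.ofReal (T.card / n * q) = ∑ s ∈ T, (n : ℝ≥0∞)⁻¹ * ENNReal.ofReal q := by
        rw [Finset.sum_const, nsmul_eq_mul, ENNReal.ofReal_mul (by positivity),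
          ENNReal.ofReal_div_of_pos hn, ENNReal.ofReal_natCast, ENNReal.ofReal_natCast,
          div_eq_mul_inv, mul_assoc]
    _ ≤ ∑ s ∈ T, (PMF.uniformOfFintype (Fin n)) s *
          expect (firstOutput [localSearch G d H δ ε s, findBiclique G d H δ s])
            ({o | o.isSome}.indicator 1) := by
        gcongr with s hs
        · rw [PMF.uniformOfFintype_apply, Fintype.card_fin]
        · exact (hT s hs).trans (h1 s)
    _ ≤ _ := Finset.sum_le_sum_of_subset (Finset.subset_univ T)

end FindMinor

end MinorFinding

namespace MinorFinding

open scoped ENNReal Matrix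

set_option linter.unusedSectionVars false

/-! ### The final current set is small -/

lemma rpow_mul_nat (n : ℕ) (δ : ℝ) (j : ℕ) : (n : ℝ) ^ (δ * j) = ((n : ℝ) ^ δ) ^ j :=
  Real.rpow_mul_natCast (Nat.cast_nonneg n) δ j

/-- Where the shape of the cutoff matters: even the power `2 ^ (⌈1/δ⌉ + 6)` of `ε` loses only a
factor `n^δ`. -/
lemma inv_le_cutoff_pow {n : ℕ} (hn : 0 < n) {δ : ℝ} (hδ : 0 < δ) {K : ℕ}
    (hK : (K : ℝ) ≤ Real.exp (2 / δ)) : ((n : ℝ) ^ δ)⁻¹ ≤ cutoff n δ ^ K := by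
  have hn1 : (1 : ℝ) ≤ n := by exact_mod_cast hn
  rw [cutoff, ← Real.rpow_mul_natCast (by positivity), ← Real.rpow_neg (by positivity)]
  refine Real.rpow_le_rpow_of_exponent_le hn1 ?_
  rw [neg_div, neg_mul, neg_le_neg_iff, div_mul_eq_mul_div, div_le_iff₀ (Real.exp_pos _)]
  gcongr

variable {n r : ℕ} [NeZero n] {G : SimpleGraph (Fin n)} [DecidableRel G.Adj] {d : ℕ} [NeZero d]

/-- If `FindMinor` is likely to fail, few vertices are left after the phases of `Decompose`. -/
theorem card_le_of_isFree (hr : 3 ≤ r) (H : SimpleGraph (Fin r)) (hd : ∀ v, G.degree v ≤ d)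
    {δ ε : ℝ} (hδ : 0 < δ) (hI : 5 * r ^ 4 < ⌈1 / δ⌉₊ + 4)
    (hexp : ((2 ^ (⌈1 / δ⌉₊ + 6) : ℕ) : ℝ) ≤ Real.exp (2 / δ))
    (hx₁ : 4 ^ r ^ 4 * (64 * ((r ^ 4 : ℕ) : ℝ) ^ 2 * 4 ^ (⌈1 / δ⌉₊ + 6) + 1) ≤ (n : ℝ) ^ δ)
    (hx₂ : 20 ^ 2 ^ (⌈1 / δ⌉₊ + 6) ≤ (n : ℝ) ^ δ) (hx₃ : 400 * ((⌈1 / δ⌉₊ + 4 : ℕ) : ℝ) ≤ (n : ℝ) ^ δ)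
    (hε : cutoff n δ < ε) (hfail : findMinorSuccess G d H δ ε < 2 / 3) {S : Finset (Fin n)}
    (hS : IsFree G d δ (5 * r ^ 4) S) : (S.card : ℝ) ≤ ε * n / 10 := by
  by_contra! hlarge
  have hnpos : 0 < n := Nat.pos_of_ne_zero (NeZero.ne n)
  have hn : (0 : ℝ) < n := by exact_mod_cast hnpos
  have hn1 : (1 : ℝ) ≤ n := by exact_mod_cast hnpos
  have hc0 : 0 < cutoff n δ := Real.rpow_pos_of_pos hn _
  have hε0 : 0 < ε := hc0.trans hε
  have hSn : (S.card : ℝ) ≤ n := by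
    have := Finset.card_le_univ S
    rw [Fintype.card_fin] at this
    exact_mod_cast this
  have hε10 : ε < 10 := by nlinarith
  set x := (n : ℝ) ^ δ with hx
  set I := ⌈1 / δ⌉₊ + 4 with hIdef
  set M := 5 * r ^ 4 with hM
  have hr4 : r ^ 4 = r ^ 2 * r ^ 2 := by ring
  have hr1 : 1 ≤ r ^ 4 := Nat.one_le_pow _ _ (by omega)
  have hpow : ∀ j : ℕ, 1 / (n : ℝ) ^ (δ * j) = (x ^ j)⁻¹ := fun j => by
    rw [rpow_mul_nat, one_div]
  have hx1 : 1 ≤ x := Real.one_le_rpow hn1 hδ.le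
  have hx0 : 0 < x := by linarith
  -- The removal is continued through the phases `M + 1, …, M + J + 1 = I`.
  obtain ⟨J, hJ⟩ := Nat.exists_eq_add_of_lt hI
  -- Otherwise some return norm is at least `(ε/20)^K / n ≥ x^{-2} / n`, one factor `x^{-1}` for
  -- `ε^K` and one for `20^{-K}`. But being free in phase `I ≥ 1/δ + 4` bounds all of them by
  -- `x^{-4} / n`.
  have hlast : ((stratum G d δ M S (J + 1)).card : ℝ) ≤ ε * n / 10 / 2 := by
    by_contra! hlast
    have hne : (stratum G d δ M S (J + 1)).Nonempty := by
      rw [← Finset.card_pos]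
      have : (0 : ℝ) < ε * n / 10 / 2 := by positivity
      exact_mod_cast this.trans hlast
    have hfree := isFree_stratum hd hnpos hS (J + 1)
    rw [show M + (J + 1) = I by omega] at hfree
    have h := hfree.pow_card_div_lt hd hnpos (by omega) hne
    set K := 2 ^ (I + 2) with hK
    have h1 : (ε / 20) ^ K ≤ ((stratum G d δ M S (J + 1)).card / n : ℝ) ^ K := by
      refine pow_le_pow_left₀ (by positivity) ?_ K
      rw [le_div_iff₀ hn]
      linarith
    have h2 : x⁻¹ ≤ ε ^ K := (inv_le_cutoff_pow hnpos hδ hexp).trans (by gcongr)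
    have h3 : (n : ℝ) * x ^ 4 ≤ n ^ (δ * I) := by
      have e : (n : ℝ) * x ^ 4 = n ^ (1 + δ * 4) := by
        rw [Real.rpow_add hn, Real.rpow_one]
        have := rpow_mul_nat n δ 4
        rw [hx, ← this]; norm_num
      rw [e]
      refine Real.rpow_le_rpow_of_exponent_le hn1 ?_
      have hceil : 1 / δ ≤ ⌈1 / δ⌉₊ := Nat.le_ceil _
      rw [div_le_iff₀ hδ] at hceil
      rw [hIdef]; push_cast; linarith
    have h4 : (n : ℝ) / n ^ (δ * I) ≤ (x ^ 4)⁻¹ := by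
      rw [div_le_iff₀ (by positivity), ← div_eq_inv_mul, le_div_iff₀ (by positivity)]
      exact h3
    have h5 : x⁻¹ * x⁻¹ ≤ (ε / 20) ^ K := by
      rw [div_pow, div_eq_mul_inv]
      gcongr
    have h6 : x⁻¹ * x⁻¹ < (x ^ 4)⁻¹ := h5.trans_lt (h1.trans_lt (h.trans_le h4))
    have h7 : (x ^ 4)⁻¹ ≤ x⁻¹ * x⁻¹ := by
      rw [← mul_inv, ← sq]
      gcongr
      norm_num
    exact absurd h6 (not_lt.2 h7)
  obtain ⟨j, hj, hcard⟩ := exists_card_trapped_ge (G := G) (d := d) (Nat.succ_pos J) hlarge hlast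
  set R := stratum G d δ M S j with hR
  have hfree := isFree_stratum hd hnpos hS j
  -- `R` is free up to phase `m + 1`, and phase `m + 2` removes many of its vertices; from these,
  -- iteration `m + 2` of FindBiclique succeeds.
  obtain ⟨m, hm⟩ : ∃ m, M + j = m + 1 := ⟨M + j - 1, by omega⟩
  rw [hm] at hfree
  have hsucc : ∀ s ∈ trapped G d δ (M + j + 1) R, ENNReal.ofReal (x ^ (3 * (r ^ 2 * r ^ 2)))⁻¹ ≤
      expect (findBicliqueIter G d H δ s (m + 2)) ({o | o.isSome}.indicator 1) := by
    intro s hs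
    rw [hm, mem_trapped, hpow] at hs
    refine le_expect_findBicliqueIter_of_returnNormSq hr H hnpos hd hs.1 (by omega) hx ?_ ?_ ?_ hs.2
    · rw [← hr4]
      have h4 : (4 : ℝ) ^ (m + 4) ≤ 4 ^ (⌈1 / δ⌉₊ + 6) :=
        pow_le_pow_right₀ (by norm_num) (by omega)
      have h5 := mul_le_mul_of_nonneg_left h4
        (show 0 ≤ 64 * ((r ^ 4 : ℕ) : ℝ) ^ 2 by positivity)
      exact (mul_le_mul_of_nonneg_left (by linarith) (by positivity)).trans hx₁
    · intro u hu
      rw [← hpow]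
      exact (hfree m (by omega) (by omega) u hu).le
    · intro u hu
      rw [← hpow]
      exact (hfree (m + 1) (by omega) le_rfl u hu).le
  refine absurd hfail (not_lt.2 (two_thirds_le_findMinorSuccess H hε (by omega) (by omega) _
    (by positivity) hsucc ?_))
  have hJI : ((J + 1 : ℕ) : ℝ) ≤ I := by exact_mod_cast (by omega : J + 1 ≤ I)
  have hJ0 : (0 : ℝ) < (J + 1 : ℕ) := by positivity
  have e35 : (n : ℝ) ^ (35 * δ * r ^ 4) = x ^ (35 * (r ^ 2 * r ^ 2)) := by
    rw [hx, ← rpow_mul_nat]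
    congr 1; push_cast; ring
  rw [e35]
  have hx32 : x ≤ x ^ (32 * (r ^ 2 * r ^ 2)) := le_self_pow₀ hx1 (by positivity)
  -- Of `x^(35 r^4)` repetitions, `x^(3 r^4)` pay for one success. The start vertices have density
  -- at least `ε / (20 (J + 1))`, which uses one factor of `ε⁻²`; the other exceeds `1/10`. A single
  -- `x` covers the constants.
  calc (2 : ℝ) ≤ x / (200 * (J + 1 : ℕ)) := by
        rw [le_div_iff₀ (by positivity)]
        linarith
    _ ≤ x ^ (32 * (r ^ 2 * r ^ 2)) / (20 * (J + 1 : ℕ) * ε) := by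
        apply div_le_div₀ (by positivity) hx32 (by positivity)
        nlinarith
    _ = ε * n / 10 / (2 * (J + 1 : ℕ)) / n * (x ^ (3 * (r ^ 2 * r ^ 2)))⁻¹ *
          ((ε ^ 2)⁻¹ * x ^ (35 * (r ^ 2 * r ^ 2))) := by
        rw [show 35 * (r ^ 2 * r ^ 2) = 32 * (r ^ 2 * r ^ 2) + 3 * (r ^ 2 * r ^ 2) by ring, pow_add]
        field_simp
        norm_num
    _ ≤ _ := by gcongr

end MinorFinding

namespace MinorFinding

open scoped ENNReal Matrix

set_option linter.unusedSectionVars false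

variable {n : ℕ} {G : SimpleGraph (Fin n)} [DecidableRel G.Adj] {d : ℕ} [NeZero d]

/-! ### The parameters of a piece -/

lemma returnNormSq_le_one (hd : ∀ v, G.degree v ≤ d) (hn : 0 < n) (δ : ℝ) {S : Finset (Fin n)}
    (i : ℕ) {s : Fin n} (hs : s ∈ S) : returnNormSq G d δ S i s ≤ 1 := by
  rw [returnNormSq_eq hd (baseLength_pos hn δ) i hs]
  have h := (returnMatrix_doublySub (d := d) hd (baseLength n δ) S).pow (2 * 2 ^ i)
  exact (Finset.single_le_sum (fun v _ => h.nonneg s v) (Finset.mem_univ s)).trans (h.row s)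

/-- For `i = 0` there is no earlier phase, and the trivial bound `1` takes over. -/
lemma IsFree.returnNormSq_le (hd : ∀ v, G.degree v ≤ d) (hn : 0 < n) {δ : ℝ} {i : ℕ}
    {S : Finset (Fin n)} (h : IsFree G d δ i S) {s : Fin n} (hs : s ∈ S) :
    returnNormSq G d δ S (i + 1) s ≤ (((n : ℝ) ^ δ) ^ i)⁻¹ := by
  rcases Nat.eq_zero_or_pos i with rfl | hi
  · simpa using returnNormSq_le_one hd hn δ _ hs
  · rw [← rpow_mul_nat, ← one_div]
    exact (h i hi le_rfl s hs).le

/-- As long as many vertices are trapped, one of them has a piece. -/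
theorem exists_isPiece_of_trapped (hn : 0 < n) (hd : ∀ v, G.degree v ≤ d) {δ α : ℝ} (hδ : 0 < δ)
    {i M : ℕ} (hi : i < M) {S : Finset (Fin n)} (hfree : IsFree G d δ i S) (hα : 0 < α)
    (hα' : ((n : ℝ) ^ δ)⁻¹ ≤ α) (hbig : α * n ≤ (trapped G d δ (i + 1) S).card)
    (hx : 16 < (n : ℝ) ^ δ)
    (hexp : Real.exp (-((n : ℝ) ^ (δ / 2) / 2)) ≤ (((n : ℝ) ^ δ) ^ (M + 6))⁻¹) :
    ∃ s ∈ trapped G d δ (i + 1) S, ∃ P, IsPiece G d δ α (i + 1) S s P := by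
  have hn' : (0 : ℝ) < n := by exact_mod_cast hn
  have hn1 : (1 : ℝ) ≤ n := by exact_mod_cast hn
  have hα1 : α ≤ 1 := by
    have h1 : ((trapped G d δ (i + 1) S).card : ℝ) ≤ n := by
      have := Finset.card_le_univ (trapped G d δ (i + 1) S)
      rw [Fintype.card_fin] at this
      exact_mod_cast this
    exact le_of_mul_le_mul_right (by linarith) hn'
  set x := (n : ℝ) ^ δ with hxdef
  have hx0 : 0 < x := by linarith
  have hx1 : 1 ≤ x := by linarith
  -- `⌈x⌉` visits suffice for mixing at rate `φ² = x^{-1/2}`, yet are few compared with `ℓ ≥ x^5`: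
  -- the bad mass is at most `2 x^{-3}`.
  obtain ⟨k, hk⟩ : ∃ k, ⌈x⌉₊ = k + 1 := ⟨⌈x⌉₊ - 1, by have := Nat.ceil_pos.2 hx0; omega⟩
  have hk1 : x ≤ (k + 1 : ℕ) := hk ▸ Nat.le_ceil x
  have hk2 : ((k + 1 : ℕ) : ℝ) ≤ 2 * x := by
    rw [← hk]
    have := (Nat.ceil_lt_add_one hx0.le).le
    linarith
  have hx5 : (n : ℝ) ^ (5 * δ) = x ^ 5 := by
    rw [mul_comm, hxdef, ← rpow_mul_nat]; norm_num
  have hx51 : 1 ≤ x ^ 5 := one_le_pow₀ hx1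
  have hℓ1 : x ^ 5 ≤ (baseLength n δ : ℝ) := hx5 ▸ Nat.le_ceil _
  have hℓ2 : (baseLength n δ : ℝ) ≤ 2 * x ^ 5 := by
    have := (Nat.ceil_lt_add_one (show (0 : ℝ) ≤ (n : ℝ) ^ (5 * δ) by positivity)).le
    rw [hx5] at this
    rw [baseLength, hx5]
    linarith
  have hkℓ : ((k + 1 : ℕ) * baseLength n δ : ℝ) ≤ 4 * x ^ 6 := by
    calc ((k + 1 : ℕ) * baseLength n δ : ℝ) ≤ (2 * x) * (2 * x ^ 5) := by gcongr
      _ = _ := by ring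
  have hx61 : 1 ≤ x ^ 6 := one_le_pow₀ hx1
  have hpow : ∀ j : ℕ, (n : ℝ) ^ (δ * j) = x ^ j := fun j => rpow_mul_nat n δ j
  -- `B` comes from the earlier phases and `Γ` from being trapped. The choice of `θ` makes `ℓ θ ≤ 2
  -- x^{-(i+2)}`, a factor `x` below `Γ` up to a constant.
  refine exists_isPiece hn hd (B := (x ^ i)⁻¹) (Γ := (x ^ (i + 1))⁻¹) (k := k)
    (θ := (x ^ (i + 7))⁻¹) (trapped_subset δ (i + 1) S) hα hbig
    (fun w hw => hfree.returnNormSq_le hd hn hw) (by positivity) (fun s hs => ?_) hδ.le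
    (by positivity) ?_ ?_ ?_
  · rw [mem_trapped, hpow, one_div] at hs
    exact hs.2
  · rw [show δ * (((i + 1 : ℕ) : ℝ) + 7) = δ * (i + 8 : ℕ) by push_cast; ring, hpow]
    refine hkℓ.trans ?_
    rw [le_div_iff₀ hα]
    have : x ^ 6 ≤ x ^ (i + 8) := pow_le_pow_right₀ hx1 (by omega)
    nlinarith
  · rw [show δ * (2 * ((i + 1 : ℕ) : ℝ) + 14) = δ * (2 * i + 16 : ℕ) by push_cast; ring, hpow,
      div_le_div_iff₀ (by positivity) (by positivity)]
    have h5 : ((k + 1 : ℕ) * baseLength n δ + 1 : ℝ) ≤ 5 * x ^ 6 := by linarith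
    calc α * ((k + 1 : ℕ) * baseLength n δ + 1 : ℝ) ≤ 1 * (5 * x ^ 6) := by gcongr
      _ ≤ x ^ (i + 3) * x ^ 6 := by
          rw [one_mul]
          gcongr
          exact le_trans (by linarith) (le_self_pow₀ hx1 (by omega))
      _ = (x ^ (i + 7))⁻¹ * x ^ (2 * i + 16) := by
          rw [← div_eq_inv_mul, eq_div_iff (by positivity), ← pow_add, ← pow_add]
          congr 1; omega
  · set c := (n : ℝ) ^ (-δ / 4) with hc
    have hc2 : c ^ 2 = ((n : ℝ) ^ (δ / 2))⁻¹ := by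
      rw [hc, ← Real.rpow_mul_natCast hn'.le, ← Real.rpow_neg hn'.le]
      congr 1; push_cast; ring
    have hsq : (n : ℝ) ^ (δ / 2) * (n : ℝ) ^ (δ / 2) = x := by
      rw [← Real.rpow_add hn', add_halves]
    set y := (n : ℝ) ^ (δ / 2) with hy
    have hy1 : 1 ≤ y := Real.one_le_rpow hn1 (by positivity)
    -- The exponent `(k + 1) φ² / 2` is at least `x^{1/2} / 2`, so the decay beats any fixed power
    -- of `x`.
    have hdecay : (1 - c ^ 2 / 2) ^ (k + 1) ≤ (x ^ (M + 6))⁻¹ := by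
      rw [hc2]
      have hyinv : y⁻¹ ≤ 1 := inv_le_one_of_one_le₀ hy1
      refine le_trans ?_ hexp
      calc (1 - y⁻¹ / 2) ^ (k + 1) ≤ Real.exp (-(y⁻¹ / 2)) ^ (k + 1) := by
            refine pow_le_pow_left₀ (by linarith) ?_ _
            exact Real.one_sub_le_exp_neg _
        _ = Real.exp (-((k + 1 : ℕ) * (y⁻¹ / 2))) := by rw [← Real.exp_nat_mul]; congr 1; ring
        _ ≤ _ := by
            rw [Real.exp_le_exp, neg_le_neg_iff]
            calc y / 2 = x * (y⁻¹ / 2) := by rw [← hsq]; field_simp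
              _ ≤ _ := by gcongr
    have hdecay' : (x ^ (M + 6))⁻¹ ≤ (x ^ (i + 7))⁻¹ := by
      gcongr ?_⁻¹
      exact pow_le_pow_right₀ hx1 (by omega)
    have hfirst : 2 * (baseLength n δ * ((1 - c ^ 2 / 2) ^ (k + 1) + (x ^ (i + 7))⁻¹)) ≤
        8 * (x ^ (i + 2))⁻¹ := by
      have h2 := hdecay.trans hdecay'
      calc _ ≤ 2 * ((baseLength n δ : ℝ) * ((x ^ (i + 7))⁻¹ + (x ^ (i + 7))⁻¹)) := by gcongr
        _ ≤ 2 * ((2 * x ^ 5) * ((x ^ (i + 7))⁻¹ + (x ^ (i + 7))⁻¹)) := by gcongr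
        _ = _ := by
            have : x ^ i ≠ 0 := by positivity
            simp only [pow_add]
            field_simp
            norm_num
    have hsecond : 2 * (((k + 1 : ℕ) / (α * baseLength n δ)) ^ 2 * (x ^ i)⁻¹) ≤
        8 * (x ^ (i + 2))⁻¹ := by
      calc _ ≤ 2 * (((2 * x) / (x⁻¹ * x ^ 5)) ^ 2 * (x ^ i)⁻¹) := by gcongr
        _ = 8 * (x ^ (i + 6))⁻¹ * x ^ 2 * (x ^ 2)⁻¹ := by
            have : x ^ i ≠ 0 := by positivity
            simp only [pow_add]
            field_simp
            norm_num
        _ ≤ 8 * (x ^ (i + 2))⁻¹ := by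
            rw [mul_assoc, mul_inv_cancel₀ (by positivity), mul_one]
            gcongr
            norm_num
    push_cast at hsecond
    calc _ ≤ 8 * (x ^ (i + 2))⁻¹ + 8 * (x ^ (i + 2))⁻¹ := add_le_add hfirst hsecond
      _ = 16 * (x ^ (i + 2))⁻¹ := by ring
      _ < x * (x ^ (i + 2))⁻¹ := by gcongr
      _ = _ := by
          have : x ^ i ≠ 0 := by positivity
          simp only [pow_add]
          field_simp

end MinorFinding

namespace MinorFinding

set_option linter.unusedSectionVars false

/-! ### Invariant, progress and termination of Decompose -/

section Decompose

variable {n r : ℕ} {G : SimpleGraph (Fin n)} [DecidableRel G.Adj] {d : ℕ} [NeZero d] {δ ε : ℝ}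

/-- The edges that leave a piece towards another piece or the current set. -/
def leavingEdges (G : SimpleGraph (Fin n)) (st : DecomposeState n) : Set (Sym2 (Fin n)) :=
  {e | e ∈ G.edgeSet ∧ ∃ p ∈ st.pieces, ∃ u ∈ p.2, ∃ v,
    (v ∈ st.S ∨ ∃ p' ∈ st.pieces, p.2 ≠ p'.2 ∧ v ∈ p'.2) ∧ e = s(u, v)}

lemma crossEdges_subset_leavingEdges (st : DecomposeState n) :
    crossEdges G st.pieces ⊆ leavingEdges G st := by
  rintro e ⟨he, p, hp, p', hp', hne, u, hu, v, hv, rfl⟩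
  exact ⟨he, p, hp, u, hu, v, Or.inr ⟨p', hp', hne, hv⟩, rfl⟩

/-- Only the edges from `P` to the rest of `S` are new: those between `P` and an older piece already
counted as leaving towards `S`. -/
lemma leavingEdges_carve (i : ℕ) (L : List (Fin n × Finset (Fin n))) (X S : Finset (Fin n))
    (s : Fin n) {P : Finset (Fin n)} (hP : P ⊆ S) :
    leavingEdges G ⟨i, (s, P) :: L, X, S \ P⟩ ⊆ leavingEdges G ⟨i, L, X, S⟩ ∪
      (fun q : Fin n × Fin n => s(q.1, q.2)) '' (G.interedges P (S \ P) : Set (Fin n × Fin n)) := by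
  rintro e ⟨he, p, hp, u, hu, v, hv, rfl⟩
  rw [List.mem_cons] at hp
  rcases hp with rfl | hp
  · rcases hv with hv | ⟨p', hp', hne, hv⟩
    · refine Or.inr ⟨(u, v), ?_, rfl⟩
      rw [Finset.mem_coe, SimpleGraph.mem_interedges_iff]
      exact ⟨hu, hv, he⟩
    · rw [List.mem_cons] at hp'
      rcases hp' with rfl | hp'
      · exact absurd rfl hne
      · exact Or.inl ⟨he, p', hp', v, hv, u, Or.inl (hP hu), Sym2.eq_swap⟩
  · refine Or.inl ⟨he, p, hp, u, hu, v, ?_, rfl⟩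
    rcases hv with hv | ⟨p', hp', hne, hv⟩
    · exact Or.inl (Finset.sdiff_subset hv)
    · rw [List.mem_cons] at hp'
      rcases hp' with rfl | hp'
      · exact Or.inl (hP hv)
      · exact Or.inr ⟨p', hp', hne, hv⟩

/-- What holds throughout every run of `Decompose`. -/
structure DecomposeInvariant (G : SimpleGraph (Fin n)) [DecidableRel G.Adj] (d : ℕ) [NeZero d]
    (r : ℕ) (δ ε : ℝ) (st : DecomposeState n) : Prop where
  one_le : 1 ≤ st.phase
  le : st.phase ≤ 5 * r ^ 4 + 1
  isPartition : st.IsPartition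
  isFree : IsFree G d δ (st.phase - 1) st.S
  card_X : (st.X.card : ℝ) ≤ (st.phase - 1) * (alpha n r ε * n)
  pieces : ∀ p ∈ st.pieces, ∃ i ≤ 5 * r ^ 4, ∃ S, IsPiece G d δ (alpha n r ε) i S p.1 p.2
  card_le : (st.pieces.map fun p => p.2.card).sum + st.S.card ≤ n
  leaving : ((leavingEdges G st).ncard : ℝ) ≤
    2 * (n : ℝ) ^ (-δ / 4) * d * ((st.pieces.map fun p => p.2.card).sum : ℕ)

lemma decomposeInvariant_init : DecomposeInvariant G d r δ ε (DecomposeState.init n) where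
  one_le := le_rfl
  le := by simp [DecomposeState.init]
  isPartition := by simp [DecomposeState.init, DecomposeState.IsPartition]
  isFree := fun j hj hj' => by
    have : j ≤ 0 := hj'
    omega
  card_X := by simp [DecomposeState.init]
  pieces := by simp [DecomposeState.init]
  card_le := by simp [DecomposeState.init]
  leaving := by
    have : leavingEdges G (DecomposeState.init n) = ∅ := by
      ext e; simp [leavingEdges, DecomposeState.init]
    rw [this]
    simp [DecomposeState.init]

/-- Carving adds `|P|` to the total piece size and the sparse cut of `P` to the leaving edges.
Advancing makes the new `S` free in one more phase and adds fewer than `αn` vertices to `X`. -/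
lemma DecomposeInvariant.step (hd : ∀ v, G.degree v ≤ d) (hn : 0 < n) {st st' : DecomposeState n}
    (h : DecomposeInvariant G d r δ ε st) (hstep : DecomposeStep G d r δ ε st st') :
    DecomposeInvariant G d r δ ε st' := by
  classical
  obtain ⟨h1, h2, ⟨hp1, hp2, hp3, hp4⟩, h4, h5, h6, h7, h8⟩ := h
  cases hstep with
  | carve i L X S s P hi hbig hs hP =>
    dsimp only at *
    obtain ⟨hPne, hPS, hPedges, hPreach⟩ := hP
    have hcard : (S \ P).card + P.card = S.card := Finset.card_sdiff_add_card_eq_card hPS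
    refine ⟨h1, h2, ⟨?_, ?_, ?_, ?_⟩, h4.mono hd hn Finset.sdiff_subset, h5, ?_, ?_, ?_⟩
    · dsimp only
      rw [List.pairwise_cons]
      exact ⟨fun p hp => ((hp2 p hp).2.2.mono_right hPS).symm, hp1⟩
    · intro p hp
      rcases List.mem_cons.1 hp with rfl | hp
      · exact ⟨hPne, hp3.symm.mono_left hPS, Finset.disjoint_sdiff⟩
      · exact ⟨(hp2 p hp).1, (hp2 p hp).2.1, (hp2 p hp).2.2.mono_right Finset.sdiff_subset⟩
    · exact hp3.mono_right Finset.sdiff_subset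
    · intro v
      by_cases hv : v ∈ P
      · exact Or.inr (Or.inr ⟨(s, P), List.mem_cons_self, hv⟩)
      · rcases hp4 v with h | h | ⟨p, hp, h⟩
        · exact Or.inl h
        · exact Or.inr (Or.inl (Finset.mem_sdiff.2 ⟨h, hv⟩))
        · exact Or.inr (Or.inr ⟨p, List.mem_cons_of_mem _ hp, h⟩)
    · intro p hp
      rcases List.mem_cons.1 hp with rfl | hp
      · exact ⟨i, hi, S, hPne, hPS, hPedges, hPreach⟩
      · exact h6 p hp
    · dsimp only
      rw [List.map_cons, List.sum_cons]
      dsimp only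
      omega
    · dsimp only
      have hle := Set.ncard_le_ncard (leavingEdges_carve (G := G) i L X S s hPS) (Set.toFinite _)
      have hunion := Set.ncard_union_le (leavingEdges G ⟨i, L, X, S⟩)
        ((fun q : Fin n × Fin n => s(q.1, q.2)) '' (G.interedges P (S \ P) : Set (Fin n × Fin n)))
      have himage := Set.ncard_image_le (f := fun q : Fin n × Fin n => s(q.1, q.2))
        (Set.toFinite (G.interedges P (S \ P) : Set (Fin n × Fin n)))
      rw [Set.ncard_coe_finset] at himage
      have hall : ((leavingEdges G ⟨i, (s, P) :: L, X, S \ P⟩).ncard : ℝ) ≤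
          (leavingEdges G ⟨i, L, X, S⟩).ncard + (G.interedges P (S \ P)).card := by
        exact_mod_cast hle.trans (hunion.trans (by omega))
      rw [List.map_cons, List.sum_cons]
      push_cast at h8 ⊢
      linarith
  | advance i L X S hi hsmall =>
    dsimp only at *
    have hsub := trapped_subset (G := G) (d := d) δ i S
    refine ⟨Nat.le_add_left _ _, Nat.succ_le_succ hi, ⟨hp1, ?_, ?_, ?_⟩, ?_, ?_, h6, ?_, ?_⟩
    · intro p hp
      obtain ⟨ha, hb, hc⟩ := hp2 p hp
      exact ⟨ha, Finset.disjoint_union_right.2 ⟨hb, hc.mono_right hsub⟩,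
        hc.mono_right Finset.sdiff_subset⟩
    · exact Finset.disjoint_union_left.2 ⟨hp3.mono_right Finset.sdiff_subset,
        Finset.disjoint_sdiff⟩
    · intro v
      rcases hp4 v with h | h | h
      · exact Or.inl (Finset.mem_union_left _ h)
      · by_cases hv : v ∈ trapped G d δ i S
        · exact Or.inl (Finset.mem_union_right _ hv)
        · exact Or.inr (Or.inl (Finset.mem_sdiff.2 ⟨h, hv⟩))
      · exact Or.inr (Or.inr h)
    · obtain ⟨j, rfl⟩ : ∃ j, i = j + 1 := ⟨i - 1, by omega⟩
      exact h4.sdiff_trapped hd hn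
    · have hX : ((X ∪ trapped G d δ i S).card : ℝ) ≤ X.card + (trapped G d δ i S).card := by
        exact_mod_cast Finset.card_union_le _ _
      dsimp only
      push_cast
      linarith
    · exact (Nat.add_le_add_left (Finset.card_le_card Finset.sdiff_subset) _).trans h7
    · refine le_trans ?_ h8
      have : leavingEdges G ⟨i + 1, L, X ∪ trapped G d δ i S, S \ trapped G d δ i S⟩ ⊆
          leavingEdges G ⟨i, L, X, S⟩ := by
        rintro e ⟨he, p, hp, u, hu, v, hv, rfl⟩
        exact ⟨he, p, hp, u, hu, v, hv.imp_left fun h => Finset.sdiff_subset h, rfl⟩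
      exact_mod_cast Set.ncard_le_ncard this (Set.toFinite _)

lemma DecomposeInvariant.reaches (hd : ∀ v, G.degree v ≤ d) (hn : 0 < n)
    {st st' : DecomposeState n} (h : DecomposeInvariant G d r δ ε st)
    (hreach : DecomposeReaches G d r δ ε st st') : DecomposeInvariant G d r δ ε st' := by
  induction hreach with
  | refl => exact h
  | tail _ hstep ih => exact ih.step hd hn hstep

/-- Decreases along every step of `Decompose`. -/
def DecomposeState.potential (r : ℕ) (st : DecomposeState n) : ℕ :=
  5 * r ^ 4 + 1 - st.phase + st.S.card

lemma DecomposeStep.potential_lt {st st' : DecomposeState n}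
    (h : DecomposeStep G d r δ ε st st') : st'.potential r < st.potential r := by
  cases h with
  | carve i L X S s P hi hbig hs hP =>
    have hcard := Finset.card_sdiff_add_card_eq_card hP.2.1
    have := hP.1.card_pos
    simp only [DecomposeState.potential]
    omega
  | advance i L X S hi hsmall =>
    have := Finset.card_le_card (Finset.sdiff_subset (s := S) (t := trapped G d δ i S))
    simp only [DecomposeState.potential]
    omega

lemma not_exists_decompose_run : ¬ ∃ run : ℕ → DecomposeState n,
    run 0 = DecomposeState.init n ∧ ∀ k, DecomposeStep G d r δ ε (run k) (run (k + 1)) := by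
  rintro ⟨run, -, hrun⟩
  have h : ∀ k, (run k).potential r + k ≤ (run 0).potential r := by
    intro k
    induction k with
    | zero => simp
    | succ k ih =>
      have := (hrun k).potential_lt
      omega
  have := h ((run 0).potential r + 1)
  omega

lemma exists_reaches_final (hd : ∀ v, G.degree v ≤ d) (hn : 0 < n)
    (hprog : ∀ st, DecomposeInvariant G d r δ ε st → st.phase ≤ 5 * r ^ 4 →
      ∃ st', DecomposeStep G d r δ ε st st') (st : DecomposeState n)
    (h : DecomposeInvariant G d r δ ε st) :
    ∃ out, DecomposeReaches G d r δ ε st out ∧ out.IsFinal r := by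
  induction hk : st.potential r using Nat.strong_induction_on generalizing st with
  | _ k ih =>
    by_cases hphase : st.phase ≤ 5 * r ^ 4
    · obtain ⟨st', hst'⟩ := hprog st h hphase
      obtain ⟨out, hout, hfin⟩ := ih _ (hk ▸ hst'.potential_lt) st' (h.step hd hn hst') rfl
      exact ⟨out, .head hst' hout, hfin⟩
    · exact ⟨st, .refl, le_antisymm h.le (by omega)⟩

/-- If trapped vertices always have pieces, `Decompose` never gets stuck. -/
lemma DecomposeInvariant.exists_step
    (hpiece : ∀ (i : ℕ) (S : Finset (Fin n)), i < 5 * r ^ 4 → IsFree G d δ i S →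
      alpha n r ε * n ≤ (trapped G d δ (i + 1) S).card →
      ∃ s ∈ trapped G d δ (i + 1) S, ∃ P, IsPiece G d δ (alpha n r ε) (i + 1) S s P)
    {st : DecomposeState n} (h : DecomposeInvariant G d r δ ε st) (hphase : st.phase ≤ 5 * r ^ 4) :
    ∃ st', DecomposeStep G d r δ ε st st' := by
  obtain ⟨i, L, X, S⟩ := st
  by_cases hbig : alpha n r ε * n ≤ (trapped G d δ i S).card
  · have h1 := h.one_le
    obtain ⟨j, rfl⟩ : ∃ j, i = j + 1 := ⟨i - 1, by dsimp only at h1; omega⟩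
    obtain ⟨s, hs, P, hP⟩ := hpiece j S hphase h.isFree hbig
    exact ⟨_, .carve _ L X S s P hphase hbig hs hP⟩
  · exact ⟨_, .advance i L X S hphase (not_le.1 hbig)⟩

end Decompose

end MinorFinding

namespace MinorFinding

/-! ### Size of the parameters -/

open Filter in
/-- What has to hold for `n` to be large enough. -/
lemma eventually_large (r d : ℕ) {δ : ℝ} (hδ : 0 < δ) (C : ℝ) :
    ∀ᶠ n : ℕ in atTop, C ≤ (n : ℝ) ^ δ ∧ 1 ≤ Real.log n ∧
      50 * r ^ 4 * Real.log n ≤ (n : ℝ) ^ (δ / 2) ∧ 20 * d ≤ (n : ℝ) ^ (δ / 8) ∧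
      Real.exp (-((n : ℝ) ^ (δ / 2) / 2)) ≤ (((n : ℝ) ^ δ) ^ (5 * r ^ 4 + 6))⁻¹ := by
  have hrpow : ∀ {a : ℝ}, 0 < a → Tendsto (fun n : ℕ => (n : ℝ) ^ a) atTop atTop := fun ha =>
    (tendsto_rpow_atTop ha).comp tendsto_natCast_atTop_atTop
  have hlog : ∀ᶠ n : ℕ in atTop, 50 * r ^ 4 * Real.log n ≤ (n : ℝ) ^ (δ / 2) := by
    have h := ((isLittleO_log_rpow_atTop (half_pos hδ)).const_mul_left (50 * r ^ 4 : ℝ)).bound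
      one_pos
    filter_upwards [tendsto_natCast_atTop_atTop.eventually h] with n hn
    rw [one_mul] at hn
    exact (le_abs_self _).trans (hn.trans_eq (Real.norm_of_nonneg (by positivity)))
  have hexp : ∀ᶠ n : ℕ in atTop,
      Real.exp (-((n : ℝ) ^ (δ / 2) / 2)) ≤ (((n : ℝ) ^ δ) ^ (5 * r ^ 4 + 6))⁻¹ := by
    -- In terms of `y = n^{δ/2}` one has `n^δ = y²`, hence the doubled exponent.
    have h := (isLittleO_pow_exp_pos_mul_atTop (2 * (5 * r ^ 4 + 6)) (half_pos one_pos)).bound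
      one_pos
    filter_upwards [(hrpow (half_pos hδ)).eventually h, eventually_gt_atTop 0] with n hn hn0
    have hn' : (0 : ℝ) < n := by exact_mod_cast hn0
    rw [one_mul, Real.norm_of_nonneg (by positivity), Real.norm_of_nonneg (by positivity),
      pow_mul, sq, ← Real.rpow_add hn', add_halves] at hn
    rw [Real.exp_neg]
    gcongr
    exact hn.trans_eq (by congr 1; ring)
  exact ((hrpow hδ).eventually_ge_atTop C).and
    (((Real.tendsto_log_atTop.comp tendsto_natCast_atTop_atTop).eventually_ge_atTop 1).and
      (hlog.and (((hrpow (by positivity)).eventually_ge_atTop _).and hexp)))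

/-- `⌈1/δ⌉ + 6 ≤ 1/δ + 7`, and `(1/δ + 7) log 2 ≤ 2/δ` as soon as `1/δ ≥ 5`. -/
lemma two_pow_le_exp {δ : ℝ} (hδ : 0 < δ) (hδ' : 5 ≤ 1 / δ) :
    ((2 ^ (⌈1 / δ⌉₊ + 6) : ℕ) : ℝ) ≤ Real.exp (2 / δ) := by
  have hceil := (Nat.ceil_lt_add_one (show 0 ≤ 1 / δ by positivity)).le
  have h2 : (2 : ℝ) = Real.exp (Real.log 2) := (Real.exp_log two_pos).symm
  push_cast
  rw [h2, ← Real.exp_nat_mul, ← h2, Real.exp_le_exp]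
  push_cast
  have hlog := Real.log_two_lt_d9
  have hlog0 := Real.log_two_gt_d9
  have : 2 / δ = 2 * (1 / δ) := by ring
  rw [this]
  nlinarith

lemma rpow_neg_le_cutoff {n : ℕ} (hn : 0 < n) {δ c : ℝ} (hδ : 0 < δ)
    (hc : c ≤ Real.exp (2 / δ)) (hc0 : 0 < c) : (n : ℝ) ^ (-(δ / c)) ≤ cutoff n δ := by
  have hn1 : (1 : ℝ) ≤ n := by exact_mod_cast hn
  rw [cutoff, neg_div]
  refine Real.rpow_le_rpow_of_exponent_le hn1 (neg_le_neg ?_)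
  gcongr

variable {n r : ℕ} {G : SimpleGraph (Fin n)} [DecidableRel G.Adj] {d : ℕ} [NeZero d]

/-- Since `r^4 ≥ 81`, `i + 7 ≤ 6 r^4` and `2i + 14 ≤ 11 r^4` in every phase. -/
lemma IsPiece.reach_le (hr : 3 ≤ r) (hn : 0 < n) {δ α : ℝ} (hδ : 0 < δ) (hα : 0 < α) {i : ℕ}
    (hi : i ≤ 5 * r ^ 4) {S : Finset (Fin n)} {s : Fin n} {P : Finset (Fin n)}
    (h : IsPiece G d δ α i S s P) {v : Fin n} (hv : v ∈ P) :
    ∃ t : ℕ, (t : ℝ) ≤ 160 * (n : ℝ) ^ (6 * δ * r ^ 4) / α ∧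
      α / (n : ℝ) ^ (11 * δ * r ^ 4) ≤ walkProb G d s t v := by
  have hn1 : (1 : ℝ) ≤ n := by exact_mod_cast hn
  have hr4 : (81 : ℝ) ≤ r ^ 4 := by
    have : (3 : ℝ) ≤ r := by exact_mod_cast hr
    calc (81 : ℝ) = 3 ^ 4 := by norm_num
      _ ≤ _ := by gcongr
  have hi' : (i : ℝ) ≤ 5 * r ^ 4 := by exact_mod_cast hi
  obtain ⟨t, ht, ht'⟩ := h.2.2.2 v hv
  refine ⟨t, ht.trans ?_, le_trans ?_ ht'⟩
  · have : (n : ℝ) ^ (δ * (i + 7)) ≤ (n : ℝ) ^ (6 * δ * r ^ 4) :=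
      Real.rpow_le_rpow_of_exponent_le hn1 (by nlinarith)
    gcongr
  · have : (n : ℝ) ^ (δ * (2 * i + 14)) ≤ (n : ℝ) ^ (11 * δ * r ^ 4) :=
      Real.rpow_le_rpow_of_exponent_le hn1 (by nlinarith)
    gcongr

end MinorFinding

/-! ### Assembly -/

theorem mainTheorem5 (r : ℕ) (hr : 3 ≤ r) :
    ∃ δ₀ : ℝ, 0 < δ₀ ∧ ∀ δ : ℝ, 0 < δ → δ < δ₀ → ∀ (d : ℕ) [NeZero d],
    ∃ n₀ : ℕ, ∀ (n : ℕ) [NeZero n], n₀ ≤ n →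
    ∀ (H : SimpleGraph (Fin r)) (G : SimpleGraph (Fin n)) [DecidableRel G.Adj],
    (∀ v, G.degree v ≤ d) →
    ∀ ε : ℝ, MinorFinding.cutoff n δ < ε →
    MinorFinding.findMinorSuccess G d H δ ε < 2 / 3 →
    -- the procedure never gets stuck: every partial run can be completed
    (∀ st, MinorFinding.DecomposeReaches G d r δ ε (MinorFinding.DecomposeState.init n) st →
      ∃ out, MinorFinding.DecomposeReaches G d r δ ε st out ∧ out.IsFinal r) ∧
    -- the procedure always terminates
    (¬ ∃ run : ℕ → MinorFinding.DecomposeState n,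
      run 0 = MinorFinding.DecomposeState.init n ∧
      ∀ k, MinorFinding.DecomposeStep G d r δ ε (run k) (run (k + 1))) ∧
    -- every possible output satisfies the conditions
    ∀ out, MinorFinding.DecomposeReaches G d r δ ε (MinorFinding.DecomposeState.init n) out →
      out.IsFinal r →
      out.IsPartition ∧
      (out.X.card : ℝ) ≤ ε * n / 10 ∧
      (out.S.card : ℝ) ≤ ε * n / 10 ∧
      (∀ p ∈ out.pieces, ∀ v ∈ p.2, ∃ t : ℕ,
        (t : ℝ) ≤ 160 * (n : ℝ) ^ (6 * δ * r ^ 4) / MinorFinding.alpha n r ε ∧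
        MinorFinding.alpha n r ε / (n : ℝ) ^ (11 * δ * r ^ 4) ≤
          MinorFinding.walkProb G d p.1 t v) ∧
      ((MinorFinding.crossEdges G out.pieces).ncard : ℝ) ≤ ε * n / 10 := by
  open MinorFinding in
  have hr0 : (0 : ℝ) < r ^ 4 := by positivity
  have hr81 : 81 ≤ r ^ 4 := (show 81 = 3 ^ 4 by norm_num) ▸ Nat.pow_le_pow_left hr 4
  have hr81' : (81 : ℝ) ≤ r ^ 4 := by exact_mod_cast hr81
  -- With this `δ₀` the loop of FindBiclique extends beyond `5 r^4`, so there are phases left after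
  -- those of Decompose.
  refine ⟨1 / (5 * r ^ 4), by positivity, fun δ hδ hδ₀ d _ => ?_⟩
  have hδinv : (5 * r ^ 4 : ℝ) < 1 / δ := by
    rw [lt_div_iff₀ (by positivity)] at hδ₀
    rw [lt_div_iff₀ hδ]
    linarith
  have hI : 5 * r ^ 4 < ⌈1 / δ⌉₊ + 4 := by
    have h := hδinv.trans_le (Nat.le_ceil (1 / δ))
    have : 5 * r ^ 4 < ⌈1 / δ⌉₊ := by exact_mod_cast h
    omega
  have hexp := two_pow_le_exp hδ (by linarith)
  have hexp8 : (8 : ℝ) ≤ Real.exp (2 / δ) := by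
    refine le_trans ?_ hexp
    exact_mod_cast (Nat.pow_le_pow_right two_pos (by omega) : 2 ^ 3 ≤ 2 ^ (⌈1 / δ⌉₊ + 6))
  obtain ⟨n₀, hn₀⟩ := Filter.eventually_atTop.1 (eventually_large r d hδ
    (max (max (4 ^ r ^ 4 * (64 * ((r ^ 4 : ℕ) : ℝ) ^ 2 * 4 ^ (⌈1 / δ⌉₊ + 6) + 1))
      (20 ^ 2 ^ (⌈1 / δ⌉₊ + 6))) (max (400 * ((⌈1 / δ⌉₊ + 4 : ℕ) : ℝ)) 17)))
  refine ⟨n₀, fun n _ hn H G _ hd ε hε hfail => ?_⟩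
  obtain ⟨hC, hlog, hlog', hdn, hdecay⟩ := hn₀ n hn
  simp only [max_le_iff] at hC
  obtain ⟨⟨hx₁, hx₂⟩, hx₃, hx₄⟩ := hC
  have hnpos : 0 < n := Nat.pos_of_ne_zero (NeZero.ne n)
  have hn' : (0 : ℝ) < n := by exact_mod_cast hnpos
  have hε0 : 0 < ε := (Real.rpow_pos_of_pos hn' _).trans hε
  have hα : 0 < alpha n r ε := by rw [alpha]; positivity
  -- The cutoff is at least `n^{-δ/2}`; the other half of the exponent absorbs `50 r^4 log n`.
  have hα' : ((n : ℝ) ^ δ)⁻¹ ≤ alpha n r ε := by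
    have h1 := (rpow_neg_le_cutoff hnpos hδ (by linarith) two_pos).trans hε.le
    rw [alpha, le_div_iff₀ (by positivity)]
    refine le_trans ?_ h1
    calc ((n : ℝ) ^ δ)⁻¹ * (50 * r ^ 4 * Real.log n) ≤ ((n : ℝ) ^ δ)⁻¹ * (n : ℝ) ^ (δ / 2) := by
          gcongr
      _ = _ := by
          rw [← Real.rpow_neg hn'.le, ← Real.rpow_add hn']
          congr 1; ring
  have hinv : ∀ st, DecomposeReaches G d r δ ε (DecomposeState.init n) st →
      DecomposeInvariant G d r δ ε st := fun st => decomposeInvariant_init.reaches hd hnpos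
  refine ⟨fun st hst => exists_reaches_final hd hnpos (fun st' h => h.exists_step
    fun i S hi hfree hbig => exists_isPiece_of_trapped hnpos hd hδ hi hfree hα hα' hbig
      (by linarith) hdecay) st (hinv st hst), not_exists_decompose_run, fun out hout hfin => ?_⟩
  have h := hinv out hout
  have hphase : out.phase = 5 * r ^ 4 + 1 := hfin
  refine ⟨h.isPartition, ?_, ?_, fun p hp v hv => ?_, ?_⟩
  -- The `5 r^4` phases contribute at most `αn` each, together `εn / (10 log n)`.
  · refine h.card_X.trans ?_
    rw [hphase, alpha]
    have e : ((5 * r ^ 4 + 1 : ℕ) - 1 : ℝ) * (ε / (50 * r ^ 4 * Real.log n) * n) =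
        ε * n / 10 / Real.log n := by
      push_cast
      field_simp
      ring
    rw [e]
    exact div_le_self (by positivity) hlog
  · have hfree := h.isFree
    rw [hphase, Nat.add_sub_cancel] at hfree
    exact card_le_of_isFree hr H hd hδ hI hexp hx₁ hx₂ hx₃ hε hfail hfree
  · obtain ⟨i, hi, S, hP⟩ := h.pieces p hp
    exact hP.reach_le hr hnpos hδ hα hi hv
  -- Of `n^{-δ/4}`, one half of the exponent absorbs `20 d`; the other gives `n^{-δ/8}`, which is at
  -- most the cutoff.
  · have h1 := (rpow_neg_le_cutoff hnpos hδ hexp8 (by norm_num)).trans hε.le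
    have h2 : ((crossEdges G out.pieces).ncard : ℝ) ≤ (leavingEdges G out).ncard := by
      exact_mod_cast Set.ncard_le_ncard (crossEdges_subset_leavingEdges out) (Set.toFinite _)
    have h3 : (((out.pieces.map fun p => p.2.card).sum : ℕ) : ℝ) ≤ n := by
      exact_mod_cast le_self_add.trans h.card_le
    have e : (n : ℝ) ^ (-δ / 4) * (n : ℝ) ^ (δ / 8) = (n : ℝ) ^ (-(δ / 8)) := by
      rw [← Real.rpow_add hn']
      congr 1; ring
    calc _ ≤ 2 * (n : ℝ) ^ (-δ / 4) * d * n := h2.trans (h.leaving.trans (by gcongr))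
      _ = (n : ℝ) ^ (-δ / 4) * (20 * d) * n / 10 := by ring
      _ ≤ (n : ℝ) ^ (-δ / 4) * (n : ℝ) ^ (δ / 8) * n / 10 := by gcongr
      _ ≤ ε * n / 10 := by rw [e]; gcongr
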